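/- **Processes.** Fix a set of tags, a set of process names and an infinite set of channels. Processes are $$P,Q ::= \mathsf{done} \mid A\langle\overline{x}\rangle \mid x\leftrightarrow y \mid \mathsf{close}\,x \mid \mathsf{wait}\,x.P \mid x!a.P \mid \mathsf{case}\,x\{a_i:P_i\}_{i\in I} \mid x[y](P\mid Q) \mid x(y).P \mid P\oplus Q \mid (x)(P\mid Q)$$ where $x[y](P\mid Q)$ (send on $x$ a fresh channel $y$ used by $P$, continue as $Q$) binds $y$ in $P$ only, $x(y).P$ binds $y$ in $P$, and the cut $(x)(P\mid Q)$ binds $x$ in $P$ and $Q$. Processes are identified up to renaming of bound channels, and $\mathrm{fn}(P)$ is the set of free channels of $P$. Every process name $A$ has one global definition $A(\overline{x})=P$ with $\mathrm{fn}(P)=\{\overline{x}\}$, in which all invocations occur below a prefix or a choice. Buffers are $B_x ::= [\,] \mid x!a.B_x \mid x[y](P\mid B_x)$, and $B_x[P]$ is the result of filling the hole with $P$. *Structural pre-congruence* $\sqsupseteq$ is the least preorder closed under all process constructors such that (bound names being renamed so that nothing is captured, and no channel leaving the scope of its binder) - $A\langle\overline{x}\rangle\sqsupseteq P$ if $A(\overline{x})=P$;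 $\ x\leftrightarrow y\sqsupseteq y\leftrightarrow x$; $\ (x)(P\mid Q)\sqsupseteq(x)(Q\mid P)$; - for $x\ne y$: $(x)(B_x[\mathsf{wait}\,y.P]\mid Q)\sqsupseteq \mathsf{wait}\,y.(x)(B_x[P]\mid Q)$; $\ (x)(B_x[\mathsf{case}\,y\{a_i:P_i\}_{i\in I}]\mid Q)\sqsupseteq \mathsf{case}\,y\{a_i:(x)(B_x[P_i]\mid Q)\}_{i\in I}$; $\ (x)(B_x[y(z).P]\mid Q)\sqsupseteq y(z).(x)(B_x[P]\mid Q)$; - $(x)(B_x[P]\mid B'_x[x\leftrightarrow y])\sqsupseteq B_y[(x)(P\mid B'_x[x\leftrightarrow y])]$, where $B_y$ is $B_x$ with $x$ replaced by $y$; - for $x\neq y$: $(x)(y[z](P\mid Q)\mid R)\sqsupseteq y[z]((x)(P\mid R)\mid Q)$ if $x\in\mathrm{fn}(P)$, $x\notin\mathrm{fn}(Q)$; $\ (x)(B_y[P]\mid Q)\sqsupseteq B_y[(x)(P\mid Q)]$ if $x\notin\mathrm{fn}(B_y)$; $\ B_x[y[z](P\mid Q)]\sqsupseteq y[z](B_x[P]\mid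 Q)$ if $x\in\mathrm{fn}(P)$; $\ B_x[B'_y[P]]\sqsupseteq B'_y[B_x[P]]$ if $x\in\mathrm{fn}(P)$. *Reduction* $\to$ is the least relation with $P_1\oplus P_2\to P_k$ ($k=1,2$); $(x)(x\leftrightarrow y\mid P)\to P\{y/x\}$; $(x)(\mathsf{close}\,x\mid\mathsf{wait}\,x.P)\to P$ (with $x\notin\mathrm{fn}(P)$); $(x)(x!a_k.P\mid B_x[\mathsf{case}\,x\{a_i:Q_i\}_{i\in I}])\to(x)(P\mid B_x[Q_k])$ for $k\in I$; $(x)(x[y](P\mid Q)\mid B_x[x(y).R])\to(y)(P\mid(x)(Q\mid B_x[R]))$ (with $x\notin\mathrm{fn}(P)$); $(x)(P\mid R)\to(x)(Q\mid R)$ and $B_x[P]\to B_x[Q]$ whenever $P\to Q$; and $P\to Q$ whenever $P\sqsupseteq R\to Q$. **Runs.** A run of $P$ is a maximal (infinite, or ending in an irreducible process) sequence $P=P_0\to P_1\to\cdots$. $P$ is *weakly terminating* if it has a finite run. A run is *fair* if $P_i$ is weakly terminating for only finitely many indices $i$. $P$ is *fairly terminating* if every fair run of $P$ is finite. **Session types**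 are the possibly infinite regular trees generated by $$S,T ::= \mathbf 1\mid\bot\mid\oplus\{^{m_i}a_i:S_i\}_{i\in I}\mid\&\{^{m_i}a_i:S_i\}_{i\in I}\mid S\otimes T\mid S⅋T$$ with $I$ finite and non-empty, the tags $a_i$ pairwise distinct and annotations $m_i\in\mathbb N$. The types $\mathbf 1$, $\oplus\{\cdots\}$, $S\otimes T$ are *positive*. The dual $S^\perp$ exchanges $\mathbf 1/\bot$, $\oplus/\&$, $\otimes/⅋$ everywhere and keeps tags and annotations. Transitions $S\xrightarrow{\alpha}T$, with $\alpha={!}\sigma$ or ${?}\sigma$ and $\sigma$ either $*$, an annotated tag $^ma$, or a session type, are defined by the rules - $\mathbf 1\xrightarrow{!*}\mathbf 1$; $\ \bot\xrightarrow{?*}\bot$; $\ \oplus\{^{m_i}a_i:S_i\}\xrightarrow{!\,^{m_k}a_k}S_k$; $\ \&\{^{m_i}a_i:S_i\}\xrightarrow{?\,^{m_k}a_k}S_k$; $\ S\otimes T\xrightarrow{!S}T$; $\ S⅋T\xrightarrow{?S}T$; - if $S_i\xrightarrow{?\sigma}T_i$ for all $i\in I$ then $\oplus\{^{m_i}a_i:S_i\}_{i\in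 I}\xrightarrow{?\sigma}\oplus\{^{m_i}a_i:T_i\}_{i\in I}$; if $S_i\xrightarrow{!\sigma}T_i$ for all $i\in I$ then $\&\{^{m_i}a_i:S_i\}_{i\in I}\xrightarrow{!\sigma}\&\{^{m_i}a_i:T_i\}_{i\in I}$; - if $T\xrightarrow{?\sigma}T'$ then $S\otimes T\xrightarrow{?\sigma}S\otimes T'$; if $T\xrightarrow{!\sigma}T'$ then $S⅋T\xrightarrow{!\sigma}S⅋T'$; and by the two corules that draw the conclusions of the second item when the premise holds for just one $k\in I$ (the other $T_i$ being arbitrary). The relation is the bounded coinductive interpretation: the largest relation consistent with the rules and contained in the inductive interpretation of rules and corules. *Correct composition* $S\bowtie T$ is the largest relation such that $S\bowtie T$ implies: $S$ or $T$ is positive; for $\sigma$ equal to $*$ or an annotated tag, $S\xrightarrow{!\sigma}S'$ implies $T\xrightarrow{?\sigma}T'$ for some $T'$ with $S'\bowtie T'$; $S\xrightarrow{!S_1}S_2$ implies $T\xrightarrow{?T_1}T_2$ for some $T_1,T_2$ with $S_1\bowtie T_1$ and $S_2\bowtie T_2$; and the last two conditions with the roles of $S$ and $T$ exchanged. *Fair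 asynchronous subtyping*: $S\leqslant T$ if $R\bowtie T$ implies $R\bowtie S$ for every session type $R$. **Typing.** Judgments $P\vdash^n\Gamma$, where $\Gamma$ is a partial map from channels to session types and $n\in\mathbb N$ is a measure, are defined by the following rules, interpreted coinductively (derivations may be infinite); "$\Gamma,\Delta$" requires disjoint domains. - $\mathsf{done}\vdash^n\emptyset$; $\ \mathsf{close}\,x\vdash^n x:\mathbf 1$ if $n\ge1$; $\ x\leftrightarrow y\vdash^n x:S,y:T$ if $n\ge 1$ and $S^\perp\leqslant T$; - $A\langle\overline{x}\rangle\vdash^n\overline{x:S}$ if $A(\overline{x})=P$, $P\vdash^m\overline{x:S}$ and $m\le n$; - $P\oplus Q\vdash^{1+n_k}\Gamma$ if $P\vdash^{n_1}\Gamma$, $Q\vdash^{n_2}\Gamma$ and $k\in\{1,2\}$; - $(x)(P\mid Q)\vdash^{m+n}\Gamma,\Delta$ if $P\vdash^m\Gamma,x:S$, $Q\vdash^n\Delta,x:T$ and $S\bowtie T$; - $\mathsf{wait}\,x.P\vdash^n\Gamma,x:\bot$ if $P\vdash^n\Gamma$; - $x!a_k.P\vdash^{1+m_k+n}\Gamma,x:\oplus\{^{m_i}a_i:S_i\}_{i\in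 I}$ if $k\in I$ and $P\vdash^n\Gamma,x:S_k$; - $\mathsf{case}\,x\{a_i:P_i\}_{i\in I}\vdash^n\Gamma,x:\&\{^{m_i}a_i:S_i\}_{i\in J}$ if $J\subseteq I$, $P_i\vdash^{n+m_i}\Gamma,x:S_i$ for all $i\in J$, and $\mathrm{fn}(P_i)\subseteq\mathrm{dom}(\Gamma)\cup\{x\}$ for $i\in I\setminus J$; - $x[y](P\mid Q)\vdash^{1+m+n}\Gamma,\Delta,x:S\otimes T$ if $P\vdash^m\Gamma,y:S$ and $Q\vdash^n\Delta,x:T$; - $x(y).P\vdash^n\Gamma,x:S⅋T$ if $P\vdash^n\Gamma,y:S,x:T$. **Statement (well-typed processes are fairly terminating).** If $P\vdash^n\emptyset$ for some $n$, then $P$ is fairly terminating: every fair run of $P$ is finite. Consequently there is no starvation and there are no orphan messages: the last process $Q$ of every fair run of $P$ satisfies $Q\sqsupseteq\mathsf{done}$, that is, in $Q$ no action is pending, all sessions are closed and all messages have been consumed. -/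

import Mathlib

/-! # Session types -/

namespace CaP

/-- Node labels of session types. The branches of `plus` and `amp` are indexed by a finite
non-empty set of (pairwise distinct) tags, and each tag carries a measure annotation. -/
inductive Shape (Tag : Type) : Type
  | one : Shape Tag
  | bot : Shape Tag
  | plus (I : Finset Tag) (hI : I.Nonempty) (m : {a // a ∈ I} → ℕ) : Shape Tag
  | amp (I : Finset Tag) (hI : I.Nonempty) (m : {a // a ∈ I} → ℕ) : Shape Tag
  | tensor : Shape Tag
  | par : Shape Tag

/-- The index type of the children of a node. -/
abbrev Shape.Children {Tag : Type} : Shape Tag → Type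
  | .one => Empty
  | .bot => Empty
  | .plus I _ _ => {a // a ∈ I}
  | .amp I _ _ => {a // a ∈ I}
  | .tensor => Bool
  | .par => Bool

/-- The polynomial functor of session types. -/
abbrev typeFunctor (Tag : Type) : PFunctor.{0, 0} := ⟨Shape Tag, Shape.Children⟩

/-- Possibly infinite session type trees. Session types are the regular ones (`Regular`). -/
abbrev SType (Tag : Type) : Type := (typeFunctor Tag).M

namespace SType

variable {Tag : Type}

/-- The type `𝟏`. -/
def one : SType Tag := PFunctor.M.mk ⟨Shape.one, fun e : Empty => e.elim⟩

/-- The type `⊥`. -/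
def bot : SType Tag := PFunctor.M.mk ⟨Shape.bot, fun e : Empty => e.elim⟩

/-- The type `⊕{ᵐⁱaᵢ : Kᵢ}`, for `i ∈ I`. -/
def plus (I : Finset Tag) (hI : I.Nonempty) (m : {a // a ∈ I} → ℕ)
    (K : {a // a ∈ I} → SType Tag) : SType Tag :=
  PFunctor.M.mk ⟨Shape.plus I hI m, K⟩

/-- The type `&{ᵐⁱaᵢ : Kᵢ}`, for `i ∈ I`. -/
def amp (I : Finset Tag) (hI : I.Nonempty) (m : {a // a ∈ I} → ℕ)
    (K : {a // a ∈ I} → SType Tag) : SType Tag :=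
  PFunctor.M.mk ⟨Shape.amp I hI m, K⟩

/-- The type `S ⊗ T`: output of a channel of type `S`, then `T`. -/
def tensor (S T : SType Tag) : SType Tag :=
  PFunctor.M.mk ⟨Shape.tensor, fun b : Bool => match b with | false => S | true => T⟩

/-- The type `S ⅋ T`: input of a channel of type `S`, then `T`. -/
def par (S T : SType Tag) : SType Tag :=
  PFunctor.M.mk ⟨Shape.par, fun b : Bool => match b with | false => S | true => T⟩

/-- One unfolding step of duality: exchange the root connective with its dual. -/
def dualStep : (typeFunctor Tag) (SType Tag) → (typeFunctor Tag) (SType Tag)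
  | ⟨.one, k⟩ => ⟨Shape.bot, k⟩
  | ⟨.bot, k⟩ => ⟨Shape.one, k⟩
  | ⟨.plus I hI m, k⟩ => ⟨Shape.amp I hI m, k⟩
  | ⟨.amp I hI m, k⟩ => ⟨Shape.plus I hI m, k⟩
  | ⟨.tensor, k⟩ => ⟨Shape.par, k⟩
  | ⟨.par, k⟩ => ⟨Shape.tensor, k⟩

/-- The dual session type: every connective, at every depth, is exchanged with its dual. -/
def dual : SType Tag → SType Tag := PFunctor.M.corec (fun S => dualStep S.dest)

/-- A tree is regular if it has finitely many distinct subtrees. -/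
def Regular (S : SType Tag) : Prop :=
  {T : SType Tag | Relation.ReflTransGen (fun U V => ∃ i, U.children i = V) S T}.Finite

/-- Positive types are those built with `𝟏`, `⊕` and `⊗`. -/
def Pos (S : SType Tag) : Prop :=
  match S.dest.1 with
  | Shape.one => True
  | Shape.plus _ _ _ => True
  | Shape.tensor => True
  | _ => False

/-- Messages: the termination signal `*`, an annotated tag, or a channel of a given type. -/
inductive Msg (Tag : Type) : Type
  | star : Msg Tag
  | tag (m : ℕ) (a : Tag) : Msg Tag
  | chan (S : SType Tag) : Msg Tag

/-- Actions: input or output of a message. -/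
inductive Act (Tag : Type) : Type
  | inp (σ : Msg Tag) : Act Tag
  | out (σ : Msg Tag) : Act Tag

/-- One application of a (non-corule) rule of the transition system of session types, with
premises in `X`. Besides the immediate transitions there are late inputs (inputs performed
after pending outputs) and early outputs (outputs performed before pending inputs). -/
inductive TransStep (X : SType Tag → Act Tag → SType Tag → Prop) :
    SType Tag → Act Tag → SType Tag → Prop
  | must_one : TransStep X one (.out .star) one
  | must_bot : TransStep X bot (.inp .star) bot
  | must_plus (I : Finset Tag) (hI : I.Nonempty) (m : {a // a ∈ I} → ℕ)
      (K : {a // a ∈ I} → SType Tag) (k : {a // a ∈ I}) :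
      TransStep X (plus I hI m K) (.out (.tag (m k) k)) (K k)
  | must_amp (I : Finset Tag) (hI : I.Nonempty) (m : {a // a ∈ I} → ℕ)
      (K : {a // a ∈ I} → SType Tag) (k : {a // a ∈ I}) :
      TransStep X (amp I hI m K) (.inp (.tag (m k) k)) (K k)
  | must_tensor (S T : SType Tag) : TransStep X (tensor S T) (.out (.chan S)) T
  | must_par (S T : SType Tag) : TransStep X (par S T) (.inp (.chan S)) T
  | may_plus (I : Finset Tag) (hI : I.Nonempty) (m : {a // a ∈ I} → ℕ)
      (K K' : {a // a ∈ I} → SType Tag) (σ : Msg Tag) (h : ∀ i, X (K i) (.inp σ) (K' i)) :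
      TransStep X (plus I hI m K) (.inp σ) (plus I hI m K')
  | may_amp (I : Finset Tag) (hI : I.Nonempty) (m : {a // a ∈ I} → ℕ)
      (K K' : {a // a ∈ I} → SType Tag) (σ : Msg Tag) (h : ∀ i, X (K i) (.out σ) (K' i)) :
      TransStep X (amp I hI m K) (.out σ) (amp I hI m K')
  | may_tensor (S T T' : SType Tag) (σ : Msg Tag) (h : X T (.inp σ) T') :
      TransStep X (tensor S T) (.inp σ) (tensor S T')
  | may_par (S T T' : SType Tag) (σ : Msg Tag) (h : X T (.out σ) T') :
      TransStep X (par S T) (.out σ) (par S T')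

/-- The inductive interpretation of the rules together with the two corules `fair_plus` and
`fair_amp`. -/
inductive IndTrans : SType Tag → Act Tag → SType Tag → Prop
  | must_one : IndTrans one (.out .star) one
  | must_bot : IndTrans bot (.inp .star) bot
  | must_plus (I : Finset Tag) (hI : I.Nonempty) (m : {a // a ∈ I} → ℕ)
      (K : {a // a ∈ I} → SType Tag) (k : {a // a ∈ I}) :
      IndTrans (plus I hI m K) (.out (.tag (m k) k)) (K k)
  | must_amp (I : Finset Tag) (hI : I.Nonempty) (m : {a // a ∈ I} → ℕ)
      (K : {a // a ∈ I} → SType Tag) (k : {a // a ∈ I}) :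
      IndTrans (amp I hI m K) (.inp (.tag (m k) k)) (K k)
  | must_tensor (S T : SType Tag) : IndTrans (tensor S T) (.out (.chan S)) T
  | must_par (S T : SType Tag) : IndTrans (par S T) (.inp (.chan S)) T
  | may_plus (I : Finset Tag) (hI : I.Nonempty) (m : {a // a ∈ I} → ℕ)
      (K K' : {a // a ∈ I} → SType Tag) (σ : Msg Tag)
      (h : ∀ i, IndTrans (K i) (.inp σ) (K' i)) :
      IndTrans (plus I hI m K) (.inp σ) (plus I hI m K')
  | may_amp (I : Finset Tag) (hI : I.Nonempty) (m : {a // a ∈ I} → ℕ)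
      (K K' : {a // a ∈ I} → SType Tag) (σ : Msg Tag)
      (h : ∀ i, IndTrans (K i) (.out σ) (K' i)) :
      IndTrans (amp I hI m K) (.out σ) (amp I hI m K')
  | may_tensor (S T T' : SType Tag) (σ : Msg Tag) (h : IndTrans T (.inp σ) T') :
      IndTrans (tensor S T) (.inp σ) (tensor S T')
  | may_par (S T T' : SType Tag) (σ : Msg Tag) (h : IndTrans T (.out σ) T') :
      IndTrans (par S T) (.out σ) (par S T')
  | fair_plus (I : Finset Tag) (hI : I.Nonempty) (m : {a // a ∈ I} → ℕ)
      (K K' : {a // a ∈ I} → SType Tag) (σ : Msg Tag) (k : {a // a ∈ I})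
      (h : IndTrans (K k) (.inp σ) (K' k)) :
      IndTrans (plus I hI m K) (.inp σ) (plus I hI m K')
  | fair_amp (I : Finset Tag) (hI : I.Nonempty) (m : {a // a ∈ I} → ℕ)
      (K K' : {a // a ∈ I} → SType Tag) (σ : Msg Tag) (k : {a // a ∈ I})
      (h : IndTrans (K k) (.out σ) (K' k)) :
      IndTrans (amp I hI m K) (.out σ) (amp I hI m K')

/-- The fair asynchronous transition relation of session types, by bounded coinduction: the
largest relation that is consistent with the rules and is included in the inductive
interpretation of rules and corules. -/
def Trans (S : SType Tag) (α : Act Tag) (T : SType Tag) : Prop :=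
  ∃ X : SType Tag → Act Tag → SType Tag → Prop,
    (∀ S α T, X S α T → TransStep X S α T ∧ IndTrans S α T) ∧ X S α T

/-- `R` is a correct asynchronous composition. -/
structure IsCorrectComposition (R : SType Tag → SType Tag → Prop) : Prop where
  pol : ∀ S T, R S T → Pos S ∨ Pos T
  out_inp : ∀ S T, R S T → ∀ σ : Msg Tag, (σ = .star ∨ ∃ m a, σ = .tag m a) →
    ∀ S', Trans S (.out σ) S' → ∃ T', Trans T (.inp σ) T' ∧ R S' T'
  inp_out : ∀ S T, R S T → ∀ σ : Msg Tag, (σ = .star ∨ ∃ m a, σ = .tag m a) →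
    ∀ T', Trans T (.out σ) T' → ∃ S', Trans S (.inp σ) S' ∧ R S' T'
  out_inp_chan : ∀ S T, R S T → ∀ S₁ S₂, Trans S (.out (.chan S₁)) S₂ →
    ∃ T₁ T₂, Trans T (.inp (.chan T₁)) T₂ ∧ R S₁ T₁ ∧ R S₂ T₂
  inp_out_chan : ∀ S T, R S T → ∀ T₁ T₂, Trans T (.out (.chan T₁)) T₂ →
    ∃ S₁ S₂, Trans S (.inp (.chan S₁)) S₂ ∧ R S₁ T₁ ∧ R S₂ T₂

/-- `S` and `T` compose correctly: the largest correct asynchronous composition. -/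
def Correct (S T : SType Tag) : Prop :=
  ∃ R : SType Tag → SType Tag → Prop, IsCorrectComposition R ∧ R S T

/-- Fair asynchronous subtyping: every session type composing correctly with `T` composes
correctly with `S`. -/
def Subt (S T : SType Tag) : Prop :=
  ∀ R : SType Tag, Regular R → Correct R T → Correct R S

end SType

/-! # Processes

Processes up to renaming of bound channels, in de Bruijn notation: channels are natural
numbers, and below a binder the bound channel is `0` and the outer channel `x` is `x + 1`. -/

/-- Processes over the tags `Tag` and the process names `Name`. -/
inductive Proc (Tag Name : Type) : Type
  /-- the terminated process -/
  | done : Proc Tag Name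
  /-- invocation of a process name -/
  | call (A : Name) (xs : List ℕ) : Proc Tag Name
  /-- link of two channels -/
  | link (x y : ℕ) : Proc Tag Name
  /-- signal output -/
  | close (x : ℕ) : Proc Tag Name
  /-- signal input -/
  | wait (x : ℕ) (P : Proc Tag Name) : Proc Tag Name
  /-- tag output -/
  | select (x : ℕ) (a : Tag) (P : Proc Tag Name) : Proc Tag Name
  /-- tag input -/
  | offer (x : ℕ) (I : Finset Tag) (F : {a // a ∈ I} → Proc Tag Name) : Proc Tag Name
  /-- output on `x` of a fresh channel, bound in `P` (not in the continuation `Q`) -/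
  | fork (x : ℕ) (P Q : Proc Tag Name) : Proc Tag Name
  /-- input from `x` of a channel, bound in `P` -/
  | join (x : ℕ) (P : Proc Tag Name) : Proc Tag Name
  /-- non-deterministic choice -/
  | choice (P Q : Proc Tag Name) : Proc Tag Name
  /-- composition of two processes connected by a channel bound in both -/
  | cut (P Q : Proc Tag Name) : Proc Tag Name

/-- Extension of a renaming below a binder. -/
def lift (ρ : ℕ → ℕ) : ℕ → ℕ
  | 0 => 0
  | n + 1 => ρ n + 1

/-- The renaming that replaces the bound channel `0` by the outer channel `y`, leaving the
scope of the binder. -/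
def inst (y : ℕ) : ℕ → ℕ
  | 0 => y
  | n + 1 => n

/-- The renaming that exchanges the two innermost bound channels. -/
def swap : ℕ → ℕ
  | 0 => 1
  | 1 => 0
  | n + 2 => n + 2

namespace Proc

variable {Tag Name : Type}

/-- Renaming of the free channels. -/
def rename (ρ : ℕ → ℕ) : Proc Tag Name → Proc Tag Name
  | done => done
  | call A xs => call A (xs.map ρ)
  | link x y => link (ρ x) (ρ y)
  | close x => close (ρ x)
  | wait x P => wait (ρ x) (P.rename ρ)
  | select x a P => select (ρ x) a (P.rename ρ)
  | offer x I F => offer (ρ x) I (fun i => (F i).rename ρ)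
  | fork x P Q => fork (ρ x) (P.rename (lift ρ)) (Q.rename ρ)
  | join x P => join (ρ x) (P.rename (lift ρ))
  | choice P Q => choice (P.rename ρ) (Q.rename ρ)
  | cut P Q => cut (P.rename (lift ρ)) (Q.rename (lift ρ))

/-- The set of free channels. -/
def fn : Proc Tag Name → Set ℕ
  | done => ∅
  | call _ xs => {x | x ∈ xs}
  | link x y => {x, y}
  | close x => {x}
  | wait x P => {x} ∪ P.fn
  | select x _ P => {x} ∪ P.fn
  | offer x _ F => {x} ∪ {z | ∃ i, z ∈ (F i).fn}
  | fork x P Q => {x} ∪ {z | z + 1 ∈ P.fn} ∪ Q.fn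
  | join x P => {x} ∪ {z | z + 1 ∈ P.fn}
  | choice P Q => P.fn ∪ Q.fn
  | cut P Q => {z | z + 1 ∈ P.fn} ∪ {z | z + 1 ∈ Q.fn}

/-- Every invocation in the process is guarded by a prefix or by a choice. -/
def Guarded : Proc Tag Name → Prop
  | call _ _ => False
  | cut P Q => P.Guarded ∧ Q.Guarded
  | _ => True

end Proc

/-- The global process definitions, one for each process name. The formal parameters of `A` are
the channels `0, …, arity A - 1`; they are the free channels of the body. Invocations in bodies
are guarded. -/
structure Program (Tag Name : Type) where
  arity : Name → ℕ
  body : Name → Proc Tag Name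
  fn_body : ∀ A, (body A).fn = {x | x < arity A}
  guarded : ∀ A, (body A).Guarded

/-- Buffers `B_x`; the channel `x` on which the messages are sent is supplied by `fill`. -/
inductive Buffer (Tag Name : Type) : Type
  | hole : Buffer Tag Name
  | select (a : Tag) (B : Buffer Tag Name) : Buffer Tag Name
  /-- the fresh channel is bound in `P` -/
  | fork (P : Proc Tag Name) (B : Buffer Tag Name) : Buffer Tag Name

namespace Buffer

variable {Tag Name : Type}

/-- `B.fill x P` is `B_x[P]`. -/
def fill (x : ℕ) : Buffer Tag Name → Proc Tag Name → Proc Tag Name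
  | hole, P => P
  | select a B, P => .select x a (B.fill x P)
  | fork Q B, P => .fork x Q (B.fill x P)

/-- Renaming of the free channels (other than the subject of the messages). -/
def rename (ρ : ℕ → ℕ) : Buffer Tag Name → Buffer Tag Name
  | hole => hole
  | select a B => select a (B.rename ρ)
  | fork P B => fork (P.rename (lift ρ)) (B.rename ρ)

end Buffer

open Proc in
/-- Structural pre-congruence. A process of the form `P.rename Nat.succ` below a binder is one in
which the bound channel is not free. -/
inductive PCong {Tag Name : Type} (D : Program Tag Name) :
    Proc Tag Name → Proc Tag Name → Prop
  | s_call (A : Name) (xs : List ℕ) (h : xs.length = D.arity A) :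
      PCong D (call A xs) ((D.body A).rename (fun i => xs.getD i 0))
  | s_link (x y : ℕ) : PCong D (link x y) (link y x)
  | s_comm (P Q : Proc Tag Name) : PCong D (cut P Q) (cut Q P)
  | s_wait (B : Buffer Tag Name) (y : ℕ) (P Q : Proc Tag Name) :
      PCong D (cut (B.fill 0 (wait (y + 1) P)) Q) (wait y (cut (B.fill 0 P) Q))
  | s_case (B : Buffer Tag Name) (y : ℕ) (I : Finset Tag)
      (F : {a // a ∈ I} → Proc Tag Name) (Q : Proc Tag Name) :
      PCong D (cut (B.fill 0 (offer (y + 1) I F)) Q)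
        (offer y I (fun i => cut (B.fill 0 (F i)) Q))
  | s_join (B : Buffer Tag Name) (y : ℕ) (P Q : Proc Tag Name) :
      PCong D (cut (B.fill 0 (join (y + 1) P)) Q)
        (join y (cut ((B.rename (lift Nat.succ)).fill 0 (P.rename swap))
          (Q.rename (lift Nat.succ))))
  | s_pull_0 (B B' : Buffer Tag Name) (y : ℕ) (P : Proc Tag Name) :
      PCong D (cut (B.fill 0 P) (B'.fill 0 (link 0 (y + 1))))
        ((B.rename (inst y)).fill y (cut P (B'.fill 0 (link 0 (y + 1)))))
  | s_pull_1 (y : ℕ) (P Q R : Proc Tag Name) (h : 1 ∈ P.fn) :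
      PCong D (cut (fork (y + 1) P (Q.rename Nat.succ)) R)
        (fork y (cut (P.rename swap) (R.rename (lift Nat.succ))) Q)
  | s_pull_2 (B : Buffer Tag Name) (y : ℕ) (P Q : Proc Tag Name) :
      PCong D (cut ((B.rename Nat.succ).fill (y + 1) P) Q) (B.fill y (cut P Q))
  | s_pull_3 (B : Buffer Tag Name) (x y : ℕ) (P Q : Proc Tag Name)
      (hxy : x ≠ y) (h : x + 1 ∈ P.fn) :
      PCong D (B.fill x (fork y P Q)) (fork y ((B.rename Nat.succ).fill (x + 1) P) Q)
  | s_pull_4 (B B' : Buffer Tag Name) (x y : ℕ) (P : Proc Tag Name)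
      (hxy : x ≠ y) (h : x ∈ P.fn) :
      PCong D (B.fill x (B'.fill y P)) (B'.fill y (B.fill x P))
  | refl (P : Proc Tag Name) : PCong D P P
  | trans (P Q R : Proc Tag Name) (h : PCong D P Q) (h' : PCong D Q R) : PCong D P R
  | c_wait (x : ℕ) (P P' : Proc Tag Name) (h : PCong D P P') :
      PCong D (wait x P) (wait x P')
  | c_select (x : ℕ) (a : Tag) (P P' : Proc Tag Name) (h : PCong D P P') :
      PCong D (select x a P) (select x a P')
  | c_offer (x : ℕ) (I : Finset Tag) (F F' : {a // a ∈ I} → Proc Tag Name)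
      (h : ∀ i, PCong D (F i) (F' i)) : PCong D (offer x I F) (offer x I F')
  | c_fork (x : ℕ) (P P' Q Q' : Proc Tag Name) (h : PCong D P P') (h' : PCong D Q Q') :
      PCong D (fork x P Q) (fork x P' Q')
  | c_join (x : ℕ) (P P' : Proc Tag Name) (h : PCong D P P') :
      PCong D (join x P) (join x P')
  | c_choice (P P' Q Q' : Proc Tag Name) (h : PCong D P P') (h' : PCong D Q Q') :
      PCong D (choice P Q) (choice P' Q')
  | c_cut (P P' Q Q' : Proc Tag Name) (h : PCong D P P') (h' : PCong D Q Q') :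
      PCong D (cut P Q) (cut P' Q')

open Proc in
/-- Reduction. -/
inductive Red {Tag Name : Type} (D : Program Tag Name) :
    Proc Tag Name → Proc Tag Name → Prop
  | r_choice_left (P Q : Proc Tag Name) : Red D (choice P Q) P
  | r_choice_right (P Q : Proc Tag Name) : Red D (choice P Q) Q
  | r_link (y : ℕ) (P : Proc Tag Name) :
      Red D (cut (link 0 (y + 1)) P) (P.rename (inst y))
  | r_close (P : Proc Tag Name) :
      Red D (cut (close 0) (wait 0 (P.rename Nat.succ))) P
  | r_select (B : Buffer Tag Name) (I : Finset Tag) (F : {a // a ∈ I} → Proc Tag Name)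
      (k : {a // a ∈ I}) (P : Proc Tag Name) :
      Red D (cut (select 0 k P) (B.fill 0 (offer 0 I F))) (cut P (B.fill 0 (F k)))
  | r_fork (B : Buffer Tag Name) (P Q R : Proc Tag Name) :
      Red D (cut (fork 0 (P.rename (lift Nat.succ)) Q) (B.fill 0 (join 0 R)))
        (cut P (cut (Q.rename (lift Nat.succ))
          ((B.rename (lift Nat.succ)).fill 0 (R.rename swap))))
  | r_cut (P Q R : Proc Tag Name) (h : Red D P Q) : Red D (cut P R) (cut Q R)
  | r_buffer (B : Buffer Tag Name) (x : ℕ) (P Q : Proc Tag Name) (h : Red D P Q) :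
      Red D (B.fill x P) (B.fill x Q)
  | r_str (P R Q : Proc Tag Name) (h : PCong D P R) (h' : Red D R Q) : Red D P Q

/-! # Runs and fair termination -/

section Runs

variable {Tag Name : Type} (D : Program Tag Name)

/-- `f 0, f 1, …, f N` (or `f 0, f 1, …` if `N = ⊤`) is a run of `P`: a maximal reduction
sequence starting from `P`. The values of `f` beyond `N` are irrelevant. -/
structure IsRun (P : Proc Tag Name) (N : ℕ∞) (f : ℕ → Proc Tag Name) : Prop where
  start : f 0 = P
  step : ∀ i : ℕ, (i : ℕ∞) < N → Red D (f i) (f (i + 1))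
  maximal : ∀ k : ℕ, N = k → ¬ ∃ Q, Red D (f k) Q

/-- `P` has a finite run. -/
def WeaklyTerminating (P : Proc Tag Name) : Prop :=
  ∃ (N : ℕ∞) (f : ℕ → Proc Tag Name), IsRun D P N f ∧ N ≠ ⊤

/-- The sequence contains finitely many (occurrences of) weakly terminating processes. -/
def Fair (N : ℕ∞) (f : ℕ → Proc Tag Name) : Prop :=
  {i : ℕ | (i : ℕ∞) ≤ N ∧ WeaklyTerminating D (f i)}.Finite

/-- Every fair run of `P` is finite. -/
def FairlyTerminating (P : Proc Tag Name) : Prop :=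
  ∀ (N : ℕ∞) (f : ℕ → Proc Tag Name), IsRun D P N f → Fair D N f → N ≠ ⊤

end Runs

/-! # Type system -/

/-- Typing contexts: partial maps from channels to types. -/
abbrev Ctx (Tag : Type) : Type := ℕ → Option (SType Tag)

namespace Ctx

variable {Tag : Type}

/-- The empty context. -/
def empty : Ctx Tag := fun _ => none

/-- The context `Γ` extended, below a binder, with the type of the bound channel. -/
def cons (S : SType Tag) (Γ : Ctx Tag) : Ctx Tag
  | 0 => some S
  | n + 1 => Γ n

/-- `Γ` is the union of `Γ₁` and `Γ₂`, whose domains are disjoint. -/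
def Split (Γ Γ₁ Γ₂ : Ctx Tag) : Prop :=
  ∀ x, (Γ₁ x = none ∧ Γ₂ x = Γ x) ∨ (Γ₂ x = none ∧ Γ₁ x = Γ x)

end Ctx

open Proc in
/-- One application of a typing rule to derive that `P` is well typed in `Γ` with measure `n`,
with premises in `X`. -/
inductive TypingStep {Tag Name : Type} (D : Program Tag Name)
    (X : Proc Tag Name → Ctx Tag → ℕ → Prop) : Proc Tag Name → Ctx Tag → ℕ → Prop
  | done (n : ℕ) : TypingStep D X done Ctx.empty n
  | call (Γ : Ctx Tag) (A : Name) (xs : List ℕ) (m n : ℕ)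
      (hlen : xs.length = D.arity A) (hxs : xs.Nodup) (hdom : ∀ x, Γ x ≠ none ↔ x ∈ xs)
      (h : X (D.body A) (fun i => xs[i]?.bind Γ) m) (hmn : m ≤ n) :
      TypingStep D X (call A xs) Γ n
  | link (Γ : Ctx Tag) (x y : ℕ) (S T : SType Tag) (n : ℕ) (hxy : x ≠ y)
      (hx : Γ x = some S) (hy : Γ y = some T) (hΓ : ∀ z, z ≠ x → z ≠ y → Γ z = none)
      (hST : SType.Subt S.dual T) (hn : 1 ≤ n) :
      TypingStep D X (link x y) Γ n
  | cut (Γ Γ₁ Γ₂ : Ctx Tag) (P Q : Proc Tag Name) (S T : SType Tag) (n₁ n₂ : ℕ)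
      (hΓ : Ctx.Split Γ Γ₁ Γ₂) (hST : SType.Correct S T)
      (hP : X P (Ctx.cons S Γ₁) n₁) (hQ : X Q (Ctx.cons T Γ₂) n₂) :
      TypingStep D X (cut P Q) Γ (n₁ + n₂)
  | choice_left (Γ : Ctx Tag) (P Q : Proc Tag Name) (n₁ n₂ : ℕ)
      (hP : X P Γ n₁) (hQ : X Q Γ n₂) : TypingStep D X (choice P Q) Γ (1 + n₁)
  | choice_right (Γ : Ctx Tag) (P Q : Proc Tag Name) (n₁ n₂ : ℕ)
      (hP : X P Γ n₁) (hQ : X Q Γ n₂) : TypingStep D X (choice P Q) Γ (1 + n₂)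
  | close (Γ : Ctx Tag) (x n : ℕ) (hx : Γ x = some SType.one)
      (hΓ : ∀ z, z ≠ x → Γ z = none) (hn : 1 ≤ n) : TypingStep D X (close x) Γ n
  | wait (Γ : Ctx Tag) (x : ℕ) (P : Proc Tag Name) (n : ℕ) (hx : Γ x = some SType.bot)
      (hP : X P (Function.update Γ x none) n) : TypingStep D X (wait x P) Γ n
  | select (Γ : Ctx Tag) (x : ℕ) (I : Finset Tag) (hI : I.Nonempty) (m : {a // a ∈ I} → ℕ)
      (K : {a // a ∈ I} → SType Tag) (k : {a // a ∈ I}) (P : Proc Tag Name) (n : ℕ)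
      (hx : Γ x = some (SType.plus I hI m K))
      (hP : X P (Function.update Γ x (some (K k))) n) :
      TypingStep D X (select x k P) Γ (1 + m k + n)
  /-- The branches that the type does not mention are only required to be well scoped. -/
  | offer (Γ : Ctx Tag) (x : ℕ) (I : Finset Tag) (F : {a // a ∈ I} → Proc Tag Name)
      (J : Finset Tag) (hJ : J.Nonempty) (hJI : J ⊆ I) (m : {a // a ∈ J} → ℕ)
      (K : {a // a ∈ J} → SType Tag) (n : ℕ)
      (hx : Γ x = some (SType.amp J hJ m K))
      (hF : ∀ j : {a // a ∈ J},
        X (F ⟨j, hJI j.2⟩) (Function.update Γ x (some (K j))) (n + m j))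
      (hfn : ∀ i : {a // a ∈ I}, i.1 ∉ J → ∀ z ∈ (F i).fn, Γ z ≠ none) :
      TypingStep D X (offer x I F) Γ n
  | fork (Γ Γ₁ Γ₂ : Ctx Tag) (x : ℕ) (S T : SType Tag) (P Q : Proc Tag Name) (n₁ n₂ : ℕ)
      (hx : Γ x = some (SType.tensor S T))
      (hΓ : Ctx.Split (Function.update Γ x none) Γ₁ Γ₂)
      (hP : X P (Ctx.cons S Γ₁) n₁) (hQ : X Q (Function.update Γ₂ x (some T)) n₂) :
      TypingStep D X (fork x P Q) Γ (1 + n₁ + n₂)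
  | join (Γ : Ctx Tag) (x : ℕ) (S T : SType Tag) (P : Proc Tag Name) (n : ℕ)
      (hx : Γ x = some (SType.par S T))
      (hP : X P (Ctx.cons S (Function.update Γ x (some T))) n) :
      TypingStep D X (join x P) Γ n

/-- `P` is well typed in `Γ` with measure `n`: there is a possibly infinite typing derivation
(the typing rules are interpreted coinductively), in which all types are regular. -/
def Typed {Tag Name : Type} (D : Program Tag Name) (P : Proc Tag Name) (Γ : Ctx Tag)
    (n : ℕ) : Prop :=
  ∃ X : Proc Tag Name → Ctx Tag → ℕ → Prop,
    (∀ P Γ n, X P Γ n →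
      (∀ x S, Γ x = some S → SType.Regular S) ∧ TypingStep D X P Γ n) ∧ X P Γ n

end CaP

namespace CaP

namespace SType

variable {Tag : Type}

/-! ### Constructors of session types -/

/-! The measure bounds the length of one well-chosen run. A link and a `close` cost at least 1, a
choice costs 1 more than one of its alternatives, and an output costs 1 on top of its continuation;
a tag output also pays in advance the annotation that the receiving branch adds to its own measure.
Hence a closed typed process either reduces to a closed typed process of smaller measure or is
pre-congruent to `done` (`Ty.progress_or_done`), and induction on the measure makes it weakly
terminating (`Ty.weaklyTerminating`). Reduction along any other path preserves typability, though
perhaps with a larger measure (`Red.ty`), so every process of every run is weakly terminating. A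
fair run has finitely many such processes, hence is finite; its last process does not reduce, so
progress leaves only `done`.

On types, the subtyping required at links is replaced by `Sub`, correct composition with the dual of
the supertype. It is implied by the given subtyping (`Subt.sub`) and is a preorder because correct
compositions chain through dual types (`Correct.cut`). Outputs and late inputs commute
(`Trans.diamond`), which yields the types needed to reorder messages (`correct_plus`,
`correct_tensor`).

On processes, coinductive derivations are replaced by a predicate `Ty` defined by structural
recursion. The only premise that is not about a subprocess, the typing of the body at an invocation,
is delegated to an oracle. Linearity becomes a condition on free channels, so environments can be
total and need no splitting, and subsumption is built in (`Ty.mono`).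

Asynchrony is handled by separating a buffer from what fills it (`ty_fill`): an input available
outside a buffer is also available in its hole (`BTy.inp`), so a sender is always understood by a
receiver that still has pending outputs. With this, pre-congruence preserves typing and measure; the
delicate rule is the one that moves a buffer across a link (`ty_s_pull_0`).

Progress comes from `Ty.outcome`: every typed process makes progress or exposes a thread. Each
pending output costs at least 1, so the buffer in front of a thread is bounded by the measure
(`progress_or_exists_fill`); guardedness makes one unfolding of invocations enough
(`outcome_of_call`). When two threads meet on a cut channel, the polarity clause of correct
composition forbids both to be waiting. -/

@[simp] theorem head_one : (one : SType Tag).dest.1 = .one := rfl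
@[simp] theorem head_bot : (bot : SType Tag).dest.1 = .bot := rfl
@[simp] theorem head_plus (I : Finset Tag) (hI m K) :
    (plus I hI m K).dest.1 = .plus I hI m := rfl
@[simp] theorem head_amp (I : Finset Tag) (hI m K) :
    (amp I hI m K).dest.1 = .amp I hI m := rfl
@[simp] theorem head_tensor (S T : SType Tag) : (tensor S T).dest.1 = .tensor := rfl
@[simp] theorem head_par (S T : SType Tag) : (par S T).dest.1 = .par := rfl

/-- Every session type tree is built by one of the six constructors. -/
theorem eq_constructor (S : SType Tag) :
    S = one ∨ S = bot ∨ (∃ I hI m K, S = plus I hI m K) ∨ (∃ I hI m K, S = amp I hI m K) ∨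
      (∃ A B, S = tensor A B) ∨ ∃ A B, S = par A B := by
  rw [← PFunctor.M.mk_dest S]
  obtain ⟨a, k⟩ := S.dest
  cases a with
  | one => left; unfold one; congr; funext e; exact e.elim
  | bot => right; left; unfold bot; congr; funext e; exact e.elim
  | plus I hI m => exact .inr (.inr (.inl ⟨I, hI, m, k, rfl⟩))
  | amp I hI m => exact .inr (.inr (.inr (.inl ⟨I, hI, m, k, rfl⟩)))
  | tensor =>
    refine .inr (.inr (.inr (.inr (.inl ⟨k false, k true, ?_⟩))))
    unfold tensor; congr; funext b; cases b <;> rfl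
  | par =>
    refine .inr (.inr (.inr (.inr (.inr ⟨k false, k true, ?_⟩))))
    unfold par; congr; funext b; cases b <;> rfl

theorem plus_inj {I I' : Finset Tag} {hI hI'} {m : {a // a ∈ I} → ℕ} {m' : {a // a ∈ I'} → ℕ}
    {K : {a // a ∈ I} → SType Tag} {K' : {a // a ∈ I'} → SType Tag}
    (h : plus I hI m K = plus I' hI' m' K') : ∃ e : I' = I, (e ▸ m') = m ∧ (e ▸ K') = K := by
  have h := PFunctor.M.mk_inj h
  injection h with h1 h2
  injection h1 with h3 h4
  subst h3
  cases h4
  cases h2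
  exact ⟨rfl, rfl, rfl⟩

theorem amp_inj {I I' : Finset Tag} {hI hI'} {m : {a // a ∈ I} → ℕ} {m' : {a // a ∈ I'} → ℕ}
    {K : {a // a ∈ I} → SType Tag} {K' : {a // a ∈ I'} → SType Tag}
    (h : amp I hI m K = amp I' hI' m' K') : ∃ e : I' = I, (e ▸ m') = m ∧ (e ▸ K') = K := by
  have h := PFunctor.M.mk_inj h
  injection h with h1 h2
  injection h1 with h3 h4
  subst h3
  cases h4
  cases h2
  exact ⟨rfl, rfl, rfl⟩

theorem tensor_inj {S T S' T' : SType Tag} (h : tensor S T = tensor S' T') : S' = S ∧ T' = T := by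
  have h := PFunctor.M.mk_inj h
  injection h with h1 h2
  exact ⟨(congrFun h2 false).symm, (congrFun h2 true).symm⟩

theorem par_inj {S T S' T' : SType Tag} (h : par S T = par S' T') : S' = S ∧ T' = T := by
  have h := PFunctor.M.mk_inj h
  injection h with h1 h2
  exact ⟨(congrFun h2 false).symm, (congrFun h2 true).symm⟩

theorem head_eq {S T : SType Tag} (h : S = T) : S.dest.1 = T.dest.1 := by rw [h]

/-! ### Duality -/

@[simp] theorem dual_one : (one : SType Tag).dual = bot := by
  rw [← PFunctor.M.mk_dest (one : SType Tag).dual]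
  unfold dual
  rw [PFunctor.M.dest_corec]
  unfold bot
  congr 1
  refine Sigma.ext rfl (heq_of_eq ?_)
  funext e; exact e.elim

@[simp] theorem dual_bot : (bot : SType Tag).dual = one := by
  rw [← PFunctor.M.mk_dest (bot : SType Tag).dual]
  unfold dual
  rw [PFunctor.M.dest_corec]
  unfold one
  congr 1
  refine Sigma.ext rfl (heq_of_eq ?_)
  funext e; exact e.elim

@[simp] theorem dual_plus (I : Finset Tag) (hI m K) :
    (plus I hI m K).dual = amp I hI m (fun i => (K i).dual) := by
  rw [← PFunctor.M.mk_dest (plus I hI m K).dual]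
  unfold dual
  rw [PFunctor.M.dest_corec]
  rfl

@[simp] theorem dual_amp (I : Finset Tag) (hI m K) :
    (amp I hI m K).dual = plus I hI m (fun i => (K i).dual) := by
  rw [← PFunctor.M.mk_dest (amp I hI m K).dual]
  unfold dual
  rw [PFunctor.M.dest_corec]
  rfl

@[simp] theorem dual_tensor (S T : SType Tag) : (tensor S T).dual = par S.dual T.dual := by
  rw [← PFunctor.M.mk_dest (tensor S T).dual]
  unfold dual
  rw [PFunctor.M.dest_corec]
  unfold par
  congr 1
  refine Sigma.ext rfl (heq_of_eq ?_)
  funext b; cases b <;> rfl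

@[simp] theorem dual_par (S T : SType Tag) : (par S T).dual = tensor S.dual T.dual := by
  rw [← PFunctor.M.mk_dest (par S T).dual]
  unfold dual
  rw [PFunctor.M.dest_corec]
  unfold tensor
  congr 1
  refine Sigma.ext rfl (heq_of_eq ?_)
  funext b; cases b <;> rfl

-- Bisimulation: unfolding a double dual exchanges the root connective twice and leaves double duals
-- of the children.
@[simp] theorem dual_dual (S : SType Tag) : S.dual.dual = S := by
  refine PFunctor.M.bisim (fun A B => A = SType.dual (SType.dual B)) ?_ _ _ rfl
  rintro A S rfl
  obtain rfl | rfl | ⟨I, hI, m, K, rfl⟩ | ⟨I, hI, m, K, rfl⟩ | ⟨A, B, rfl⟩ | ⟨A, B, rfl⟩ :=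
    eq_constructor S
  · exact ⟨.one, _, _, by rw [dual_one, dual_bot]; rfl, rfl, fun e => e.elim⟩
  · exact ⟨.bot, _, _, by rw [dual_bot, dual_one]; rfl, rfl, fun e => e.elim⟩
  · exact ⟨.plus I hI m, _, _, by rw [dual_plus, dual_amp]; rfl, rfl, fun i => rfl⟩
  · exact ⟨.amp I hI m, _, _, by rw [dual_amp, dual_plus]; rfl, rfl, fun i => rfl⟩
  · exact ⟨.tensor, _, _, by rw [dual_tensor, dual_par]; rfl, rfl, fun b => by cases b <;> rfl⟩
  · exact ⟨.par, _, _, by rw [dual_par, dual_tensor]; rfl, rfl, fun b => by cases b <;> rfl⟩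

theorem pos_dual (S : SType Tag) : Pos S.dual ↔ ¬ Pos S := by
  obtain rfl | rfl | ⟨I, hI, m, K, rfl⟩ | ⟨I, hI, m, K, rfl⟩ | ⟨A, B, rfl⟩ | ⟨A, B, rfl⟩ :=
    eq_constructor S <;> simp [Pos]

theorem children_dual (S : SType Tag) (i) : ∃ j, S.dual.children i = SType.dual (S.children j) := by
  obtain rfl | rfl | ⟨I, hI, m, K, rfl⟩ | ⟨I, hI, m, K, rfl⟩ | ⟨A, B, rfl⟩ | ⟨A, B, rfl⟩ :=
    eq_constructor S
  · revert i; rw [dual_one]; exact fun e => Empty.elim e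
  · revert i; rw [dual_bot]; exact fun e => Empty.elim e
  · revert i; rw [dual_plus]; exact fun i => ⟨i, rfl⟩
  · revert i; rw [dual_amp]; exact fun i => ⟨i, rfl⟩
  · revert i; rw [dual_tensor]; intro i; exact ⟨i, by cases i <;> rfl⟩
  · revert i; rw [dual_par]; intro i; exact ⟨i, by cases i <;> rfl⟩

/-- Every subtree of the dual is the dual of a subtree, so finiteness is inherited. This matters
because `Subt` only tests regular types. -/
theorem Regular.dual {S : SType Tag} (h : Regular S) : Regular S.dual := by
  refine (h.image SType.dual).subset fun T hT => ?_
  induction hT with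
  | refl => exact ⟨S, .refl, rfl⟩
  | tail _ hstep ih =>
    obtain ⟨U, hU, rfl⟩ := ih
    obtain ⟨i, rfl⟩ := hstep
    obtain ⟨j, hj⟩ := children_dual U i
    exact ⟨_, hU.tail ⟨j, rfl⟩, hj.symm⟩

/-! ### Transitions -/

theorem TransStep.mono {X Y : SType Tag → Act Tag → SType Tag → Prop}
    (h : ∀ S α T, X S α T → Y S α T) {S α T} (hs : TransStep X S α T) : TransStep Y S α T := by
  cases hs with
  | must_one => exact .must_one
  | must_bot => exact .must_bot
  | must_plus => exact .must_plus ..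
  | must_amp => exact .must_amp ..
  | must_tensor => exact .must_tensor ..
  | must_par => exact .must_par ..
  | may_plus _ _ _ _ _ _ hh => exact .may_plus _ _ _ _ _ _ fun i => h _ _ _ (hh i)
  | may_amp _ _ _ _ _ _ hh => exact .may_amp _ _ _ _ _ _ fun i => h _ _ _ (hh i)
  | may_tensor _ _ _ _ hh => exact .may_tensor _ _ _ _ (h _ _ _ hh)
  | may_par _ _ _ _ hh => exact .may_par _ _ _ _ (h _ _ _ hh)

theorem Trans.step {S T : SType Tag} {α} (h : Trans S α T) : TransStep Trans S α T := by
  obtain ⟨X, hX, h⟩ := h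
  exact (hX _ _ _ h).1.mono fun _ _ _ hh => ⟨X, hX, hh⟩

theorem Trans.ind {S T : SType Tag} {α} (h : Trans S α T) : IndTrans S α T := by
  obtain ⟨X, hX, h⟩ := h
  exact (hX _ _ _ h).2

theorem TransStep.ind {S T : SType Tag} {α} (h : TransStep IndTrans S α T) : IndTrans S α T := by
  cases h with
  | must_one => exact .must_one
  | must_bot => exact .must_bot
  | must_plus => exact .must_plus ..
  | must_amp => exact .must_amp ..
  | must_tensor => exact .must_tensor ..
  | must_par => exact .must_par ..
  | may_plus _ _ _ _ _ _ hh => exact .may_plus _ _ _ _ _ _ hh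
  | may_amp _ _ _ _ _ _ hh => exact .may_amp _ _ _ _ _ _ hh
  | may_tensor _ _ _ _ hh => exact .may_tensor _ _ _ _ hh
  | may_par _ _ _ _ hh => exact .may_par _ _ _ _ hh

/-- Lambek's argument: one rule on top of the bounded greatest fixed point is again consistent, and
it stays within the inductive bound because every rule is also a rule of `IndTrans`. -/
theorem TransStep.trans {S T : SType Tag} {α} (h : TransStep Trans S α T) : Trans S α T := by
  refine ⟨fun S α T => TransStep Trans S α T, fun S α T hh => ⟨?_, ?_⟩, h⟩
  · exact hh.mono fun _ _ _ => Trans.step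
  · exact (hh.mono fun _ _ _ => Trans.ind).ind

/-! ### Inversion of transitions by root connective -/

theorem not_one_inp {σ} {T : SType Tag} (h : Trans one (.inp σ) T) : False := by
  have h := h.step
  generalize hS : (one : SType Tag) = S at h
  cases h <;> exact absurd (head_eq hS) (by simp)

theorem not_bot_out {σ} {T : SType Tag} (h : Trans bot (.out σ) T) : False := by
  have h := h.step
  generalize hS : (bot : SType Tag) = S at h
  cases h <;> exact absurd (head_eq hS) (by simp)

theorem bot_inp {σ} {T : SType Tag} (h : Trans bot (.inp σ) T) : σ = .star ∧ T = bot := by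
  have h := h.step
  generalize hS : (bot : SType Tag) = S at h
  cases h <;> first
    | exact ⟨rfl, rfl⟩
    | exact absurd (head_eq hS) (by simp)

theorem plus_out {I : Finset Tag} {hI m K σ T} (h : Trans (plus I hI m K) (.out σ) T) :
    ∃ k : {a // a ∈ I}, σ = .tag (m k) k ∧ T = K k := by
  have h := h.step
  generalize hS : plus I hI m K = S at h
  cases h <;> first
    | (obtain ⟨rfl, rfl, rfl⟩ := plus_inj hS; exact ⟨_, rfl, rfl⟩)
    | exact absurd (head_eq hS) (by simp)

theorem plus_inp {I : Finset Tag} {hI m K σ T} (h : Trans (plus I hI m K) (.inp σ) T) :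
    ∃ K', T = plus I hI m K' ∧ ∀ i, Trans (K i) (.inp σ) (K' i) := by
  have h := h.step
  generalize hS : plus I hI m K = S at h
  cases h <;> first
    | (obtain ⟨rfl, rfl, rfl⟩ := plus_inj hS; exact ⟨_, rfl, by assumption⟩)
    | exact absurd (head_eq hS) (by simp)

theorem amp_inp {I : Finset Tag} {hI m K σ T} (h : Trans (amp I hI m K) (.inp σ) T) :
    ∃ k : {a // a ∈ I}, σ = .tag (m k) k ∧ T = K k := by
  have h := h.step
  generalize hS : amp I hI m K = S at h
  cases h <;> first
    | (obtain ⟨rfl, rfl, rfl⟩ := amp_inj hS; exact ⟨_, rfl, rfl⟩)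
    | exact absurd (head_eq hS) (by simp)

theorem amp_out {I : Finset Tag} {hI m K σ T} (h : Trans (amp I hI m K) (.out σ) T) :
    ∃ K', T = amp I hI m K' ∧ ∀ i, Trans (K i) (.out σ) (K' i) := by
  have h := h.step
  generalize hS : amp I hI m K = S at h
  cases h <;> first
    | (obtain ⟨rfl, rfl, rfl⟩ := amp_inj hS; exact ⟨_, rfl, by assumption⟩)
    | exact absurd (head_eq hS) (by simp)

theorem tensor_out {A B : SType Tag} {σ T} (h : Trans (tensor A B) (.out σ) T) :
    σ = .chan A ∧ T = B := by
  have h := h.step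
  generalize hS : tensor A B = S at h
  cases h <;> first
    | (obtain ⟨rfl, rfl⟩ := tensor_inj hS; exact ⟨rfl, rfl⟩)
    | exact absurd (head_eq hS) (by simp)

theorem tensor_inp {A B : SType Tag} {σ T} (h : Trans (tensor A B) (.inp σ) T) :
    ∃ B', T = tensor A B' ∧ Trans B (.inp σ) B' := by
  have h := h.step
  generalize hS : tensor A B = S at h
  cases h <;> first
    | (obtain ⟨rfl, rfl⟩ := tensor_inj hS; exact ⟨_, rfl, by assumption⟩)
    | exact absurd (head_eq hS) (by simp)

theorem par_inp {A B : SType Tag} {σ T} (h : Trans (par A B) (.inp σ) T) :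
    σ = .chan A ∧ T = B := by
  have h := h.step
  generalize hS : par A B = S at h
  cases h <;> first
    | (obtain ⟨rfl, rfl⟩ := par_inj hS; exact ⟨rfl, rfl⟩)
    | exact absurd (head_eq hS) (by simp)

theorem par_out {A B : SType Tag} {σ T} (h : Trans (par A B) (.out σ) T) :
    ∃ B', T = par A B' ∧ Trans B (.out σ) B' := by
  have h := h.step
  generalize hS : par A B = S at h
  cases h <;> first
    | (obtain ⟨rfl, rfl⟩ := par_inj hS; exact ⟨_, rfl, by assumption⟩)
    | exact absurd (head_eq hS) (by simp)

theorem trans_one : Trans (one : SType Tag) (.out .star) one := TransStep.must_one.trans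

theorem trans_plus {I : Finset Tag} {hI m K} (k : {a // a ∈ I}) :
    Trans (plus I hI m K) (.out (.tag (m k) k)) (K k) := (TransStep.must_plus ..).trans

theorem trans_tensor {A B : SType Tag} : Trans (tensor A B) (.out (.chan A)) B :=
  (TransStep.must_tensor ..).trans

theorem trans_plus_inp {I : Finset Tag} {hI m K K' σ} (h : ∀ i, Trans (K i) (.inp σ) (K' i)) :
    Trans (plus I hI m K) (.inp σ) (plus I hI m K') := (TransStep.may_plus _ _ _ _ _ _ h).trans

theorem trans_tensor_inp {A B B' : SType Tag} {σ} (h : Trans B (.inp σ) B') :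
    Trans (tensor A B) (.inp σ) (tensor A B') := (TransStep.may_tensor _ _ _ _ h).trans

/-- Outputs and inputs of a type commute. -/
theorem Trans.diamond {V V₁ V₂ : SType Tag} {σ τ} (h₁ : Trans V (.inp σ) V₁)
    (h₂ : Trans V (.out τ) V₂) : ∃ V₃, Trans V₁ (.out τ) V₃ ∧ Trans V₂ (.inp σ) V₃ := by
  obtain rfl | rfl | ⟨I, hI, m, K, rfl⟩ | ⟨I, hI, m, K, rfl⟩ | ⟨A, B, rfl⟩ | ⟨A, B, rfl⟩ :=
    eq_constructor V
  · exact (not_one_inp h₁).elim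
  · exact (not_bot_out h₂).elim
  -- The late input acts in every branch, so doing it before or after the choice of `k` leads to the
  -- same `K' k`.
  · obtain ⟨K', rfl, hK⟩ := plus_inp h₁
    obtain ⟨k, rfl, rfl⟩ := plus_out h₂
    exact ⟨K' k, trans_plus k, hK k⟩
  · obtain ⟨K', rfl, hK⟩ := amp_out h₂
    obtain ⟨k, rfl, rfl⟩ := amp_inp h₁
    exact ⟨K' k, hK k, (TransStep.must_amp _ _ _ _ k).trans⟩
  · obtain ⟨B', rfl, hB⟩ := tensor_inp h₁
    obtain ⟨rfl, rfl⟩ := tensor_out h₂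
    exact ⟨B', trans_tensor, hB⟩
  · obtain ⟨B', rfl, hB⟩ := par_out h₂
    obtain ⟨rfl, rfl⟩ := par_inp h₁
    exact ⟨B', hB, (TransStep.must_par _ _).trans⟩

/-- The dual of a message dualises the type of a channel. -/
def Msg.dual : Msg Tag → Msg Tag
  | .star => .star
  | .tag m a => .tag m a
  | .chan S => .chan S.dual

@[simp] theorem Msg.dual_dual (σ : Msg Tag) : σ.dual.dual = σ := by
  cases σ <;> simp [Msg.dual]

/-- The dual of an action exchanges input and output. -/
def Act.dual : Act Tag → Act Tag
  | .inp σ => .out σ.dual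
  | .out σ => .inp σ.dual

@[simp] theorem Act.dual_dual (α : Act Tag) : α.dual.dual = α := by
  cases α <;> simp [Act.dual]

theorem IndTrans.dual {S T : SType Tag} {α} (h : IndTrans S α T) :
    IndTrans S.dual α.dual T.dual := by
  induction h with
  | must_one => simpa [Act.dual, Msg.dual] using IndTrans.must_bot
  | must_bot => simpa [Act.dual, Msg.dual] using IndTrans.must_one
  | must_plus I hI m K k =>
    simpa [Act.dual, Msg.dual] using IndTrans.must_amp I hI m (fun i => (K i).dual) k
  | must_amp I hI m K k =>
    simpa [Act.dual, Msg.dual] using IndTrans.must_plus I hI m (fun i => (K i).dual) k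
  | must_tensor S T => simpa [Act.dual, Msg.dual] using IndTrans.must_par S.dual T.dual
  | must_par S T => simpa [Act.dual, Msg.dual] using IndTrans.must_tensor S.dual T.dual
  | may_plus I hI m K K' σ h ih => simpa [Act.dual, Msg.dual] using IndTrans.may_amp I hI m _ _ _ ih
  | may_amp I hI m K K' σ h ih => simpa [Act.dual, Msg.dual] using IndTrans.may_plus I hI m _ _ _ ih
  | may_tensor S T T' σ h ih => simpa [Act.dual, Msg.dual] using IndTrans.may_par S.dual _ _ _ ih
  | may_par S T T' σ h ih => simpa [Act.dual, Msg.dual] using IndTrans.may_tensor S.dual _ _ _ ih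
  | fair_plus I hI m K K' σ k h ih =>
    simpa [Act.dual, Msg.dual] using IndTrans.fair_amp I hI m (fun i => (K i).dual) (fun i => (K' i).dual) _ k ih
  | fair_amp I hI m K K' σ k h ih =>
    simpa [Act.dual, Msg.dual] using IndTrans.fair_plus I hI m (fun i => (K i).dual) (fun i => (K' i).dual) _ k ih

theorem TransStep.dual {X : SType Tag → Act Tag → SType Tag → Prop} {S T : SType Tag} {α}
    (h : TransStep (fun S α T => X S.dual α.dual T.dual) S α T) :
    TransStep X S.dual α.dual T.dual := by
  cases h with
  | must_one => simpa [Act.dual, Msg.dual] using TransStep.must_bot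
  | must_bot => simpa [Act.dual, Msg.dual] using TransStep.must_one
  | must_plus I hI m K k =>
    simpa [Act.dual, Msg.dual] using TransStep.must_amp I hI m (fun i => (K i).dual) k
  | must_amp I hI m K k =>
    simpa [Act.dual, Msg.dual] using TransStep.must_plus I hI m (fun i => (K i).dual) k
  | must_tensor S T => simpa [Act.dual, Msg.dual] using TransStep.must_par S.dual T.dual
  | must_par S T => simpa [Act.dual, Msg.dual] using TransStep.must_tensor S.dual T.dual
  | may_plus I hI m K K' σ h => simpa [Act.dual, Msg.dual] using TransStep.may_amp I hI m _ _ _ h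
  | may_amp I hI m K K' σ h => simpa [Act.dual, Msg.dual] using TransStep.may_plus I hI m _ _ _ h
  | may_tensor S T T' σ h => simpa [Act.dual, Msg.dual] using TransStep.may_par S.dual _ _ _ h
  | may_par S T T' σ h => simpa [Act.dual, Msg.dual] using TransStep.may_tensor S.dual _ _ _ h

/-- The witness is the preimage of `Trans` under duality; since duality is an involution, the rules
carry over in both directions. -/
theorem Trans.dual {S T : SType Tag} {α} (h : Trans S α T) : Trans S.dual α.dual T.dual := by
  refine ⟨fun S α T => Trans S.dual α.dual T.dual, fun S α T hh => ?_, by simpa using h⟩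
  constructor
  · have h1 := hh.step
    have : TransStep (fun S α T => Trans S.dual α.dual T.dual) S.dual.dual α.dual.dual
        T.dual.dual := TransStep.dual (h1.mono fun _ _ _ h2 => by simpa using h2)
    simpa using this
  · simpa using hh.ind.dual

/-! ### Correct composition and subtyping -/

/-- A union of correct compositions is one, since each clause only asks that successors stay in the
relation. -/
theorem isCorrectComposition_correct : IsCorrectComposition (Correct (Tag := Tag)) where
  pol := fun S T ⟨_, hR, h⟩ => hR.pol S T h
  out_inp := fun S T ⟨R, hR, h⟩ σ hσ S' hS =>
    let ⟨T', h1, h2⟩ := hR.out_inp S T h σ hσ S' hS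
    ⟨T', h1, R, hR, h2⟩
  inp_out := fun S T ⟨R, hR, h⟩ σ hσ S' hS =>
    let ⟨T', h1, h2⟩ := hR.inp_out S T h σ hσ S' hS
    ⟨T', h1, R, hR, h2⟩
  out_inp_chan := fun S T ⟨R, hR, h⟩ S₁ S₂ hS =>
    let ⟨T₁, T₂, h1, h2, h3⟩ := hR.out_inp_chan S T h S₁ S₂ hS
    ⟨T₁, T₂, h1, ⟨R, hR, h2⟩, R, hR, h3⟩
  inp_out_chan := fun S T ⟨R, hR, h⟩ S₁ S₂ hS =>
    let ⟨T₁, T₂, h1, h2, h3⟩ := hR.inp_out_chan S T h S₁ S₂ hS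
    ⟨T₁, T₂, h1, ⟨R, hR, h2⟩, R, hR, h3⟩

theorem Correct.symm {S T : SType Tag} (h : Correct S T) : Correct T S := by
  obtain ⟨R, hR, h⟩ := h
  exact ⟨fun A B => R B A, ⟨fun A B hh => (hR.pol B A hh).symm,
    fun A B hh => hR.inp_out B A hh, fun A B hh => hR.out_inp B A hh,
    fun A B hh => hR.inp_out_chan B A hh, fun A B hh => hR.out_inp_chan B A hh⟩, h⟩

/-- Messages that match in the composition of dual behaviours: equal up to composing
the types of the exchanged channels correctly. -/
inductive Match : Msg Tag → Msg Tag → Prop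
  | star : Match .star .star
  | tag (m : ℕ) (a : Tag) : Match (.tag m a) (.tag m a)
  | chan (S T : SType Tag) (h : Correct S T) : Match (.chan S) (.chan T)

theorem Match.symm {σ τ : Msg Tag} (h : Match σ τ) : Match τ σ := by
  cases h with
  | star => exact .star
  | tag => exact .tag ..
  | chan _ _ h => exact .chan _ _ h.symm

/-- Merges the clauses for signals, tags and channels; `Match` absorbs the comparison of payloads,
so later arguments need no case split on the message. -/
theorem Correct.out {S S' T : SType Tag} {σ} (h : Correct S T) (hS : Trans S (.out σ) S') :
    ∃ τ T', Match σ τ ∧ Trans T (.inp τ) T' ∧ Correct S' T' := by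
  cases σ with
  | star =>
    obtain ⟨T', h1, h2⟩ := isCorrectComposition_correct.out_inp _ _ h _ (.inl rfl) _ hS
    exact ⟨_, T', .star, h1, h2⟩
  | tag m a =>
    obtain ⟨T', h1, h2⟩ := isCorrectComposition_correct.out_inp _ _ h _ (.inr ⟨_, _, rfl⟩) _ hS
    exact ⟨_, T', .tag .., h1, h2⟩
  | chan S₁ =>
    obtain ⟨T₁, T₂, h1, h2, h3⟩ := isCorrectComposition_correct.out_inp_chan _ _ h _ _ hS
    exact ⟨_, T₂, .chan _ _ h2, h1, h3⟩

/-- A coinduction principle for correct composition. -/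
theorem Correct.coind (R : SType Tag → SType Tag → Prop)
    (pol : ∀ S T, R S T → Pos S ∨ Pos T)
    (out : ∀ S T, R S T → ∀ σ S', Trans S (.out σ) S' → ∃ τ T',
      (Match σ τ ∨ ∃ A B, σ = .chan A ∧ τ = .chan B ∧ R A B) ∧ Trans T (.inp τ) T' ∧
        (R S' T' ∨ Correct S' T'))
    (out' : ∀ S T, R S T → ∀ σ T', Trans T (.out σ) T' → ∃ τ S',
      (Match τ σ ∨ ∃ A B, σ = .chan A ∧ τ = .chan B ∧ R B A) ∧ Trans S (.inp τ) S' ∧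
        (R S' T' ∨ Correct S' T')) {S T : SType Tag} (h : R S T) : Correct S T := by
  have hc := isCorrectComposition_correct (Tag := Tag)
  -- Coinduction up to `Correct`: successors may already be known to compose correctly.
  refine ⟨fun S T => R S T ∨ Correct S T, ⟨?_, ?_, ?_, ?_, ?_⟩, .inl h⟩
  · rintro S T (h | h)
    exacts [pol S T h, hc.pol _ _ h]
  · rintro S T (h | h) σ hσ S' hS
    · obtain ⟨τ, T', hm, ht, hr⟩ := out S T h σ S' hS
      have : τ = σ := by
        rcases hσ with rfl | ⟨m, a, rfl⟩ <;> rcases hm with hm | ⟨_, _, h1, _⟩ <;>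
          first | cases h1 | (cases hm; rfl)
      exact ⟨T', this ▸ ht, hr⟩
    · obtain ⟨T', h1, h2⟩ := hc.out_inp _ _ h σ hσ S' hS
      exact ⟨T', h1, .inr h2⟩
  · rintro S T (h | h) σ hσ S' hS
    · obtain ⟨τ, T', hm, ht, hr⟩ := out' S T h σ S' hS
      have : τ = σ := by
        rcases hσ with rfl | ⟨m, a, rfl⟩ <;> rcases hm with hm | ⟨_, _, h1, _⟩ <;>
          first | cases h1 | (cases hm; rfl)
      exact ⟨T', this ▸ ht, hr⟩
    · obtain ⟨T', h1, h2⟩ := hc.inp_out _ _ h σ hσ S' hS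
      exact ⟨T', h1, .inr h2⟩
  · rintro S T (h | h) S₁ S₂ hS
    · obtain ⟨τ, T', hm | ⟨A, B, h1, rfl, h3⟩, ht, hr⟩ := out S T h _ _ hS
      · cases hm with | chan _ T₁ hh => exact ⟨T₁, T', ht, .inr hh, hr⟩
      · cases h1; exact ⟨B, T', ht, .inl h3, hr⟩
    · obtain ⟨T₁, T₂, h1, h2, h3⟩ := hc.out_inp_chan _ _ h _ _ hS
      exact ⟨T₁, T₂, h1, .inr h2, .inr h3⟩
  · rintro S T (h | h) S₁ S₂ hS
    · obtain ⟨τ, T', hm | ⟨A, B, h1, rfl, h3⟩, ht, hr⟩ := out' S T h _ _ hS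
      · cases hm with | chan T₁ _ hh => exact ⟨T₁, T', ht, .inr hh, hr⟩
      · cases h1; exact ⟨B, T', ht, .inl h3, hr⟩
    · obtain ⟨T₁, T₂, h1, h2, h3⟩ := hc.inp_out_chan _ _ h _ _ hS
      exact ⟨T₁, T₂, h1, .inr h2, .inr h3⟩

/-- Each output is answered by the dual transition. A channel payload is answered by its own dual,
so the payloads are again a pair of the candidate relation, not yet known to be correct. -/
theorem correct_dual (S : SType Tag) : Correct S S.dual := by
  refine Correct.coind (fun S T => T = S.dual) ?_ ?_ ?_ rfl
  · rintro S _ rfl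
    rw [pos_dual]; exact em _
  · rintro S _ rfl σ S' h
    refine ⟨σ.dual, S'.dual, ?_, h.dual, .inl rfl⟩
    cases σ with
    | star => exact .inl .star
    | tag => exact .inl (.tag ..)
    | chan A => exact .inr ⟨A, A.dual, rfl, rfl, rfl⟩
  · rintro S _ rfl σ S' h
    have h2 := h.dual
    rw [dual_dual] at h2
    refine ⟨σ.dual, S'.dual, ?_, h2, .inl (by simp)⟩
    cases σ with
    | star => exact .inl .star
    | tag => exact .inl (.tag ..)
    | chan A => exact .inr ⟨A, A.dual, rfl, rfl, by simp⟩

/-- Payload channels form the same kind of chain through an intermediate type as the sessions that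
carry them; this closes the relation used in `Correct.cut`. -/
theorem Match.dual_trans {σ τ ρ : Msg Tag} (h : Match σ τ) (h' : Match τ.dual ρ) :
    Match σ ρ ∨ ∃ A B C, σ = .chan A ∧ ρ = .chan C ∧ Correct A (B : SType Tag).dual ∧
      Correct B C := by
  cases h with
  | star => cases h'; exact .inl .star
  | tag => cases h'; exact .inl (.tag ..)
  | chan A B h =>
    cases h' with
    | chan _ C h' => exact .inr ⟨A, B.dual, C, rfl, rfl, by simpa using h, h'⟩

/-- Correct compositions chain through dual types. -/
theorem Correct.cut {A B C : SType Tag} (h : Correct A B.dual) (h' : Correct B C) :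
    Correct A C := by
  refine Correct.coind (fun A C => ∃ B : SType Tag, Correct A B.dual ∧ Correct B C) ?_ ?_ ?_
    ⟨B, h, h'⟩
  · rintro A C ⟨B, h, h'⟩
    -- Only one of `B` and its dual is positive, so the intermediate type cannot account for the
    -- positive side of both compositions.
    have h1 := isCorrectComposition_correct.pol _ _ h
    have h2 := isCorrectComposition_correct.pol _ _ h'
    rw [pos_dual] at h1
    tauto
  · rintro A C ⟨B, h, h'⟩ σ A' hA
    obtain ⟨τ, T, hm, hT, hc⟩ := h.out hA
    -- The input that answers on the dual of `B` is an output of `B`, which the second composition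
    -- forwards to `C`.
    have hT := hT.dual
    rw [dual_dual] at hT
    obtain ⟨ρ, C', hm', hC, hc'⟩ := h'.out hT
    refine ⟨ρ, C', ?_, hC, .inl ⟨T.dual, by simpa using hc, hc'⟩⟩
    rcases hm.dual_trans hm' with hm | ⟨A, B, C, rfl, rfl, h1, h2⟩
    exacts [.inl hm, .inr ⟨A, C, rfl, rfl, B, h1, h2⟩]
  · rintro A C ⟨B, h, h'⟩ σ C' hC
    obtain ⟨τ, T, hm, hT, hc⟩ := h'.symm.out hC
    have hT := hT.dual
    obtain ⟨ρ, A', hm', hA, hc'⟩ := h.symm.out hT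
    refine ⟨ρ, A', ?_, hA, .inl ⟨T, hc'.symm, hc.symm⟩⟩
    rcases hm.dual_trans hm' with hm | ⟨C, B, A, rfl, rfl, h1, h2⟩
    · exact .inl hm.symm
    · exact .inr ⟨C, A, rfl, rfl, B.dual, by simpa using h2.symm, h1.symm⟩

/-! ### Subtyping as correct composition with the dual -/

/-- Subtyping, characterised by composition with the dual. -/
def Sub (S T : SType Tag) : Prop := Correct S T.dual

theorem Sub.refl (S : SType Tag) : Sub S S := correct_dual S

theorem Sub.trans {S T U : SType Tag} (h : Sub S T) (h' : Sub T U) : Sub S U :=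
  Correct.cut h h'

theorem Sub.dual {S T : SType Tag} (h : Sub S T) : Sub T.dual S.dual := by
  unfold Sub; rw [dual_dual]; exact Correct.symm h

theorem Correct.sub_left {S S' T : SType Tag} (h : Correct S T) (hS : Sub S' S) :
    Correct S' T := Correct.cut hS h

theorem Correct.sub_right {S T T' : SType Tag} (h : Correct S T) (hT : Sub T' T) :
    Correct S T' := (h.symm.sub_left hT).symm

/-- The definition of `Subt` is tested on the dual of the supertype, which is regular and composes
correctly with the supertype. -/
theorem Subt.sub {S T : SType Tag} (hT : Regular T) (h : Subt S T) : Sub S T :=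
  (h _ hT.dual (correct_dual T).symm).symm

/-- An input of the supertype is an output of its dual, and the subtype has to receive whatever that
dual sends. -/
theorem Sub.inp {S T T' : SType Tag} {σ} (h : Sub S T) (hT : Trans T (.inp σ) T') :
    ∃ τ S', Match τ σ.dual ∧ Trans S (.inp τ) S' ∧ Sub S' T' := by
  obtain ⟨τ, S', hm, hS, hc⟩ := (Correct.symm h).out hT.dual
  exact ⟨τ, S', hm.symm, hS, hc.symm⟩

/-- A type that first outputs a tag and then behaves as prescribed by the
corresponding late input of `V` composes correctly with `V`. -/
theorem correct_plus {V : SType Tag} {I : Finset Tag} {hI m} {K : {a // a ∈ I} → SType Tag}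
    (h : ∀ i : {a // a ∈ I}, Trans V (.inp (.tag (m i) i)) (K i)) :
    Correct (plus I hI m fun i => (K i).dual) V := by
  refine Correct.coind (fun W V => ∃ K : {a // a ∈ I} → SType Tag,
    W = plus I hI m (fun i => (K i).dual) ∧
      ∀ i : {a // a ∈ I}, Trans V (.inp (.tag (m i) i)) (K i)) ?_ ?_ ?_ ⟨K, rfl, h⟩
  · rintro _ V ⟨K, rfl, -⟩
    exact .inl (by simp [Pos])
  · rintro _ V ⟨K, rfl, h⟩ σ S hS
    obtain ⟨k, rfl, rfl⟩ := plus_out hS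
    exact ⟨_, K k, .inl (.tag ..), h k, .inr (correct_dual _).symm⟩
  · rintro _ V ⟨K, rfl, h⟩ τ V₂ hV
    -- `V` may output before it consumes the tag. By the diamond its late inputs survive, and the
    -- candidate type accepts the message late, in every branch.
    choose K' h1 h2 using fun i => (h i).diamond hV
    refine ⟨τ.dual, plus I hI m fun i => (K' i).dual, .inl ?_,
      trans_plus_inp fun i => (h1 i).dual, .inl ⟨K', rfl, h2⟩⟩
    cases τ with
    | star => exact .star
    | tag => exact .tag ..
    | chan A => exact .chan _ _ (correct_dual A).symm

/-- A type that first outputs a channel and then behaves as prescribed by the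
corresponding late input of `V` composes correctly with `V`. -/
theorem correct_tensor {V V' A A' : SType Tag} (h : Trans V (.inp (.chan A')) V')
    (hA : Correct A A') : Correct (tensor A V'.dual) V := by
  refine Correct.coind (fun W V => ∃ V', W = tensor A V'.dual ∧ Trans V (.inp (.chan A')) V')
    ?_ ?_ ?_ ⟨V', rfl, h⟩
  · rintro _ V ⟨K, rfl, -⟩
    exact .inl (by simp [Pos])
  · rintro _ V ⟨K, rfl, h⟩ σ S hS
    obtain ⟨rfl, rfl⟩ := tensor_out hS
    exact ⟨_, K, .inl (.chan _ _ hA), h, .inr (correct_dual _).symm⟩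
  · rintro _ V ⟨K, rfl, h⟩ τ V₂ hV
    obtain ⟨K', h1, h2⟩ := h.diamond hV
    refine ⟨τ.dual, tensor A K'.dual, .inl ?_, trans_tensor_inp h1.dual, .inl ⟨K', rfl, h2⟩⟩
    cases τ with
    | star => exact .star
    | tag => exact .tag ..
    | chan A => exact .chan _ _ (correct_dual A).symm

end SType

end CaP

namespace CaP

open Function SType

variable {Tag Name : Type}

/-! ### Renamings and free channels -/

@[simp] theorem lift_zero (ρ : ℕ → ℕ) : lift ρ 0 = 0 := rfl
@[simp] theorem lift_succ (ρ : ℕ → ℕ) (n : ℕ) : lift ρ (n + 1) = ρ n + 1 := rfl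
@[simp] theorem inst_zero (y : ℕ) : inst y 0 = y := rfl
@[simp] theorem inst_succ (y n : ℕ) : inst y (n + 1) = n := rfl
@[simp] theorem swap_zero : swap 0 = 1 := rfl
@[simp] theorem swap_one : swap 1 = 0 := rfl
@[simp] theorem swap_add_two (n : ℕ) : swap (n + 2) = n + 2 := rfl

theorem swap_injective : Injective swap := by
  rintro (_ | _ | a) (_ | _ | b) h <;> simp_all [swap]

theorem lift_injective {ρ : ℕ → ℕ} (h : Injective ρ) : Injective (lift ρ) := by
  rintro (_ | a) (_ | b) hab <;> simp_all
  exact h hab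

theorem injOn_lift {ρ : ℕ → ℕ} {s : Set ℕ} (h : Set.InjOn ρ {z | z + 1 ∈ s}) :
    Set.InjOn (lift ρ) s := by
  rintro (_ | a) ha (_ | b) hb hab <;> simp_all
  exact h ha hb hab

namespace Proc

@[simp] theorem mem_fn_rename {ρ : ℕ → ℕ} {P : Proc Tag Name} {z : ℕ} :
    z ∈ (P.rename ρ).fn ↔ ∃ y ∈ P.fn, ρ y = z := by
  induction P generalizing ρ z with
  | done => simp [rename, fn]
  | call A xs => simp [rename, fn]
  | link x y => simp [rename, fn, eq_comm]
  | close x => simp [rename, fn, eq_comm]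
  | wait x P ih => simp [rename, fn, ih, eq_comm]
  | select x a P ih => simp [rename, fn, ih, eq_comm]
  | offer x I F ih =>
    simp only [rename, fn, ih, Set.mem_union, Set.mem_singleton_iff, Set.mem_ofPred_eq, or_and_right,
      exists_or, exists_eq_left]
    exact or_congr eq_comm ⟨fun ⟨i, y, h⟩ => ⟨y, ⟨i, h.1⟩, h.2⟩, fun ⟨y, ⟨i, h⟩, h'⟩ => ⟨i, y, h, h'⟩⟩
  | fork x P Q ihP ihQ =>
    simp only [rename, fn, ihP, ihQ, Set.mem_union, Set.mem_singleton_iff, Set.mem_ofPred_eq,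
      or_and_right, exists_or, exists_eq_left]
    refine or_congr_left (or_congr eq_comm ⟨?_, ?_⟩)
    · rintro ⟨_ | y, h1, h2⟩ <;> simp at h2
      exact ⟨y, h1, h2⟩
    · rintro ⟨y, h1, rfl⟩; exact ⟨y + 1, h1, rfl⟩
  | join x P ih =>
    simp only [rename, fn, ih, Set.mem_union, Set.mem_singleton_iff, Set.mem_ofPred_eq,
      or_and_right, exists_or, exists_eq_left]
    refine or_congr eq_comm ⟨?_, ?_⟩
    · rintro ⟨_ | y, h1, h2⟩ <;> simp at h2
      exact ⟨y, h1, h2⟩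
    · rintro ⟨y, h1, rfl⟩; exact ⟨y + 1, h1, rfl⟩
  | choice P Q ihP ihQ => simp [rename, fn, ihP, ihQ, or_and_right, exists_or]
  | cut P Q ihP ihQ =>
    simp only [rename, fn, ihP, ihQ, Set.mem_union, Set.mem_ofPred_eq, or_and_right, exists_or]
    refine or_congr ⟨?_, ?_⟩ ⟨?_, ?_⟩
    · rintro ⟨_ | y, h1, h2⟩ <;> simp at h2
      exact ⟨y, h1, h2⟩
    · rintro ⟨y, h1, rfl⟩; exact ⟨y + 1, h1, rfl⟩
    · rintro ⟨_ | y, h1, h2⟩ <;> simp at h2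
      exact ⟨y, h1, h2⟩
    · rintro ⟨y, h1, rfl⟩; exact ⟨y + 1, h1, rfl⟩

theorem rename_congr {ρ ρ' : ℕ → ℕ} {P : Proc Tag Name} (h : ∀ x ∈ P.fn, ρ x = ρ' x) :
    P.rename ρ = P.rename ρ' := by
  have hl : ∀ {ρ ρ' : ℕ → ℕ} {s : Set ℕ}, (∀ x, x + 1 ∈ s → ρ x = ρ' x) →
      ∀ x ∈ s, lift ρ x = lift ρ' x := by
    rintro ρ ρ' s h (_ | x) hx
    exacts [rfl, congrArg (· + 1) (h x hx)]
  induction P generalizing ρ ρ' with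
  | done => rfl
  | call A xs => simpa [rename, fn] using h
  | link x y => simp only [rename, h x (.inl rfl), h y (.inr rfl)]
  | close x => simp only [rename, h x rfl]
  | wait x P ih => rw [rename, rename, h x (.inl rfl), ih fun z hz => h z (.inr hz)]
  | select x a P ih => rw [rename, rename, h x (.inl rfl), ih fun z hz => h z (.inr hz)]
  | offer x I F ih =>
    rw [rename, rename, h x (.inl rfl)]
    congr; funext i
    exact ih i fun z hz => h z (.inr ⟨i, hz⟩)
  | fork x P Q ihP ihQ =>
    rw [rename, rename, h x (.inl (.inl rfl)), ihP (hl fun z hz => h z (.inl (.inr hz))),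
      ihQ fun z hz => h z (.inr hz)]
  | join x P ih =>
    rw [rename, rename, h x (.inl rfl), ih (hl fun z hz => h z (.inr hz))]
  | choice P Q ihP ihQ =>
    rw [rename, rename, ihP fun z hz => h z (.inl hz), ihQ fun z hz => h z (.inr hz)]
  | cut P Q ihP ihQ =>
    rw [rename, rename, ihP (hl fun z hz => h z (.inl hz)), ihQ (hl fun z hz => h z (.inr hz))]

theorem lift_comp (ρ ρ' : ℕ → ℕ) : lift ρ' ∘ lift ρ = lift (ρ' ∘ ρ) := by
  funext n; cases n <;> rfl

theorem rename_rename {ρ ρ' : ℕ → ℕ} {P : Proc Tag Name} :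
    (P.rename ρ).rename ρ' = P.rename (ρ' ∘ ρ) := by
  induction P generalizing ρ ρ' <;> simp_all [rename, lift_comp]

theorem lift_id : lift id = id := by
  funext n; cases n <;> rfl

@[simp] theorem rename_id {P : Proc Tag Name} : P.rename id = P := by
  induction P <;> simp_all [rename, lift_id]

/-- Pre-congruence and reduction express "not free" by a renaming; this and the next lemma turn a
non-membership into that form. -/
theorem exists_rename_succ {P : Proc Tag Name} (h : 0 ∉ P.fn) :
    ∃ P' : Proc Tag Name, P = P'.rename Nat.succ := by
  refine ⟨P.rename Nat.pred, ?_⟩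
  rw [rename_rename]
  conv_lhs => rw [← P.rename_id]
  refine rename_congr fun x hx => ?_
  rcases x with _ | x
  exacts [(h hx).elim, rfl]

theorem exists_rename_lift_succ {P : Proc Tag Name} (h : 1 ∉ P.fn) :
    ∃ P' : Proc Tag Name, P = P'.rename (lift Nat.succ) := by
  refine ⟨P.rename (lift Nat.pred), ?_⟩
  rw [rename_rename]
  conv_lhs => rw [← P.rename_id]
  refine rename_congr fun x hx => ?_
  rcases x with _ | _ | x
  exacts [rfl, (h hx).elim, rfl]

end Proc

/-! ### Free channels of buffers -/

namespace Buffer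

/-- The channels that occur free in the messages of a buffer. -/
def fn : Buffer Tag Name → Set ℕ
  | hole => ∅
  | select _ B => B.fn
  | fork P B => {z | z + 1 ∈ P.fn} ∪ B.fn

@[simp] theorem mem_fn_rename {ρ : ℕ → ℕ} {B : Buffer Tag Name} {z : ℕ} :
    z ∈ (B.rename ρ).fn ↔ ∃ y ∈ B.fn, ρ y = z := by
  induction B with
  | hole => simp [rename, fn]
  | select a B ih => simp [rename, fn, ih]
  | fork P B ih =>
    simp only [rename, fn, ih, Set.mem_union, Set.mem_ofPred_eq, or_and_right, exists_or,
      Proc.mem_fn_rename]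
    refine or_congr_left ⟨?_, ?_⟩
    · rintro ⟨_ | y, h1, h2⟩ <;> simp at h2
      exact ⟨y, h1, h2⟩
    · rintro ⟨y, h1, rfl⟩; exact ⟨y + 1, h1, rfl⟩

theorem mem_fn_fill {B : Buffer Tag Name} {x z : ℕ} {P : Proc Tag Name} :
    z ∈ (B.fill x P).fn ↔ (B ≠ hole ∧ z = x) ∨ z ∈ B.fn ∨ z ∈ P.fn := by
  induction B with
  | hole => simp [fill, fn]
  | select a B ih => simp [fill, fn, ih, Proc.fn]; tauto
  | fork Q B ih => simp [fill, fn, ih, Proc.fn]; tauto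

theorem mem_fn_fill_of_mem {B : Buffer Tag Name} {x z : ℕ} {P : Proc Tag Name} (hx : x ∈ P.fn) :
    z ∈ (B.fill x P).fn ↔ z ∈ B.fn ∨ z ∈ P.fn := by
  rw [mem_fn_fill]
  constructor
  · rintro (⟨-, rfl⟩ | h)
    exacts [.inr hx, h]
  · exact .inr

end Buffer

/-! ### Syntax-directed typing with subsumption -/

/-- Extension of a total typing environment below a binder. -/
def scons (S : SType Tag) (Γ : ℕ → SType Tag) : ℕ → SType Tag
  | 0 => S
  | n + 1 => Γ n

@[simp] theorem scons_zero (S : SType Tag) (Γ : ℕ → SType Tag) : scons S Γ 0 = S := rfl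
@[simp] theorem scons_succ (S : SType Tag) (Γ : ℕ → SType Tag) (n : ℕ) :
    scons S Γ (n + 1) = Γ n := rfl

theorem scons_update (S T : SType Tag) (Γ : ℕ → SType Tag) (x : ℕ) :
    scons S (update Γ x T) = update (scons S Γ) (x + 1) T := by
  funext z
  rcases z with _ | z
  · simp
  · by_cases h : z = x
    · subst h; simp
    · simp [h]

theorem update_scons_zero (S T : SType Tag) (Γ : ℕ → SType Tag) :
    update (scons S Γ) 0 T = scons T Γ := by
  funext z
  rcases z with _ | z <;> simp

/-- Oracles for the typing of the bodies of process definitions. -/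
abbrev Oracle (Tag Name : Type) : Type := Name → (ℕ → SType Tag) → ℕ → Prop

open Proc in
/-- Typing with subsumption in total environments, where the typing of the bodies of process
definitions is given by an oracle. Linearity is expressed by conditions on free channels. -/
def Ty (D : Program Tag Name) (C : Oracle Tag Name) :
    Proc Tag Name → (ℕ → SType Tag) → ℕ → Prop
  | done, _, _ => True
  | call A xs, Γ, n => xs.Nodup ∧ xs.length = D.arity A ∧ ∃ Δ m, C A Δ m ∧
      (∀ i (h : i < xs.length), Sub (Δ i) (Γ xs[i])) ∧ m ≤ n
  | link x y, Γ, n => x ≠ y ∧ Sub (Γ x).dual (Γ y) ∧ 1 ≤ n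
  | close x, Γ, n => Sub SType.one (Γ x) ∧ 1 ≤ n
  | wait x P, Γ, n => x ∉ P.fn ∧ Sub SType.bot (Γ x) ∧ Ty D C P Γ n
  | select x a P, Γ, n => x ∈ P.fn ∧ ∃ (I : Finset Tag) (hI : I.Nonempty) (m : {a // a ∈ I} → ℕ)
      (K : {a // a ∈ I} → SType Tag) (k : {a // a ∈ I}) (n' : ℕ), k.1 = a ∧
        Sub (SType.plus I hI m K) (Γ x) ∧ Ty D C P (update Γ x (K k)) n' ∧ 1 + m k + n' ≤ n
  -- Every typed branch has at least the free channels of all branches. This bounds the branches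
  -- that the type does not mention, and lets a selected branch replace the whole process without
  -- losing channels.
  | offer x I F, Γ, n => ∃ (J : Finset Tag) (hJ : J.Nonempty) (m : {a // a ∈ J} → ℕ)
      (K : {a // a ∈ J} → SType Tag) (hJI : J ⊆ I), Sub (SType.amp J hJ m K) (Γ x) ∧
        ∀ j : {a // a ∈ J}, x ∈ (F ⟨j, hJI j.2⟩).fn ∧
          (∀ i, (F i).fn ⊆ (F ⟨j, hJI j.2⟩).fn) ∧
          Ty D C (F ⟨j, hJI j.2⟩) (update Γ x (K j)) (n + m j)
  | fork x P Q, Γ, n => 0 ∈ P.fn ∧ x ∈ Q.fn ∧ (∀ z, z + 1 ∈ P.fn → z ∉ Q.fn) ∧ ∃ S T n₁ n₂,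
      Sub (SType.tensor S T) (Γ x) ∧ Ty D C P (scons S Γ) n₁ ∧ Ty D C Q (update Γ x T) n₂ ∧
        1 + n₁ + n₂ ≤ n
  | join x P, Γ, n => 0 ∈ P.fn ∧ x + 1 ∈ P.fn ∧ ∃ S T, Sub (SType.par S T) (Γ x) ∧
      Ty D C P (scons S (update Γ x T)) n
  | choice P Q, Γ, n => P.fn = Q.fn ∧ ∃ n₁ n₂, Ty D C P Γ n₁ ∧ Ty D C Q Γ n₂ ∧
      (1 + n₁ ≤ n ∨ 1 + n₂ ≤ n)
  | cut P Q, Γ, n => 0 ∈ P.fn ∧ 0 ∈ Q.fn ∧ (∀ z, z + 1 ∈ P.fn → z + 1 ∉ Q.fn) ∧ ∃ S T n₁ n₂,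
      Correct S T ∧ Ty D C P (scons S Γ) n₁ ∧ Ty D C Q (scons T Γ) n₂ ∧ n₁ + n₂ ≤ n

variable {D : Program Tag Name} {C : Oracle Tag Name}

/-- Each axiom and each prefix compares its expected type with the environment through `Sub`, so
raising the types of free channels only composes subtypings; bound and updated channels keep their
types. -/
theorem Ty.mono {P : Proc Tag Name} {Γ Γ' : ℕ → SType Tag} {n n' : ℕ} (h : Ty D C P Γ n)
    (hΓ : ∀ x ∈ P.fn, Sub (Γ x) (Γ' x)) (hn : n ≤ n') : Ty D C P Γ' n' := by
  have hu : ∀ {Γ Γ' : ℕ → SType Tag} {s : Set ℕ}, (∀ x ∈ s, Sub (Γ x) (Γ' x)) → ∀ (x : ℕ) T,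
      ∀ z ∈ s, Sub (update Γ x T z) (update Γ' x T z) := by
    intro Γ Γ' s h x T z hz
    by_cases hzx : z = x
    · subst hzx; simp [Sub.refl]
    · simpa [hzx] using h z hz
  have hs : ∀ {Γ Γ' : ℕ → SType Tag} {s : Set ℕ} (S : SType Tag),
      (∀ x, x + 1 ∈ s → Sub (Γ x) (Γ' x)) → ∀ z ∈ s, Sub (scons S Γ z) (scons S Γ' z) := by
    rintro Γ Γ' s S h (_ | z) hz
    exacts [Sub.refl _, h z hz]
  induction P generalizing Γ Γ' n n' with
  | done => trivial
  | call A xs =>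
    obtain ⟨h1, h2, Δ, m, h3, h4, h5⟩ := h
    exact ⟨h1, h2, Δ, m, h3, fun i hi => (h4 i hi).trans (hΓ _ (List.getElem_mem hi)), h5.trans hn⟩
  | link x y =>
    exact ⟨h.1, (hΓ x (.inl rfl)).dual.trans (h.2.1.trans (hΓ y (.inr rfl))), h.2.2.trans hn⟩
  | close x => exact ⟨h.1.trans (hΓ x rfl), h.2.trans hn⟩
  | wait x P ih =>
    exact ⟨h.1, h.2.1.trans (hΓ x (.inl rfl)), ih h.2.2 (fun z hz => hΓ z (.inr hz)) hn⟩
  | select x a P ih =>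
    obtain ⟨hx, I, hI, m, K, k, n₁, rfl, h1, h2, h3⟩ := h
    exact ⟨hx, I, hI, m, K, k, n₁, rfl, h1.trans (hΓ x (.inl rfl)),
      ih h2 (hu (fun z hz => hΓ z (.inr hz)) _ _) le_rfl, h3.trans hn⟩
  | offer x I F ih =>
    obtain ⟨J, hJ, m, K, hJI, h1, h2⟩ := h
    exact ⟨J, hJ, m, K, hJI, h1.trans (hΓ x (.inl rfl)), fun j => ⟨(h2 j).1, (h2 j).2.1,
      ih _ (h2 j).2.2 (hu (fun z hz => hΓ z (.inr ⟨_, hz⟩)) _ _) (by omega)⟩⟩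
  | fork x P Q ihP ihQ =>
    obtain ⟨h0, hx, hd, S, T, n₁, n₂, h1, h2, h3, h4⟩ := h
    exact ⟨h0, hx, hd, S, T, n₁, n₂, h1.trans (hΓ x (.inl (.inl rfl))),
      ihP h2 (hs _ fun z hz => hΓ z (.inl (.inr hz))) le_rfl,
      ihQ h3 (hu (fun z hz => hΓ z (.inr hz)) _ _) le_rfl, h4.trans hn⟩
  | join x P ih =>
    obtain ⟨h0, hx, S, T, h1, h2⟩ := h
    exact ⟨h0, hx, S, T, h1.trans (hΓ x (.inl rfl)),
      ih h2 (hs _ (hu (s := {z | z + 1 ∈ P.fn}) (fun z hz => hΓ z (.inr hz)) _ _)) hn⟩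
  | choice P Q ihP ihQ =>
    obtain ⟨h0, n₁, n₂, h1, h2, h3⟩ := h
    exact ⟨h0, n₁, n₂, ihP h1 (fun z hz => hΓ z (.inl hz)) le_rfl,
      ihQ h2 (fun z hz => hΓ z (.inr hz)) le_rfl, by omega⟩
  | cut P Q ihP ihQ =>
    obtain ⟨h0, h0', hd, S, T, n₁, n₂, h1, h2, h3, h4⟩ := h
    exact ⟨h0, h0', hd, S, T, n₁, n₂, h1, ihP h2 (hs _ fun z hz => hΓ z (.inl hz)) le_rfl,
      ihQ h3 (hs _ fun z hz => hΓ z (.inr hz)) le_rfl, h4.trans hn⟩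

theorem Ty.congr {P : Proc Tag Name} {Γ Γ' : ℕ → SType Tag} {n : ℕ} (h : Ty D C P Γ n)
    (hΓ : ∀ x ∈ P.fn, Γ x = Γ' x) : Ty D C P Γ' n :=
  h.mono (fun x hx => hΓ x hx ▸ Sub.refl _) le_rfl

theorem Proc.apply_mem_fn_rename {ρ : ℕ → ℕ} {P : Proc Tag Name} {s : Set ℕ} {x : ℕ}
    (h : Set.InjOn ρ s) (hx : x ∈ s) (hP : P.fn ⊆ s) : ρ x ∈ (P.rename ρ).fn ↔ x ∈ P.fn := by
  rw [Proc.mem_fn_rename]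
  exact ⟨fun ⟨y, hy, e⟩ => h (hP hy) hx e ▸ hy, fun h => ⟨x, h, rfl⟩⟩

theorem Proc.rename_fn_subset {ρ : ℕ → ℕ} {P Q : Proc Tag Name}
    (h : Set.InjOn ρ (P.fn ∪ Q.fn)) : (P.rename ρ).fn ⊆ (Q.rename ρ).fn ↔ P.fn ⊆ Q.fn := by
  constructor
  · intro hs x hx
    have := hs (Proc.mem_fn_rename.2 ⟨x, hx, rfl⟩)
    rwa [Proc.apply_mem_fn_rename h (.inl hx) (fun _ => .inr)] at this
  · intro hs x hx
    obtain ⟨y, hy, rfl⟩ := Proc.mem_fn_rename.1 hx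
    exact Proc.mem_fn_rename.2 ⟨y, hs hy, rfl⟩

open Proc in
/-- Typing is invariant under renamings that do not identify free channels. -/
theorem ty_rename {P : Proc Tag Name} {ρ : ℕ → ℕ} {Γ Γ' : ℕ → SType Tag} {n : ℕ}
    (hρ : Set.InjOn ρ P.fn) (hΓ : ∀ x ∈ P.fn, Γ' x = Γ (ρ x)) :
    Ty D C (P.rename ρ) Γ n ↔ Ty D C P Γ' n := by
  -- Updating commutes with a renaming because no other free channel is sent to the updated one.
  have hu : ∀ {Γ Γ' : ℕ → SType Tag} {s t : Set ℕ} {ρ : ℕ → ℕ}, (∀ x ∈ t, Γ' x = Γ (ρ x)) →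
      ∀ (x : ℕ) T, Set.InjOn ρ t → s ⊆ t → x ∈ t →
      ∀ z ∈ s, update Γ' x T z = update Γ (ρ x) T (ρ z) := by
    intro Γ Γ' s t ρ h x T hρ hs hx z hz
    by_cases hzx : z = x
    · subst hzx; simp
    · rw [update_of_ne hzx, update_of_ne fun e => hzx (hρ (hs hz) hx e), h z (hs hz)]
  have hs : ∀ {Γ Γ' : ℕ → SType Tag} {s : Set ℕ} {ρ : ℕ → ℕ} (S : SType Tag),
      (∀ x, x + 1 ∈ s → Γ' x = Γ (ρ x)) → ∀ z ∈ s, scons S Γ' z = scons S Γ (lift ρ z) := by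
    rintro Γ Γ' s ρ S h (_ | z) hz
    exacts [rfl, h z hz]
  have h0 : ∀ (ρ : ℕ → ℕ) (P : Proc Tag Name), 0 ∈ (P.rename (lift ρ)).fn ↔ 0 ∈ P.fn := by
    intro ρ P
    rw [mem_fn_rename]
    refine ⟨?_, fun h => ⟨0, h, rfl⟩⟩
    rintro ⟨_ | y, hy, e⟩
    exacts [hy, by simp at e]
  have h1 : ∀ (ρ : ℕ → ℕ) (P : Proc Tag Name) z, z + 1 ∈ (P.rename (lift ρ)).fn ↔
      ∃ y, y + 1 ∈ P.fn ∧ ρ y = z := by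
    intro ρ P z
    rw [mem_fn_rename]
    constructor
    · rintro ⟨_ | y, hy, e⟩
      exacts [by simp at e, ⟨y, hy, by simpa using e⟩]
    · rintro ⟨y, hy, rfl⟩; exact ⟨y + 1, hy, rfl⟩
  induction P generalizing ρ Γ Γ' n with
  | done => exact Iff.rfl
  | call A xs =>
    simp only [rename, Ty, List.length_map, List.getElem_map]
    refine and_congr ⟨.of_map _, .map_on fun _ hx _ hy e => hρ hx hy e⟩ (and_congr Iff.rfl ?_)
    refine exists_congr fun Δ => exists_congr fun m => and_congr Iff.rfl (and_congr ?_ Iff.rfl)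
    exact forall_congr' fun i => forall_congr' fun hi => by rw [hΓ _ (List.getElem_mem hi)]
  | link x y =>
    simp only [rename, Ty, hΓ x (.inl rfl), hΓ y (.inr rfl)]
    refine and_congr (not_congr ⟨fun h => hρ (.inl rfl) (.inr rfl) h, fun h => h ▸ rfl⟩) Iff.rfl
  | close x => simp only [rename, Ty, hΓ x rfl]
  | wait x P ih =>
    simp only [rename, Ty, hΓ x (.inl rfl)]
    refine and_congr (not_congr (apply_mem_fn_rename hρ (.inl rfl) fun _ => .inr))
      (and_congr Iff.rfl (ih (hρ.mono fun _ => .inr) fun z hz => hΓ z (.inr hz)))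
  | select x a P ih =>
    simp only [rename, Ty, hΓ x (.inl rfl)]
    refine and_congr (apply_mem_fn_rename hρ (.inl rfl) fun _ => .inr) ?_
    refine exists_congr fun I => exists_congr fun hI => exists_congr fun m => exists_congr fun K =>
      exists_congr fun k => exists_congr fun n' => and_congr Iff.rfl (and_congr Iff.rfl
        (and_congr (ih (hρ.mono fun _ => .inr) ?_) Iff.rfl))
    exact hu hΓ _ _ hρ (fun _ => .inr) (.inl rfl)
  | offer x I F ih =>
    simp only [rename, Ty, hΓ x (.inl rfl)]
    refine exists_congr fun J => exists_congr fun hJ => exists_congr fun m => exists_congr fun K =>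
      exists_congr fun hJI => and_congr Iff.rfl (forall_congr' fun j => and_congr ?_
        (and_congr (forall_congr' fun i => ?_) (ih _ (hρ.mono ?_) ?_)))
    · exact apply_mem_fn_rename hρ (.inl rfl) fun _ h => .inr ⟨_, h⟩
    · refine rename_fn_subset (hρ.mono ?_)
      rintro z (h | h) <;> exact .inr ⟨_, h⟩
    · exact fun _ h => .inr ⟨_, h⟩
    · exact hu hΓ _ _ hρ (fun _ h => .inr ⟨_, h⟩) (.inl rfl)
  | fork x P Q ihP ihQ =>
    simp only [rename, Ty, hΓ x (.inl (.inl rfl))]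
    refine and_congr (h0 ρ P) (and_congr (apply_mem_fn_rename hρ (.inl (.inl rfl)) fun _ => .inr)
      (and_congr ?_ ?_))
    · simp only [h1]
      constructor
      · intro h z hz hz'
        exact h _ ⟨z, hz, rfl⟩ (mem_fn_rename.2 ⟨z, hz', rfl⟩)
      · rintro h _ ⟨z, hz, rfl⟩ hz'
        rw [apply_mem_fn_rename hρ (.inl (.inr hz)) fun _ => .inr] at hz'
        exact h z hz hz'
    · refine exists_congr fun S => exists_congr fun T => exists_congr fun n₁ => exists_congr
        fun n₂ => and_congr Iff.rfl (and_congr (ihP (injOn_lift (hρ.mono ?_)) ?_)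
          (and_congr (ihQ (hρ.mono fun _ => .inr) ?_) Iff.rfl))
      · exact fun _ h => .inl (.inr h)
      · exact hs _ fun z hz => hΓ z (.inl (.inr hz))
      · exact hu hΓ _ _ hρ (fun _ => .inr) (.inl (.inl rfl))
  | join x P ih =>
    simp only [rename, Ty, hΓ x (.inl rfl)]
    refine and_congr (h0 ρ P) (and_congr ?_ (exists_congr fun S => exists_congr fun T =>
      and_congr Iff.rfl (ih (injOn_lift (hρ.mono fun _ => .inr)) ?_)))
    · rw [h1]
      exact ⟨fun ⟨y, hy, e⟩ => hρ (.inr hy) (.inl rfl) e ▸ hy, fun h => ⟨x, h, rfl⟩⟩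
    · exact hs _ (hu (s := {z | z + 1 ∈ P.fn}) hΓ _ _ hρ (fun _ => .inr) (.inl rfl))
  | choice P Q ihP ihQ =>
    simp only [rename, Ty]
    refine and_congr ?_ (exists_congr fun n₁ => exists_congr fun n₂ => and_congr
      (ihP (hρ.mono fun _ => .inl) fun z hz => hΓ z (.inl hz)) (and_congr
        (ihQ (hρ.mono fun _ => .inr) fun z hz => hΓ z (.inr hz)) Iff.rfl))
    rw [Set.Subset.antisymm_iff, Set.Subset.antisymm_iff, rename_fn_subset hρ,
      rename_fn_subset (by rwa [Set.union_comm])]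
  | cut P Q ihP ihQ =>
    simp only [rename, Ty]
    refine and_congr (h0 ρ P) (and_congr (h0 ρ Q) (and_congr ?_ ?_))
    · simp only [h1]
      constructor
      · intro h z hz hz'
        exact h _ ⟨z, hz, rfl⟩ ⟨z, hz', rfl⟩
      · rintro h _ ⟨z, hz, rfl⟩ ⟨y, hy, e⟩
        cases hρ (.inr hy) (.inl hz) e
        exact h z hz hy
    · refine exists_congr fun S => exists_congr fun T => exists_congr fun n₁ => exists_congr
        fun n₂ => and_congr Iff.rfl (and_congr (ihP (injOn_lift (hρ.mono ?_)) ?_)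
          (and_congr (ihQ (injOn_lift (hρ.mono ?_)) ?_) Iff.rfl))
      · exact fun _ h => .inl h
      · exact hs _ fun z hz => hΓ z (.inl hz)
      · exact fun _ h => .inr h
      · exact hs _ fun z hz => hΓ z (.inr hz)

end CaP

namespace CaP

open Function SType

variable {Tag Name : Type} {D : Program Tag Name} {C : Oracle Tag Name}

/-- For payload channels this is transitivity of `Sub`. -/
theorem SType.Match.sub_trans {σ τ ρ : Msg Tag} (h : Match σ τ.dual) (h' : Match τ ρ.dual) :
    Match σ ρ.dual := by
  cases τ <;> cases ρ <;> simp only [Msg.dual] at * <;> cases h <;> cases h'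
  · exact .star
  · exact .tag ..
  · next h1 h2 => exact .chan _ _ (Correct.cut h1 h2)

/-! ### Typing of buffers -/

/-- Typing of a buffer: `S` is the type of the channel in the hole and `T` is its type
outside the buffer. -/
def BTy (D : Program Tag Name) (C : Oracle Tag Name) :
    Buffer Tag Name → (ℕ → SType Tag) → SType Tag → SType Tag → ℕ → Prop
  | .hole, _, S, T, _ => Sub S T
  | .select a B, Γ, S, T, n => ∃ (I : Finset Tag) (hI : I.Nonempty) (m : {a // a ∈ I} → ℕ)
      (K : {a // a ∈ I} → SType Tag) (k : {a // a ∈ I}) (n' : ℕ), k.1 = a ∧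
        Sub (SType.plus I hI m K) T ∧ BTy D C B Γ S (K k) n' ∧ 1 + m k + n' ≤ n
  | .fork P B, Γ, S, T, n => 0 ∈ P.fn ∧ (∀ z, z + 1 ∈ P.fn → z ∉ B.fn) ∧ ∃ S₁ T₁ n₁ n₂,
      Sub (SType.tensor S₁ T₁) T ∧ Ty D C P (scons S₁ Γ) n₁ ∧ BTy D C B Γ S T₁ n₂ ∧
        1 + n₁ + n₂ ≤ n

theorem BTy.mono {B : Buffer Tag Name} {Γ Γ' : ℕ → SType Tag} {S T T' : SType Tag} {n : ℕ}
    (h : BTy D C B Γ S T n) (hΓ : ∀ z ∈ B.fn, Γ z = Γ' z) (hT : Sub T T') :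
    BTy D C B Γ' S T' n := by
  induction B generalizing T T' n with
  | hole => exact Sub.trans h hT
  | select a B ih =>
    obtain ⟨I, hI, m, K, k, n', rfl, h1, h2, h3⟩ := h
    exact ⟨I, hI, m, K, k, n', rfl, h1.trans hT, ih h2 hΓ (Sub.refl _), h3⟩
  | fork P B ih =>
    obtain ⟨h0, hd, S₁, T₁, n₁, n₂, h1, h2, h3, h4⟩ := h
    refine ⟨h0, hd, S₁, T₁, n₁, n₂, h1.trans hT, h2.congr ?_,
      ih h3 (fun z hz => hΓ z (.inr hz)) (Sub.refl _), h4⟩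
    rintro (_ | z) hz
    exacts [rfl, hΓ z (.inl hz)]

theorem BTy.congr {B : Buffer Tag Name} {Γ Γ' : ℕ → SType Tag} {S T : SType Tag} {n : ℕ}
    (h : BTy D C B Γ S T n) (hΓ : ∀ z ∈ B.fn, Γ z = Γ' z) : BTy D C B Γ' S T n :=
  h.mono hΓ (Sub.refl _)

theorem bty_rename {B : Buffer Tag Name} {ρ : ℕ → ℕ} {Γ Γ' : ℕ → SType Tag} {S T : SType Tag}
    {n : ℕ} (hρ : Set.InjOn ρ B.fn) (hΓ : ∀ x ∈ B.fn, Γ' x = Γ (ρ x)) :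
    BTy D C (B.rename ρ) Γ S T n ↔ BTy D C B Γ' S T n := by
  induction B generalizing T n with
  | hole => exact Iff.rfl
  | select a B ih =>
    simp only [Buffer.rename, BTy, ih hρ hΓ]
  | fork P B ih =>
    simp only [Buffer.rename, BTy]
    refine and_congr ?_ (and_congr ?_ ?_)
    · rw [Proc.mem_fn_rename]
      refine ⟨?_, fun h => ⟨0, h, rfl⟩⟩
      rintro ⟨_ | y, hy, e⟩
      exacts [hy, by simp at e]
    · simp only [Buffer.mem_fn_rename, Proc.mem_fn_rename]
      constructor
      · intro h z hz hz'
        exact h (ρ z) ⟨z + 1, hz, rfl⟩ ⟨z, hz', rfl⟩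
      · rintro h z ⟨_ | y, hy, e⟩ ⟨y', hy', rfl⟩
        · simp at e
        · simp only [lift_succ, Nat.add_right_cancel_iff] at e
          cases hρ (.inl hy) (.inr hy') e
          exact h _ hy hy'
    · refine exists_congr fun S => exists_congr fun T => exists_congr fun n₁ => exists_congr
        fun n₂ => and_congr Iff.rfl (and_congr (ty_rename (injOn_lift (hρ.mono ?_)) ?_)
          (and_congr (ih (hρ.mono fun _ => .inr) fun z hz => hΓ z (.inr hz)) Iff.rfl))
      · exact fun _ h => .inl h
      · rintro (_ | z) hz
        exacts [rfl, hΓ z (.inl hz)]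

/-- By linearity the messages of a buffer mention neither its session channel nor any channel of the
hole, so they are typed independently of the hole. All that passes between the two is the type `S`
left on `x` after the outputs, and the measures add up. -/
theorem ty_fill {B : Buffer Tag Name} {x : ℕ} {P : Proc Tag Name} {Γ : ℕ → SType Tag} {n : ℕ}
    (hx : x ∈ P.fn) : Ty D C (B.fill x P) Γ n ↔ x ∉ B.fn ∧ (∀ z ∈ B.fn, z ∉ P.fn) ∧
      ∃ S n₁ n₂, BTy D C B Γ S (Γ x) n₁ ∧ Ty D C P (update Γ x S) n₂ ∧ n₁ + n₂ ≤ n := by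
  induction B generalizing Γ n with
  | hole =>
    simp only [Buffer.fill, Buffer.fn, BTy]
    constructor
    · intro h
      exact ⟨fun h => h, fun _ h => h.elim, Γ x, 0, n, Sub.refl _, by simpa using h, by omega⟩
    · rintro ⟨-, -, S, n₁, n₂, h1, h2, h3⟩
      -- An empty buffer is just a subtyping between hole and outside, which subsumption absorbs.
      refine h2.mono (fun z _ => ?_) (by omega)
      by_cases hz : z = x
      · subst hz; simpa using h1
      · simp [hz, Sub.refl]
  | select a B ih =>
    simp only [Buffer.fill, Buffer.fn, BTy, Ty, ih, Buffer.mem_fn_fill, hx]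
    constructor
    · rintro ⟨-, I, hI, m, K, k, n', rfl, h1, ⟨h2, h3, S, n₁, n₂, h4, h5, h6⟩, h7⟩
      refine ⟨h2, h3, S, _, n₂, ⟨I, hI, m, K, k, n₁, rfl, h1, ?_, le_rfl⟩, by simpa using h5,
        by omega⟩
      rw [update_self] at h4
      exact h4.congr fun z hz => update_of_ne (fun e => h2 (by rwa [← e])) _ _
    · rintro ⟨h2, h3, S, n₁, n₂, ⟨I, hI, m, K, k, n', rfl, h1, h4, h5⟩, h6, h7⟩
      refine ⟨by tauto, I, hI, m, K, k, n' + n₂, rfl, h1, ⟨h2, h3, S, n', n₂, ?_,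
        by simpa using h6, le_rfl⟩, by omega⟩
      rw [update_self]
      exact h4.congr fun z hz => (update_of_ne (fun e => h2 (by rwa [← e])) _ _).symm
  | fork Q B ih =>
    simp only [Buffer.fill, Buffer.fn, BTy, Ty, ih, Buffer.mem_fn_fill_of_mem hx, Set.mem_union,
      Set.mem_ofPred_eq]
    constructor
    · rintro ⟨h0, -, hd, S₁, T₁, m₁, m₂, h1, h1', ⟨h2, h3, S, n₁, n₂, h4, h5, h6⟩, h7⟩
      refine ⟨by rintro (h | h); exacts [hd _ h (.inr hx), h2 h],
        by rintro z (h | h); exacts [fun hz => hd _ h (.inr hz), h3 _ h],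
        S, _, n₂, ⟨h0, fun z hz h => hd z hz (.inl h), S₁, T₁, m₁, n₁, h1, h1', ?_, le_rfl⟩,
        by simpa using h5, by omega⟩
      rw [update_self] at h4
      exact h4.congr fun z hz => update_of_ne (fun e => h2 (by rwa [← e])) _ _
    · rintro ⟨h2, h3, S, n₁, n₂, ⟨h0, hd, S₁, T₁, m₁, m₂, h1, h1', h4, h5⟩, h6, h7⟩
      refine ⟨h0, .inr hx, fun z hz h => h.elim (hd z hz) (h3 z (.inl hz)), S₁, T₁, m₁, m₂ + n₂,
        h1, h1', ⟨fun h => h2 (.inr h), fun z hz => h3 z (.inr hz), S, m₂, n₂, ?_,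
          by simpa using h6, le_rfl⟩, by omega⟩
      rw [update_self]
      exact h4.congr fun z hz => (update_of_ne (fun e => h2 (.inr (by rwa [← e]))) _ _).symm

/-- Inputs cross a buffer. -/
theorem BTy.inp {B : Buffer Tag Name} {Γ : ℕ → SType Tag} {S T T' : SType Tag} {n : ℕ} {σ}
    (h : BTy D C B Γ S T n) (hT : Trans T (.inp σ) T') :
    ∃ τ S', Match τ σ.dual ∧ Trans S (.inp τ) S' ∧ BTy D C B Γ S' T' n := by
  induction B generalizing T T' n σ with
  | hole => exact Sub.inp h hT
  | select a B ih =>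
    obtain ⟨I, hI, m, K, k, n', rfl, h1, h2, h3⟩ := h
    obtain ⟨τ, U, hm, hU, hs⟩ := h1.inp hT
    -- Under a pending output the input can only be late, hence possible in every branch; the branch
    -- `k` of the message at hand is followed into the rest of the buffer.
    obtain ⟨K', rfl, hK⟩ := plus_inp hU
    obtain ⟨ρ, S', hm', hS, hB⟩ := ih h2 (hK k)
    exact ⟨ρ, S', hm'.sub_trans hm, hS, I, hI, m, K', k, n', rfl, hs, hB, h3⟩
  | fork P B ih =>
    obtain ⟨h0, hd, S₁, T₁, n₁, n₂, h1, h2, h3, h4⟩ := h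
    obtain ⟨τ, U, hm, hU, hs⟩ := h1.inp hT
    obtain ⟨T₂, rfl, hK⟩ := tensor_inp hU
    obtain ⟨ρ, S', hm', hS, hB⟩ := ih h3 hK
    exact ⟨ρ, S', hm'.sub_trans hm, hS, h0, hd, S₁, T₂, n₁, n₂, hs, h2, hB, h4⟩

/-! ### From typing derivations to syntax-directed typing -/

theorem TypingStep.mono {X Y : Proc Tag Name → Ctx Tag → ℕ → Prop}
    (hXY : ∀ P Γ n, X P Γ n → Y P Γ n) {P Γ n} (h : TypingStep D X P Γ n) :
    TypingStep D Y P Γ n := by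
  cases h with
  | done => exact .done _
  | call _ A xs m n h1 h2 h3 h4 h5 => exact .call _ A xs m n h1 h2 h3 (hXY _ _ _ h4) h5
  | link _ x y S T n h1 h2 h3 h4 h5 h6 => exact .link _ x y S T n h1 h2 h3 h4 h5 h6
  | cut _ Γ₁ Γ₂ P Q S T n₁ n₂ h1 h2 h3 h4 =>
    exact .cut _ Γ₁ Γ₂ P Q S T n₁ n₂ h1 h2 (hXY _ _ _ h3) (hXY _ _ _ h4)
  | choice_left _ P Q n₁ n₂ h1 h2 => exact .choice_left _ P Q n₁ n₂ (hXY _ _ _ h1) (hXY _ _ _ h2)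
  | choice_right _ P Q n₁ n₂ h1 h2 =>
    exact .choice_right _ P Q n₁ n₂ (hXY _ _ _ h1) (hXY _ _ _ h2)
  | close _ x n h1 h2 h3 => exact .close _ x n h1 h2 h3
  | wait _ x P n h1 h2 => exact .wait _ x P n h1 (hXY _ _ _ h2)
  | select _ x I hI m K k P n h1 h2 => exact .select _ x I hI m K k P n h1 (hXY _ _ _ h2)
  | offer _ x I F J hJ hJI m K n h1 h2 h3 =>
    exact .offer _ x I F J hJ hJI m K n h1 (fun j => hXY _ _ _ (h2 j)) h3
  | fork _ Γ₁ Γ₂ x S T P Q n₁ n₂ h1 h2 h3 h4 =>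
    exact .fork _ Γ₁ Γ₂ x S T P Q n₁ n₂ h1 h2 (hXY _ _ _ h3) (hXY _ _ _ h4)
  | join _ x S T P n h1 h2 => exact .join _ x S T P n h1 (hXY _ _ _ h2)

theorem Typed.step {P : Proc Tag Name} {Γ : Ctx Tag} {n : ℕ} (h : Typed D P Γ n) :
    (∀ x S, Γ x = some S → Regular S) ∧ TypingStep D (Typed D) P Γ n := by
  obtain ⟨X, hX, h⟩ := h
  exact ⟨(hX _ _ _ h).1, (hX _ _ _ h).2.mono fun _ _ _ hh => ⟨X, hX, hh⟩⟩

theorem Ctx.cons_ne_none {S : SType Tag} {Γ : Ctx Tag} {s : Set ℕ}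
    (h : ∀ x, Ctx.cons S Γ x ≠ none ↔ x ∈ s) : 0 ∈ s ∧ ∀ x, Γ x ≠ none ↔ x + 1 ∈ s :=
  ⟨(h 0).1 (by simp [Ctx.cons]), fun x => h (x + 1)⟩

theorem Ctx.Split.ne_none {Γ Γ₁ Γ₂ : Ctx Tag} (h : Ctx.Split Γ Γ₁ Γ₂) (x : ℕ) :
    Γ x ≠ none ↔ Γ₁ x ≠ none ∨ Γ₂ x ≠ none := by
  rcases h x with ⟨h1, h2⟩ | ⟨h1, h2⟩ <;> simp [h1, h2]

theorem Ctx.Split.disjoint {Γ Γ₁ Γ₂ : Ctx Tag} (h : Ctx.Split Γ Γ₁ Γ₂) (x : ℕ) :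
    ¬ (Γ₁ x ≠ none ∧ Γ₂ x ≠ none) := by
  rcases h x with ⟨h1, h2⟩ | ⟨h1, h2⟩ <;> simp [h1]

theorem Ctx.update_ne_none {Γ : Ctx Tag} {s : Set ℕ} {x : ℕ} {T : SType Tag}
    (h : ∀ z, update Γ x (some T) z ≠ none ↔ z ∈ s) :
    x ∈ s ∧ ∀ z, z ≠ x → (Γ z ≠ none ↔ z ∈ s) :=
  ⟨(h x).1 (by simp), fun z hz => by rw [← h z, update_of_ne hz]⟩

theorem Ctx.update_none {Γ : Ctx Tag} {s : Set ℕ} {x : ℕ}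
    (h : ∀ z, update Γ x none z ≠ none ↔ z ∈ s) :
    x ∉ s ∧ ∀ z, z ≠ x → (Γ z ≠ none ↔ z ∈ s) :=
  ⟨fun hx => (h x).2 hx (by simp), fun z hz => by rw [← h z, update_of_ne hz]⟩

/-- The domain of a typing context is the set of free channels. -/
theorem Typed.dom {P : Proc Tag Name} {Γ : Ctx Tag} {n : ℕ} (h : Typed D P Γ n) (x : ℕ) :
    Γ x ≠ none ↔ x ∈ P.fn := by
  induction P generalizing Γ n x with
  | done => cases h.step.2; simp [Ctx.empty, Proc.fn]
  | call A xs => cases h.step.2 with | call _ _ _ _ _ h1 h2 h3 => exact h3 x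
  | link y z =>
    cases h.step.2 with
    | link _ _ _ S T _ h1 h2 h3 h4 =>
      by_cases e : x = y
      · simp [e, h2, Proc.fn]
      · by_cases e' : x = z
        · simp [e', h3, Proc.fn]
        · simp [Proc.fn, e, e', h4 x e e']
  | close y =>
    cases h.step.2 with
    | close _ _ _ h1 h2 =>
      by_cases e : x = y
      · simp [e, h1, Proc.fn]
      · simp [Proc.fn, e, h2 x e]
  | wait y P ih =>
    cases h.step.2 with
    | wait _ _ _ _ h1 h2 =>
      have h3 := Ctx.update_none fun z => ih h2 z
      by_cases e : x = y
      · simp [e, h1, Proc.fn]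
      · rw [h3.2 x e]; simp [Proc.fn, e]
  | select y a P ih =>
    cases h.step.2 with
    | select _ _ I hI m K k _ _ h1 h2 =>
      have h3 := Ctx.update_ne_none fun z => ih h2 z
      by_cases e : x = y
      · simp [e, h1, Proc.fn]
      · rw [h3.2 x e]; simp [Proc.fn, e]
  | offer y I F ih =>
    cases h.step.2 with
    | offer _ _ _ _ J hJ hJI m K _ h1 h2 h3 =>
      by_cases e : x = y
      · simp [e, h1, Proc.fn]
      -- The type has at least one branch, and any typed branch already has the whole domain.
      · obtain ⟨a, ha⟩ := hJ
        have h4 := fun j => Ctx.update_ne_none fun z => ih _ (h2 j) z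
        simp only [Proc.fn, e, Set.mem_union, Set.mem_singleton_iff, false_or, Set.mem_ofPred_eq]
        refine ⟨fun hx => ⟨_, ((h4 ⟨a, ha⟩).2 x e).1 hx⟩, ?_⟩
        rintro ⟨i, hi⟩
        by_cases hiJ : i.1 ∈ J
        · exact ((h4 ⟨i.1, hiJ⟩).2 x e).2 hi
        · exact h3 i hiJ x hi
  | fork y P Q ihP ihQ =>
    cases h.step.2 with
    | fork _ Γ₁ Γ₂ _ S T _ _ _ _ h1 h2 h3 h4 =>
      by_cases e : x = y
      · simp [e, h1, Proc.fn]
      · have h5 := (Ctx.cons_ne_none fun z => ihP h3 z).2 x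
        have h6 := (Ctx.update_ne_none fun z => ihQ h4 z).2 x e
        have h7 := h2.ne_none x
        rw [update_of_ne e, h5, h6] at h7
        simp [h7, Proc.fn, e]
  | join y P ih =>
    cases h.step.2 with
    | join _ _ S T _ _ h1 h2 =>
      by_cases e : x = y
      · simp [e, h1, Proc.fn]
      · have h5 := (Ctx.cons_ne_none fun z => ih h2 z).2 x
        rw [update_of_ne e] at h5
        simp [h5, Proc.fn, e]
  | choice P Q ihP ihQ =>
    cases h.step.2 with
    | choice_left _ _ _ _ _ h1 h2 =>
      have h3 := ihP h1 x
      have h4 := ihQ h2 x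
      simp only [Proc.fn, Set.mem_union]; tauto
    | choice_right _ _ _ _ _ h1 h2 =>
      have h3 := ihP h1 x
      have h4 := ihQ h2 x
      simp only [Proc.fn, Set.mem_union]; tauto
  | cut P Q ihP ihQ =>
    cases h.step.2 with
    | cut _ Γ₁ Γ₂ _ _ S T _ _ h1 h2 h3 h4 =>
      have h5 := (Ctx.cons_ne_none fun z => ihP h3 z).2 x
      have h6 := (Ctx.cons_ne_none fun z => ihQ h4 z).2 x
      rw [h1.ne_none x, h5, h6]
      simp [Proc.fn]

/-- The oracle given by the typing derivations of the bodies of process definitions. -/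
def bodyOracle (D : Program Tag Name) : Oracle Tag Name := fun A Δ m =>
  ∃ Γ : Ctx Tag, Typed D (D.body A) Γ m ∧ ∀ x T, Γ x = some T → Δ x = T

theorem Ctx.Split.left {Γ Γ₁ Γ₂ : Ctx Tag} (h : Ctx.Split Γ Γ₁ Γ₂) {x : ℕ} {T : SType Tag}
    (hx : Γ₁ x = some T) : Γ x = some T := by
  rcases h x with ⟨h1, h2⟩ | ⟨h1, h2⟩ <;> simp_all

theorem Ctx.Split.right {Γ Γ₁ Γ₂ : Ctx Tag} (h : Ctx.Split Γ Γ₁ Γ₂) {x : ℕ} {T : SType Tag}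
    (hx : Γ₂ x = some T) : Γ x = some T := by
  rcases h x with ⟨h1, h2⟩ | ⟨h1, h2⟩ <;> simp_all

/-- Structural induction suffices, because the one rule whose premise is not about a subprocess is
invocation, and the oracle stores that premise. Regularity enters only at links, to pass from `Subt`
to `Sub`. -/
theorem Typed.ty {P : Proc Tag Name} {Γ : Ctx Tag} {n : ℕ} (h : Typed D P Γ n)
    {Δ : ℕ → SType Tag} (hΔ : ∀ x T, Γ x = some T → Δ x = T) :
    Ty D (bodyOracle D) P Δ n := by
  have hu : ∀ {Γ : Ctx Tag} {Δ : ℕ → SType Tag}, (∀ x T, Γ x = some T → Δ x = T) →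
      ∀ x S z T, update Γ x (some S) z = some T → update Δ x S z = T := by
    intro Γ Δ h x S z T hz
    by_cases e : z = x
    · subst e; simpa using hz
    · simp only [update_of_ne e] at *; exact h z T hz
  have hs : ∀ {Γ : Ctx Tag} {Δ : ℕ → SType Tag}, (∀ x T, Γ x = some T → Δ x = T) →
      ∀ S z T, Ctx.cons S Γ z = some T → scons S Δ z = T := by
    rintro Γ Δ h S (_ | z) T hz
    · simpa [Ctx.cons] using hz
    · exact h z T hz
  induction P generalizing Γ n Δ with
  | done => trivial
  | call A xs =>
    cases h.step.2 with
    | call _ _ _ m _ h1 h2 h3 h4 h5 =>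
      -- The default `SType.one` only concerns channels that are not parameters, hence not free in
      -- the body.
      refine ⟨h2, h1, fun i => ((xs[i]?.bind Γ).getD SType.one), m, ⟨_, h4, fun x T hx => ?_⟩,
        fun i hi => ?_, h5⟩
      · simp [hx]
      · have h6 := (h3 _).2 (List.getElem_mem hi)
        obtain ⟨T, hT⟩ := Option.ne_none_iff_exists'.1 h6
        rw [hΔ _ _ hT]
        simp [hi, hT, Sub.refl]
  | link y z =>
    obtain ⟨hr, h⟩ := h.step
    cases h with
    | link _ _ _ S T _ h1 h2 h3 h4 h5 h6 =>
      refine ⟨h1, ?_, h6⟩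
      rw [hΔ _ _ h2, hΔ _ _ h3]
      exact h5.sub (hr _ _ h3)
  | close y =>
    cases h.step.2 with
    | close _ _ _ h1 h2 h3 => exact ⟨hΔ _ _ h1 ▸ Sub.refl _, h3⟩
  | wait y P ih =>
    cases h.step.2 with
    | wait _ _ _ _ h1 h2 =>
      refine ⟨(Ctx.update_none h2.dom).1, hΔ _ _ h1 ▸ Sub.refl _, ih h2 fun z T hz => ?_⟩
      by_cases e : z = y
      · subst e; simp at hz
      · rw [update_of_ne e] at hz; exact hΔ z T hz
  | select y a P ih =>
    cases h.step.2 with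
    | select _ _ I hI m K k _ n' h1 h2 =>
      exact ⟨(Ctx.update_ne_none h2.dom).1, I, hI, m, K, k, n', rfl, hΔ _ _ h1 ▸ Sub.refl _,
        ih h2 (hu hΔ _ _), le_rfl⟩
  | offer y I F ih =>
    cases h.step.2 with
    | offer _ _ _ _ J hJ hJI m K _ h1 h2 h3 =>
      have h4 := fun j => Ctx.update_ne_none (h2 j).dom
      refine ⟨J, hJ, m, K, hJI, hΔ _ _ h1 ▸ Sub.refl _, fun j => ⟨(h4 j).1, fun i z hz => ?_,
        ih _ (h2 j) (hu hΔ _ _)⟩⟩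
      by_cases e : z = y
      · exact e ▸ (h4 j).1
      · rw [← (h4 j).2 z e]
        by_cases hiJ : i.1 ∈ J
        · exact ((h4 ⟨i.1, hiJ⟩).2 z e).2 hz
        · exact h3 i hiJ z hz
  | fork y P Q ihP ihQ =>
    cases h.step.2 with
    | fork _ Γ₁ Γ₂ _ S T _ _ n₁ n₂ h1 h2 h3 h4 =>
      have h5 := Ctx.cons_ne_none h3.dom
      have h6 := Ctx.update_ne_none h4.dom
      have h7 : ∀ z T, update Γ y none z = some T → Γ z = some T := by
        intro z T hz
        by_cases e : z = y
        · subst e; simp at hz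
        · rwa [update_of_ne e] at hz
      -- The session channel is removed before the context is split, so the payload cannot use it.
      have h8 : ∀ z, z + 1 ∈ P.fn → z ≠ y := by
        rintro z hz rfl
        exact (h2.ne_none z).2 (.inl ((h5.2 z).2 hz)) (by simp)
      exact ⟨h5.1, h6.1, fun z hz hz' => h2.disjoint z
          ⟨(h5.2 z).2 hz, (h6.2 z (h8 z hz)).2 hz'⟩,
        S, T, n₁, n₂, hΔ _ _ h1 ▸ Sub.refl _,
        ihP h3 (hs (fun z T hz => hΔ z T (h7 z T (h2.left hz))) _),
        ihQ h4 (hu (fun z T hz => hΔ z T (h7 z T (h2.right hz))) _ _), le_rfl⟩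
  | join y P ih =>
    cases h.step.2 with
    | join _ _ S T _ _ h1 h2 =>
      have h3 := Ctx.cons_ne_none h2.dom
      exact ⟨h3.1, (Ctx.update_ne_none h3.2).1, S, T, hΔ _ _ h1 ▸ Sub.refl _,
        ih h2 (hs (hu hΔ _ _) _)⟩
  | choice P Q ihP ihQ =>
    cases h.step.2 with
    | choice_left _ _ _ n₁ n₂ h1 h2 =>
      exact ⟨Set.ext fun z => (h1.dom z).symm.trans (h2.dom z), n₁, n₂, ihP h1 hΔ, ihQ h2 hΔ,
        .inl le_rfl⟩
    | choice_right _ _ _ n₁ n₂ h1 h2 =>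
      exact ⟨Set.ext fun z => (h1.dom z).symm.trans (h2.dom z), n₁, n₂, ihP h1 hΔ, ihQ h2 hΔ,
        .inr le_rfl⟩
  | cut P Q ihP ihQ =>
    cases h.step.2 with
    | cut _ Γ₁ Γ₂ _ _ S T n₁ n₂ h1 h2 h3 h4 =>
      have h5 := Ctx.cons_ne_none h3.dom
      have h6 := Ctx.cons_ne_none h4.dom
      exact ⟨h5.1, h6.1, fun z hz hz' => h1.disjoint z ⟨(h5.2 z).2 hz, (h6.2 z).2 hz'⟩,
        S, T, n₁, n₂, h2, ihP h3 (hs (fun z T hz => hΔ z T (h1.left hz)) _),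
        ihQ h4 (hs (fun z T hz => hΔ z T (h1.right hz)) _), le_rfl⟩

/-- The oracle only accepts typings under which the bodies are well typed. -/
def Oracle.Sound (D : Program Tag Name) (C : Oracle Tag Name) : Prop :=
  ∀ A Δ m, C A Δ m → Ty D C (D.body A) Δ m

theorem bodyOracle_sound : (bodyOracle D).Sound D :=
  fun _ _ _ ⟨_, h, hΔ⟩ => h.ty hΔ

end CaP

namespace CaP

open Function SType

variable {Tag Name : Type} {D : Program Tag Name} {C : Oracle Tag Name}

/-! ### Images of sets of channels -/

section Images

variable {s : Set ℕ}

@[simp] theorem exists_succ_eq_zero : (∃ y ∈ s, Nat.succ y = 0) ↔ False := by simp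
@[simp] theorem exists_succ_eq_add_one {z : ℕ} : (∃ y ∈ s, Nat.succ y = z + 1) ↔ z ∈ s := by simp

@[simp] theorem exists_swap_eq_zero : (∃ y ∈ s, swap y = 0) ↔ 1 ∈ s := by
  refine ⟨?_, fun h => ⟨1, h, rfl⟩⟩
  rintro ⟨_ | _ | y, h, e⟩ <;> simp_all [swap]

@[simp] theorem exists_swap_eq_one : (∃ y ∈ s, swap y = 1) ↔ 0 ∈ s := by
  refine ⟨?_, fun h => ⟨0, h, rfl⟩⟩
  rintro ⟨_ | _ | y, h, e⟩ <;> simp_all [swap]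

@[simp] theorem exists_swap_eq_add_two {z : ℕ} :
    (∃ y ∈ s, swap y = z + 1 + 1) ↔ z + 1 + 1 ∈ s := by
  refine ⟨?_, fun h => ⟨z + 2, h, rfl⟩⟩
  rintro ⟨_ | _ | y, h, e⟩ <;> simp_all [swap]

@[simp] theorem exists_lift_eq_zero {ρ : ℕ → ℕ} : (∃ y ∈ s, lift ρ y = 0) ↔ 0 ∈ s := by
  refine ⟨?_, fun h => ⟨0, h, rfl⟩⟩
  rintro ⟨_ | y, h, e⟩ <;> simp_all

@[simp] theorem exists_lift_succ_eq_one : (∃ y ∈ s, lift Nat.succ y = 1) ↔ False := by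
  refine ⟨?_, False.elim⟩
  rintro ⟨_ | y, h, e⟩ <;> simp_all

@[simp] theorem exists_lift_succ_eq_add_two {z : ℕ} :
    (∃ y ∈ s, lift Nat.succ y = z + 1 + 1) ↔ z + 1 ∈ s := by
  refine ⟨?_, fun h => ⟨z + 1, h, rfl⟩⟩
  rintro ⟨_ | y, h, e⟩ <;> simp_all

@[simp] theorem exists_inst_eq {y z : ℕ} :
    (∃ w ∈ s, inst y w = z) ↔ z + 1 ∈ s ∨ (0 ∈ s ∧ z = y) := by
  constructor
  · rintro ⟨_ | w, h, e⟩ <;> simp_all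
  · rintro (h | ⟨h, rfl⟩)
    exacts [⟨_, h, rfl⟩, ⟨0, h, rfl⟩]

@[simp] theorem exists_lift_inst_eq_add_one {y z : ℕ} :
    (∃ w ∈ s, lift (inst y) w = z + 1) ↔ z + 1 + 1 ∈ s ∨ (1 ∈ s ∧ z = y) := by
  constructor
  · rintro ⟨_ | _ | w, h, e⟩ <;> simp_all
  · rintro (h | ⟨h, rfl⟩)
    exacts [⟨_, h, rfl⟩, ⟨1, h, rfl⟩]

end Images

/-! ### Membership in free channels -/

@[simp] theorem Proc.mem_fn_link {x y z : ℕ} :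
    z ∈ (link x y : Proc Tag Name).fn ↔ z = x ∨ z = y := by simp [fn]

@[simp] theorem Proc.mem_fn_close {x z : ℕ} :
    z ∈ (close x : Proc Tag Name).fn ↔ z = x := by simp [fn]

@[simp] theorem Proc.mem_fn_wait {x z : ℕ} {P : Proc Tag Name} :
    z ∈ (wait x P).fn ↔ z = x ∨ z ∈ P.fn := by simp [fn]

@[simp] theorem Proc.mem_fn_select {x z : ℕ} {a : Tag} {P : Proc Tag Name} :
    z ∈ (select x a P).fn ↔ z = x ∨ z ∈ P.fn := by simp [fn]

@[simp] theorem Proc.mem_fn_offer {x z : ℕ} {I : Finset Tag} {F : {a // a ∈ I} → Proc Tag Name} :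
    z ∈ (offer x I F).fn ↔ z = x ∨ ∃ i, z ∈ (F i).fn := by simp [fn]

@[simp] theorem Proc.mem_fn_fork {x z : ℕ} {P Q : Proc Tag Name} :
    z ∈ (fork x P Q).fn ↔ z = x ∨ z + 1 ∈ P.fn ∨ z ∈ Q.fn := by simp [fn, or_assoc]

@[simp] theorem Proc.mem_fn_join {x z : ℕ} {P : Proc Tag Name} :
    z ∈ (join x P).fn ↔ z = x ∨ z + 1 ∈ P.fn := by simp [fn]

@[simp] theorem Proc.mem_fn_choice {z : ℕ} {P Q : Proc Tag Name} :
    z ∈ (choice P Q).fn ↔ z ∈ P.fn ∨ z ∈ Q.fn := by simp [fn]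

@[simp] theorem Proc.mem_fn_cut {z : ℕ} {P Q : Proc Tag Name} :
    z ∈ (cut P Q).fn ↔ z + 1 ∈ P.fn ∨ z + 1 ∈ Q.fn := by simp [fn]

@[simp] theorem Buffer.rename_eq_hole {ρ : ℕ → ℕ} {B : Buffer Tag Name} :
    B.rename ρ = hole ↔ B = hole := by cases B <;> simp [rename]

theorem mem_fn_body_rename {A : Name} {xs : List ℕ} (h : xs.length = D.arity A) {z : ℕ} :
    z ∈ ((D.body A).rename fun i => xs.getD i 0).fn ↔ z ∈ xs := by
  rw [Proc.mem_fn_rename, D.fn_body, List.mem_iff_getElem]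
  constructor
  · rintro ⟨i, hi, rfl⟩
    have hi : i < xs.length := h ▸ hi
    exact ⟨i, hi, by simp [hi]⟩
  · rintro ⟨i, hi, rfl⟩
    exact ⟨i, h ▸ hi, by simp [hi]⟩

/-- Structural pre-congruence does not create free channels. -/
theorem PCong.fn_subset {P Q : Proc Tag Name} (h : PCong D P Q) {z : ℕ} (hz : z ∈ Q.fn) :
    z ∈ P.fn := by
  induction h generalizing z with
  | s_call A xs h => exact (mem_fn_body_rename h).1 hz
  | s_link x y => simpa [or_comm] using hz
  | s_comm P Q => simpa [or_comm] using hz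
  | s_wait B y P Q => simp [Buffer.mem_fn_fill] at *; grind
  -- When `I` is empty the channels of `Q` disappear, so only an inclusion holds without typing.
  | s_case B y I F Q => simp [Buffer.mem_fn_fill] at *; grind
  | s_join B y P Q => simp [Buffer.mem_fn_fill] at *; grind
  | s_pull_0 B B' y P => simp [Buffer.mem_fn_fill] at *; grind
  | s_pull_1 y P Q R h => simp at *; grind
  | s_pull_2 B y P Q => simp [Buffer.mem_fn_fill] at *; grind
  | s_pull_3 B x y P Q hxy h => simp [Buffer.mem_fn_fill] at *; grind
  | s_pull_4 B B' x y P hxy h => simp [Buffer.mem_fn_fill] at *; grind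
  | refl P => exact hz
  | trans P Q R h h' ih ih' => exact ih (ih' hz)
  | c_wait x P P' h ih => simp at *; grind
  | c_select x a P P' h ih => simp at *; grind
  | c_offer x I F F' h ih => simp at *; grind
  | c_fork x P P' Q Q' h h' ih ih' => simp at *; grind
  | c_join x P P' h ih => simp at *; grind
  | c_choice P P' Q Q' h h' ih ih' => simp at *; grind
  | c_cut P P' Q Q' h h' ih ih' => simp at *; grind

end CaP

namespace CaP

open Function SType

variable {Tag Name : Type} {D : Program Tag Name} {C : Oracle Tag Name}

/-! ### Structural pre-congruence preserves typing -/

/-- A typed output keeps its session channel free in the continuation, so a non-empty buffer forces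
the channel to occur in the hole. -/
theorem mem_of_ty_fill {B : Buffer Tag Name} {x : ℕ} {P : Proc Tag Name} {Γ : ℕ → SType Tag}
    {n : ℕ} (h : Ty D C (B.fill x P) Γ n) (hB : B ≠ .hole ∨ x ∈ P.fn) : x ∈ P.fn := by
  induction B generalizing Γ n with
  | hole => simpa using hB
  | select a B ih =>
    obtain ⟨hx, I, hI, m, K, k, n', -, -, h', -⟩ := h
    rw [Buffer.mem_fn_fill] at hx
    by_cases hB : B = .hole
    · subst hB; simpa [Buffer.fn] using hx
    · exact ih h' (.inl hB)
  | fork Q B ih =>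
    obtain ⟨-, hx, -, S, T, n₁, n₂, -, -, h', -⟩ := h
    rw [Buffer.mem_fn_fill] at hx
    by_cases hB : B = .hole
    · subst hB; simpa [Buffer.fn] using hx
    · exact ih h' (.inl hB)

/-- Decomposition of the typing of a cut whose left component is a filled buffer. -/
theorem ty_cut_fill {B : Buffer Tag Name} {P Q : Proc Tag Name} {Γ : ℕ → SType Tag} {n : ℕ}
    (h : Ty D C (.cut (B.fill 0 P) Q) Γ n) : 0 ∈ P.fn ∧ 0 ∈ Q.fn ∧ 0 ∉ B.fn ∧
      (∀ z ∈ B.fn, z ∉ P.fn) ∧ (∀ z, z + 1 ∈ B.fn → z + 1 ∉ Q.fn) ∧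
      (∀ z, z + 1 ∈ P.fn → z + 1 ∉ Q.fn) ∧ ∃ S S' T n₁ n₂ n₃, Correct S T ∧
      BTy D C B (scons S' Γ) S' S n₁ ∧ Ty D C P (scons S' Γ) n₂ ∧ Ty D C Q (scons T Γ) n₃ ∧
      n₁ + n₂ + n₃ ≤ n := by
  obtain ⟨h0, h0', hd, S, T, n₁, n₂, hST, h1, h2, h3⟩ := h
  have hx : 0 ∈ P.fn := mem_of_ty_fill h1 (by
    rw [Buffer.mem_fn_fill] at h0
    by_cases hB : B = .hole
    · subst hB; right; simpa [Buffer.fn] using h0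
    · exact .inl hB)
  obtain ⟨h4, h5, S', m₁, m₂, h6, h7, h8⟩ := (ty_fill hx).1 h1
  simp only [Buffer.mem_fn_fill_of_mem hx] at hd
  rw [update_scons_zero] at h7
  refine ⟨hx, h0', h4, h5, fun z hz => hd z (.inl hz), fun z hz => hd z (.inr hz), S, S', T,
    m₁, m₂, n₂, hST, h6.congr ?_, h7, h2, by omega⟩
  -- The buffer does not use channel 0, so it may be typed in the same environment as its hole.
  rintro (_ | z) hz
  exacts [(h4 hz).elim, rfl]

/-- Typing of a cut whose left component is a filled buffer. -/
theorem ty_cut_fill_intro {B : Buffer Tag Name} {P Q : Proc Tag Name} {Γ Γ' : ℕ → SType Tag}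
    {n n₁ n₂ n₃ : ℕ} {S S' T : SType Tag}
    (h0 : 0 ∈ P.fn) (h0' : 0 ∈ Q.fn) (hB : 0 ∉ B.fn) (hBP : ∀ z ∈ B.fn, z ∉ P.fn)
    (hBQ : ∀ z, z + 1 ∈ B.fn → z + 1 ∉ Q.fn) (hPQ : ∀ z, z + 1 ∈ P.fn → z + 1 ∉ Q.fn)
    (hST : Correct S T) (h1 : BTy D C B (scons S' Γ') S' S n₁)
    (hΓ : ∀ z, z + 1 ∈ B.fn → Γ' z = Γ z) (h2 : Ty D C P (scons S' Γ) n₂)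
    (h3 : Ty D C Q (scons T Γ) n₃) (hn : n₁ + n₂ + n₃ ≤ n) :
    Ty D C (.cut (B.fill 0 P) Q) Γ n := by
  refine ⟨by rw [Buffer.mem_fn_fill_of_mem h0]; exact .inr h0, h0', ?_, S, T, n₁ + n₂, n₃, hST,
    (ty_fill h0).2 ⟨hB, hBP, S', n₁, n₂, h1.congr ?_, by rwa [update_scons_zero], le_rfl⟩, h3, hn⟩
  · intro z hz
    rw [Buffer.mem_fn_fill_of_mem h0] at hz
    exact hz.elim (hBQ z) (hPQ z)
  · rintro (_ | z) hz
    exacts [(hB hz).elim, hΓ z hz]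

/-- The arguments are pairwise distinct, so passing them is an injective renaming of the parameters,
and the oracle types the body. The default argument 0 is never reached on a free channel. -/
theorem ty_s_call (hC : C.Sound D) {A : Name} {xs : List ℕ} {Γ n} (h : Ty D C (.call A xs) Γ n) :
    Ty D C ((D.body A).rename fun i => xs.getD i 0) Γ n := by
  obtain ⟨h1, h2, Δ, m, h3, h4, h5⟩ := h
  have hlt : ∀ i, i ∈ (D.body A).fn → i < xs.length := by
    intro i hi; rw [D.fn_body] at hi; exact h2 ▸ hi
  rw [ty_rename (Γ' := fun i => Γ (xs.getD i 0)) _ fun _ _ => rfl]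
  · refine (hC _ _ _ h3).mono (fun i hi => ?_) h5
    simpa [hlt i hi] using h4 i (hlt i hi)
  · intro i hi j hj e
    simp only [List.getD_eq_getElem _ _ (hlt i hi), List.getD_eq_getElem _ _ (hlt j hj)] at e
    exact (List.Nodup.getElem_inj_iff h1).1 e

theorem ty_s_wait {B : Buffer Tag Name} {y : ℕ} {P Q : Proc Tag Name} {Γ n}
    (h : Ty D C (.cut (B.fill 0 (.wait (y + 1) P)) Q) Γ n) :
    Ty D C (.wait y (.cut (B.fill 0 P) Q)) Γ n := by
  obtain ⟨h0, h0', hB, hBP, hBQ, hPQ, S, S', T, n₁, n₂, n₃, hST, h1, ⟨h2, h3, h4⟩, h5, hn⟩ :=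
    ty_cut_fill h
  have h0 : 0 ∈ P.fn := by simpa using h0
  refine ⟨?_, h3, ty_cut_fill_intro h0 h0' hB (fun z hz hz' => hBP z hz (by simp [hz'])) hBQ
    (fun z hz => hPQ z (by simp [hz])) hST h1 (fun _ _ => rfl) h4 h5 hn⟩
  have h6 : y + 1 ∉ B.fn := fun h => hBP _ h (by simp)
  have h7 := hPQ y (by simp)
  simp [Buffer.mem_fn_fill_of_mem h0, h2, h6, h7]

theorem scons_update_congr {s : Set ℕ} {Γ : ℕ → SType Tag} {y : ℕ} {S T : SType Tag}
    (hy : y + 1 ∉ s) : ∀ z ∈ s, scons S Γ z = scons S (update Γ y T) z := by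
  rintro (_ | z) hz
  · rfl
  · exact (update_of_ne (fun e : z = y => hy (e ▸ hz)) _ _).symm

/-- Each typed branch contains the cut channel, because it contains the free channels of all
branches; the cut is then rebuilt in it and carries the annotation of the branch. The second
component provides a branch, without which the channels of `Q` could be lost. -/
theorem ty_s_case {B : Buffer Tag Name} {y : ℕ} {I : Finset Tag}
    {F : {a // a ∈ I} → Proc Tag Name} {Q : Proc Tag Name} {Γ n}
    (h : Ty D C (.cut (B.fill 0 (.offer (y + 1) I F)) Q) Γ n) :
    Ty D C (.offer y I fun i => .cut (B.fill 0 (F i)) Q) Γ n ∧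
      ∃ i, y + 1 ∈ (F i).fn := by
  obtain ⟨h0, h0', hB, hBP, hBQ, hPQ, S, S', T, n₁, n₂, n₃, hST, h1,
    ⟨J, hJ, m, K, hJI, h2, h3⟩, h5, hn⟩ := ty_cut_fill h
  obtain ⟨i₀, hi₀⟩ : ∃ i, 0 ∈ (F i).fn := by simpa using h0
  have h6 : y + 1 ∉ B.fn := fun h => hBP _ h (by simp)
  have h7 := hPQ y (by simp)
  refine ⟨⟨J, hJ, m, K, hJI, h2, fun j => ?_⟩, let ⟨a, ha⟩ := hJ; ⟨_, (h3 ⟨a, ha⟩).1⟩⟩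
  obtain ⟨h8, h9, h10⟩ := h3 j
  have h0 := h9 i₀ hi₀
  refine ⟨by simp [Buffer.mem_fn_fill, h8], fun i z => ?_, ?_⟩
  · have := @h9 i (z + 1)
    simp only [Proc.mem_fn_cut, Buffer.mem_fn_fill]
    tauto
  · rw [← scons_update] at h10
    refine ty_cut_fill_intro h0 h0' hB (fun z hz hz' => hBP z hz (Proc.mem_fn_offer.2 (.inr ⟨_, hz'⟩))) hBQ
      (fun z hz => hPQ z (Proc.mem_fn_offer.2 (.inr ⟨_, hz⟩))) hST h1 ?_ h10
      (h5.congr (scons_update_congr h7)) (by omega)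
    intro z hz
    exact (update_of_ne (fun e : z = y => h6 (e ▸ hz)) _ _).symm

theorem ty_rename_lift_succ {P : Proc Tag Name} {S T : SType Tag} {Γ : ℕ → SType Tag} {n : ℕ} :
    Ty D C (P.rename (lift Nat.succ)) (scons S (scons T Γ)) n ↔ Ty D C P (scons S Γ) n :=
  ty_rename (lift_injective Nat.succ_injective).injOn (by rintro (_ | z) _ <;> rfl)

theorem bty_rename_lift_succ {B : Buffer Tag Name} {S T U V : SType Tag} {Γ : ℕ → SType Tag}
    {n : ℕ} : BTy D C (B.rename (lift Nat.succ)) (scons S (scons T Γ)) U V n ↔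
      BTy D C B (scons S Γ) U V n :=
  bty_rename (lift_injective Nat.succ_injective).injOn (by rintro (_ | z) _ <;> rfl)

theorem ty_rename_swap {P : Proc Tag Name} {S T : SType Tag} {Γ : ℕ → SType Tag} {n : ℕ} :
    Ty D C (P.rename swap) (scons S (scons T Γ)) n ↔ Ty D C P (scons T (scons S Γ)) n :=
  ty_rename swap_injective.injOn (by rintro (_ | _ | z) _ <;> rfl)

theorem ty_rename_succ {P : Proc Tag Name} {S : SType Tag} {Γ : ℕ → SType Tag} {n : ℕ} :
    Ty D C (P.rename Nat.succ) (scons S Γ) n ↔ Ty D C P Γ n :=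
  ty_rename Nat.succ_injective.injOn fun _ _ => rfl

theorem bty_rename_succ {B : Buffer Tag Name} {S U V : SType Tag} {Γ : ℕ → SType Tag}
    {n : ℕ} : BTy D C (B.rename Nat.succ) (scons S Γ) U V n ↔ BTy D C B Γ U V n :=
  bty_rename Nat.succ_injective.injOn fun _ _ => rfl

theorem ty_s_join {B : Buffer Tag Name} {y : ℕ} {P Q : Proc Tag Name} {Γ n}
    (h : Ty D C (.cut (B.fill 0 (.join (y + 1) P)) Q) Γ n) :
    Ty D C (.join y (.cut ((B.rename (lift Nat.succ)).fill 0 (P.rename swap))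
      (Q.rename (lift Nat.succ)))) Γ n := by
  obtain ⟨h0, h0', hB, hBP, hBQ, hPQ, S, S', T, n₁, n₂, n₃, hST, h1,
    ⟨h2, h3, S₁, T₁, h4, h4'⟩, h5, hn⟩ := ty_cut_fill h
  have h0 : 1 ∈ P.fn := by simpa using h0
  have h6 : y + 1 ∉ B.fn := fun h => hBP _ h (by simp)
  have h7 := hPQ y (by simp)
  refine ⟨by simp [Buffer.mem_fn_fill, h2], by simp [Buffer.mem_fn_fill, h3], S₁, T₁, h4, ?_⟩
  rw [← scons_update] at h4'
  refine ty_cut_fill_intro (by simpa using h0) (by simpa using h0') (by simpa using hB) ?_ ?_ ?_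
    hST (bty_rename_lift_succ.2 (h1.congr (scons_update_congr h6))) (fun _ _ => rfl)
    (ty_rename_swap.2 h4') (ty_rename_lift_succ.2 (h5.congr (scons_update_congr h7))) hn
  · rintro (_ | _ | z) hz hz'
    · simp at hz; exact hB hz
    · simp at hz
    · simp only [Buffer.mem_fn_rename, exists_lift_succ_eq_add_two, Proc.mem_fn_rename,
        exists_swap_eq_add_two] at hz hz'
      exact hBP _ hz (by simp [hz'])
  · rintro (_ | z) hz hz'
    · simp at hz
    · simp only [Buffer.mem_fn_rename, exists_lift_succ_eq_add_two, Proc.mem_fn_rename] at hz hz'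
      exact hBQ _ hz hz'
  · rintro (_ | z) hz hz'
    · simp at hz'
    · simp only [exists_lift_succ_eq_add_two, Proc.mem_fn_rename,
        exists_swap_eq_add_two] at hz hz'
      exact hPQ _ (by simp [hz]) hz'

/-- The messages of `B` move to `y`, whose type was only constrained by the link. Let `V` be the
type of the cut channel at the link, inside `B'`. Every output of the sender is answered by its
partner and crosses `B'` to become a late input of `V`. So the type that makes these outputs and
continues with the duals of the successors of `V` composes correctly with `V`: it is a subtype of
the dual of `V`, hence of the type of `y`. After the message, the link is retyped between a
successor of `V` and its dual, and the rest of `B` follows by induction. -/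
theorem ty_s_pull_0 {B B' : Buffer Tag Name} {y : ℕ} {P : Proc Tag Name} {Γ n}
    (h : Ty D C (.cut (B.fill 0 P) (B'.fill 0 (.link 0 (y + 1)))) Γ n) :
    Ty D C ((B.rename (inst y)).fill y (.cut P (B'.fill 0 (.link 0 (y + 1))))) Γ n := by
  have hx : 0 ∈ (Proc.link 0 (y + 1) : Proc Tag Name).fn := by simp
  have hy : y + 1 ∈ (B'.fill 0 (.link 0 (y + 1))).fn := by simp [Buffer.mem_fn_fill]
  induction B generalizing Γ n with
  | hole => exact h
  | select a B ih =>
    obtain ⟨-, h0', hd, S, T, n₁, n₂, hST, ⟨h0, I, hI, m, K, k, n', rfl, h1, h2, h3⟩, h4, hn⟩ := h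
    obtain ⟨h5, h6, V, m₁, m₂, h7, ⟨h8, h9, h10⟩, h11⟩ := (ty_fill hx).1 h4
    rw [update_scons_zero] at h2
    simp only [scons_zero, update_self, scons_succ, ne_eq, Nat.succ_ne_zero, not_false_eq_true,
      update_of_ne] at h7 h9
    have hc := hST.sub_left h1
    -- All tags are answered, not only the one being sent, because the new type for `y` offers the
    -- whole choice.
    have key : ∀ i : {a // a ∈ I}, ∃ T' V', Correct (K i) T' ∧ Trans V (.inp (.tag (m i) i)) V' ∧
        BTy D C B' (scons T Γ) V' T' m₁ := by
      intro i
      obtain ⟨τ, T', hm, hT, hK⟩ := hc.out (trans_plus i)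
      cases hm
      obtain ⟨ρ, V', hm, hV, hB⟩ := h7.inp hT
      cases hm
      exact ⟨T', V', hK, hV, hB⟩
    choose T' V' hK hV hB using key
    have hsub : Sub (plus I hI m fun i => (V' i).dual) (Γ y) :=
      Sub.trans (by unfold SType.Sub; rw [SType.dual_dual]; exact correct_plus hV) h9
    have hy' : y + 1 ∉ (B.fill 0 P).fn := fun h => hd y (by simp [Buffer.fill, h]) hy
    refine ⟨?_, I, hI, m, _, k, n' + n₂, rfl, hsub, ih ⟨h0, h0', ?_, K k, T' k, n', n₂, hK k,
      h2.congr (scons_update_congr hy'), (ty_fill hx).2 ⟨h5, h6, V' k, m₁, m₂, (hB k).congr ?_,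
        ⟨h8, ?_, h10⟩, h11⟩, le_rfl⟩, by omega⟩
    · simp [Buffer.mem_fn_fill]
    · exact fun z hz => hd z (by simp [Buffer.fill, hz])
    · rintro (_ | z) hz
      · exact (h5 hz).elim
      · exact (update_of_ne (fun e : z = y => h6 _ hz (by simp [e])) _ _).symm
    · simp [Sub.refl]
  | fork Q B ih =>
    obtain ⟨-, h0', hd, S, T, n₁, n₂, hST, ⟨h0, h0'', hQ, S₁, T₁, k₁, k₂, h1, h1', h2, h3⟩,
      h4, hn⟩ := h
    obtain ⟨h5, h6, V, m₁, m₂, h7, ⟨h8, h9, h10⟩, h11⟩ := (ty_fill hx).1 h4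
    rw [update_scons_zero] at h2
    simp only [scons_zero, update_self, scons_succ, ne_eq, Nat.succ_ne_zero, not_false_eq_true,
      update_of_ne] at h7 h9
    obtain ⟨τ, T', hm, hT, hK⟩ := (hST.sub_left h1).out trans_tensor
    obtain ⟨ρ, V', hm', hV, hB⟩ := h7.inp hT
    cases hm with | chan _ A hA =>
    cases ρ <;> simp only [Msg.dual] at hm' <;> cases hm'
    rename_i A' hA'
    have hsub : Sub (tensor S₁ V'.dual) (Γ y) :=
      Sub.trans (by unfold SType.Sub; rw [SType.dual_dual]; exact correct_tensor hV (hA.sub_right hA')) h9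
    have hy' : y + 1 ∉ (B.fill 0 P).fn := fun h => hd y (by simp [Buffer.fill, h]) hy
    have hyQ : y + 1 + 1 ∉ Q.fn := fun h => hd y (by simp [Buffer.fill, h]) hy
    -- The session continues in the rest of the buffer, so the payload does not use it and
    -- substituting `y` for it there is vacuous.
    have h1Q : 1 ∉ Q.fn := fun h => hQ 0 h h0''
    refine ⟨by simpa using h0, by simp [Buffer.mem_fn_fill], ?_, S₁, V'.dual, k₁, k₂ + n₂, hsub, ?_,
      ih ⟨h0'', h0', ?_, T₁, T', k₂, n₂, hK,
      h2.congr (scons_update_congr hy'), (ty_fill hx).2 ⟨h5, h6, V', m₁, m₂, hB.congr ?_,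
        ⟨h8, ?_, h10⟩, h11⟩, le_rfl⟩, by omega⟩
    · intro z hz hz'
      simp only [Proc.mem_fn_rename, exists_lift_inst_eq_add_one, h1Q, false_and, or_false] at hz
      have h12 := hd z
      have h13 := hQ (z + 1) hz
      simp only [Buffer.mem_fn_fill, Buffer.fill, Proc.mem_fn_fork, Proc.mem_fn_cut,
        Buffer.mem_fn_rename, exists_inst_eq, hz] at h12 h13 hz' h6 hy
      grind
    · rw [ty_rename (Γ' := scons S₁ (scons S Γ))]
      · exact h1'
      · rintro (_ | _ | a) ha (_ | _ | b) hb e <;> simp_all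
      · rintro (_ | _ | z) hz
        exacts [rfl, (h1Q hz).elim, rfl]
    · exact fun z hz => hd z (by simp [Buffer.fill, hz])
    · rintro (_ | z) hz
      · exact (h5 hz).elim
      · exact (update_of_ne (fun e : z = y => h6 _ hz (by simp [e])) _ _).symm
    · simp [Sub.refl]

theorem ty_s_pull_1 {y : ℕ} {P Q R : Proc Tag Name} {Γ n} (hP : 1 ∈ P.fn)
    (h : Ty D C (.cut (.fork (y + 1) P (Q.rename Nat.succ)) R) Γ n) :
    Ty D C (.fork y (.cut (P.rename swap) (R.rename (lift Nat.succ))) Q) Γ n := by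
  obtain ⟨h0, h0', hd, S, T, n₁, n₂, hST, ⟨h1, h2, h3, S₁, T₁, k₁, k₂, h4, h5, h6, h7⟩, h8, hn⟩ := h
  rw [← scons_update, ty_rename_succ] at h6
  refine ⟨by simpa using h1, by simpa using h2, ?_, S₁, T₁, k₁ + n₂, k₂, h4,
    ⟨by simpa using hP, by simpa using h0', ?_, S, T, k₁, n₂, hST, ty_rename_swap.2 h5,
      ty_rename_lift_succ.2 h8, le_rfl⟩, h6, by omega⟩
  · intro z hz hz'
    simp only [Proc.mem_fn_cut, Proc.mem_fn_rename, exists_swap_eq_add_two,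
      exists_lift_succ_eq_add_two] at hz
    rcases hz with hz | hz
    · exact h3 _ hz (by simpa using hz')
    · exact hd z (by simp [hz']) hz
  · rintro (_ | z) hz hz'
    · simp at hz'
    · simp only [Proc.mem_fn_rename, exists_swap_eq_add_two, exists_lift_succ_eq_add_two] at hz hz'
      exact hd z (by simp [hz]) hz'

theorem ty_s_pull_2 {B : Buffer Tag Name} {y : ℕ} {P Q : Proc Tag Name} {Γ n}
    (h : Ty D C (.cut ((B.rename Nat.succ).fill (y + 1) P) Q) Γ n) :
    Ty D C (B.fill y (.cut P Q)) Γ n := by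
  -- With an empty buffer both sides coincide, and `y` need not occur in `P`; otherwise it must.
  by_cases hB : B = .hole
  · subst hB; exact h
  obtain ⟨h0, h0', hd, S, T, n₁, n₂, hST, h1, h2, hn⟩ := h
  have hy : y + 1 ∈ P.fn := mem_of_ty_fill h1 (.inl (by simpa using hB))
  obtain ⟨h3, h4, S', m₁, m₂, h5, h6, h7⟩ := (ty_fill hy).1 h1
  rw [← scons_update] at h6
  rw [bty_rename_succ] at h5
  simp only [Buffer.mem_fn_fill_of_mem hy, Buffer.mem_fn_rename, exists_succ_eq_zero,
    exists_succ_eq_add_one, false_or] at h0 hd h3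
  have h4 : ∀ z ∈ B.fn, z + 1 ∉ P.fn := fun z hz => h4 _ (by simpa using hz)
  rw [ty_fill (by simp [hy])]
  refine ⟨h3, fun z hz hz' => ?_, S', m₁, m₂ + n₂, h5, ⟨h0, h0', fun z hz => hd z (.inr hz),
    S, T, m₂, n₂, hST, h6, h2.congr (scons_update_congr fun h => hd y (.inr hy) h), le_rfl⟩,
      by omega⟩
  exact (Proc.mem_fn_cut.1 hz').elim (h4 z hz) (hd z (.inl hz))

theorem ty_s_pull_3 {B : Buffer Tag Name} {x y : ℕ} {P Q : Proc Tag Name} {Γ n}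
    (hxy : x ≠ y) (hx : x + 1 ∈ P.fn) (h : Ty D C (B.fill x (.fork y P Q)) Γ n) :
    Ty D C (.fork y ((B.rename Nat.succ).fill (x + 1) P) Q) Γ n := by
  rw [ty_fill (by simp [hx])] at h
  obtain ⟨h1, h2, S, n₁, n₂, h3, ⟨h4, h5, h6, S₁, T₁, k₁, k₂, h7, h8, h9, h10⟩, hn⟩ := h
  rw [update_of_ne hxy.symm] at h7
  rw [update_comm hxy] at h9
  refine ⟨by simp [Buffer.mem_fn_fill, h4], h5, fun z hz hz' => ?_, S₁, T₁, n₁ + k₁, k₂, h7,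
    (ty_fill hx).2 ⟨by simpa using h1, ?_, S, n₁, k₁, bty_rename_succ.2 h3,
      by rwa [← scons_update], le_rfl⟩, h9.congr fun z hz => update_of_ne ?_ _ _, by omega⟩
  · simp only [Buffer.mem_fn_fill_of_mem hx, Buffer.mem_fn_rename, exists_succ_eq_add_one] at hz
    exact hz.elim (fun hz => h2 z hz (by simp [hz'])) fun hz => h6 z hz hz'
  · rintro (_ | z) hz hz'
    · simp at hz
    · simp only [Buffer.mem_fn_rename, exists_succ_eq_add_one] at hz
      exact h2 z hz (by simp [hz'])
  · rintro rfl; exact h6 _ hx hz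

theorem ty_s_pull_4 {B B' : Buffer Tag Name} {x y : ℕ} {P : Proc Tag Name} {Γ n}
    (hxy : x ≠ y) (hx : x ∈ P.fn) (h : Ty D C (B.fill x (B'.fill y P)) Γ n) :
    Ty D C (B'.fill y (B.fill x P)) Γ n := by
  by_cases hB : B' = .hole
  · subst hB; exact h
  rw [ty_fill (by simp [Buffer.mem_fn_fill, hx])] at h
  obtain ⟨h1, h2, S, n₁, n₂, h3, h4, hn⟩ := h
  have hy : y ∈ P.fn := mem_of_ty_fill h4 (.inl hB)
  rw [ty_fill hy] at h4
  obtain ⟨h5, h6, S', m₁, m₂, h7, h8, h9⟩ := h4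
  simp only [Buffer.mem_fn_fill_of_mem hy] at h2
  rw [update_of_ne hxy.symm] at h7
  rw [update_comm hxy] at h8
  rw [ty_fill (by simp [Buffer.mem_fn_fill, hy])]
  refine ⟨h5, fun z hz hz' => ?_, S', m₁, n₁ + m₂, h7.congr fun z hz => update_of_ne ?_ _ _,
    (ty_fill hx).2 ⟨h1, fun z hz hz' => h2 z hz (.inr hz'), S, n₁, m₂, ?_, h8, le_rfl⟩, by omega⟩
  · rw [Buffer.mem_fn_fill_of_mem hx] at hz'
    exact hz'.elim (fun h => h2 z h (.inl hz)) (h6 z hz)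
  · rintro rfl; exact h6 _ hz hx
  · rw [update_of_ne hxy]
    exact h3.congr fun z hz => (update_of_ne (fun e : z = y => h2 _ hz (.inr (e ▸ hy))) _ _).symm

/-- Structural pre-congruence preserves typing and, for typed processes, free channels. -/
theorem PCong.ty (hC : C.Sound D) {P Q : Proc Tag Name} (h : PCong D P Q) {Γ n}
    (hP : Ty D C P Γ n) : Ty D C Q Γ n ∧ Q.fn = P.fn := by
  -- One inclusion of free channels holds for all processes; the other needs linearity and is proved
  -- together with typing.
  suffices hs : Ty D C Q Γ n ∧ ∀ z ∈ P.fn, z ∈ Q.fn from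
    ⟨hs.1, Set.Subset.antisymm (fun _ => h.fn_subset) hs.2⟩
  have hfn : ∀ {P Q : Proc Tag Name}, PCong D P Q → (∀ z ∈ P.fn, z ∈ Q.fn) → Q.fn = P.fn :=
    fun h h' => Set.Subset.antisymm (fun _ => h.fn_subset) h'
  induction h generalizing Γ n with
  | s_call A xs h => exact ⟨ty_s_call hC hP, fun z hz => (mem_fn_body_rename h).2 hz⟩
  | s_link x y =>
    exact ⟨⟨hP.1.symm, by simpa using hP.2.1.dual, hP.2.2⟩, fun z => by simp [or_comm]⟩
  | s_comm P Q =>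
    obtain ⟨h0, h0', hd, S, T, n₁, n₂, hST, h1, h2, hn⟩ := hP
    exact ⟨⟨h0', h0, fun z hz hz' => hd z hz' hz, T, S, n₂, n₁, hST.symm, h2, h1, by omega⟩,
      fun z => by simp [or_comm]⟩
  | s_wait B y P Q =>
    refine ⟨ty_s_wait hP, fun z hz => ?_⟩
    simp [Buffer.mem_fn_fill] at *; grind
  | s_case B y I F Q =>
    obtain ⟨h1, h2⟩ := ty_s_case hP
    refine ⟨h1, fun z hz => ?_⟩
    simp [Buffer.mem_fn_fill] at *; grind
  | s_join B y P Q =>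
    refine ⟨ty_s_join hP, fun z hz => ?_⟩
    simp [Buffer.mem_fn_fill] at *; grind
  | s_pull_0 B B' y P =>
    refine ⟨ty_s_pull_0 hP, fun z hz => ?_⟩
    simp [Buffer.mem_fn_fill] at *; grind
  | s_pull_1 y P Q R h =>
    refine ⟨ty_s_pull_1 h hP, fun z hz => ?_⟩
    simp at *; grind
  | s_pull_2 B y P Q =>
    refine ⟨ty_s_pull_2 hP, fun z hz => ?_⟩
    simp [Buffer.mem_fn_fill] at *; grind
  | s_pull_3 B x y P Q hxy h =>
    refine ⟨ty_s_pull_3 hxy h hP, fun z hz => ?_⟩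
    simp [Buffer.mem_fn_fill] at *; grind
  | s_pull_4 B B' x y P hxy h =>
    refine ⟨ty_s_pull_4 hxy h hP, fun z hz => ?_⟩
    simp [Buffer.mem_fn_fill] at *; grind
  | refl P => exact ⟨hP, fun _ => id⟩
  | trans P Q R h h' ih ih' =>
    obtain ⟨h1, h2⟩ := ih hP
    obtain ⟨h3, h4⟩ := ih' h1
    exact ⟨h3, fun z hz => h4 z (h2 z hz)⟩
  | c_wait x P P' h ih =>
    obtain ⟨h1, h2, h3⟩ := hP
    obtain ⟨h4, h5⟩ := ih h3
    have := hfn h h5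
    exact ⟨⟨this ▸ h1, h2, h4⟩, by simp [this]⟩
  | c_select x a P P' h ih =>
    obtain ⟨h1, I, hI, m, K, k, n', rfl, h2, h3, h4⟩ := hP
    obtain ⟨h5, h6⟩ := ih h3
    have := hfn h h6
    exact ⟨⟨this ▸ h1, I, hI, m, K, k, n', rfl, h2, h5, h4⟩, by simp [this]⟩
  | c_offer x I F F' h ih =>
    obtain ⟨J, hJ, m, K, hJI, h1, h2⟩ := hP
    have h3 := fun j => ih _ (h2 j).2.2
    have h4 := fun j => hfn (h _) (h3 j).2
    refine ⟨⟨J, hJ, m, K, hJI, h1, fun j => ⟨(h4 j).symm ▸ (h2 j).1, fun i z hz => ?_, (h3 j).1⟩⟩, ?_⟩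
    · rw [h4 j]; exact (h2 j).2.1 i ((h i).fn_subset hz)
    · obtain ⟨a, ha⟩ := hJ
      simp only [Proc.mem_fn_offer]
      rintro z (hz | ⟨i, hz⟩)
      · exact .inl hz
      · exact .inr ⟨_, (h4 ⟨a, ha⟩).symm ▸ (h2 _).2.1 i hz⟩
  | c_fork x P P' Q Q' h h' ih ih' =>
    obtain ⟨h1, h2, h3, S, T, n₁, n₂, h4, h5, h6, h7⟩ := hP
    obtain ⟨h8, h9⟩ := ih h5
    obtain ⟨h10, h11⟩ := ih' h6
    have e := hfn h h9
    have e' := hfn h' h11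
    exact ⟨⟨e ▸ h1, e' ▸ h2, e ▸ e' ▸ h3, S, T, n₁, n₂, h4, h8, h10, h7⟩, fun z => by simp [e, e']⟩
  | c_join x P P' h ih =>
    obtain ⟨h1, h2, S, T, h3, h4⟩ := hP
    obtain ⟨h5, h6⟩ := ih h4
    have e := hfn h h6
    exact ⟨⟨e ▸ h1, e ▸ h2, S, T, h3, h5⟩, fun z => by simp [e]⟩
  | c_choice P P' Q Q' h h' ih ih' =>
    obtain ⟨h1, n₁, n₂, h2, h3, h4⟩ := hP
    obtain ⟨h8, h9⟩ := ih h2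
    obtain ⟨h10, h11⟩ := ih' h3
    have e := hfn h h9
    have e' := hfn h' h11
    exact ⟨⟨by rw [e, e', h1], n₁, n₂, h8, h10, h4⟩, fun z => by simp [e, e']⟩
  | c_cut P P' Q Q' h h' ih ih' =>
    obtain ⟨h1, h2, h3, S, T, n₁, n₂, h4, h5, h6, h7⟩ := hP
    obtain ⟨h8, h9⟩ := ih h5
    obtain ⟨h10, h11⟩ := ih' h6
    have e := hfn h h9
    have e' := hfn h' h11
    exact ⟨⟨e ▸ h1, e' ▸ h2, e ▸ e' ▸ h3, S, T, n₁, n₂, h4, h8, h10, h7⟩, fun z => by simp [e, e']⟩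

end CaP

namespace CaP

open Function SType

variable {Tag Name : Type} {D : Program Tag Name} {C : Oracle Tag Name}

/-! ### Reduction preserves typing -/

theorem SType.Match.sub_right {σ τ ρ : Msg Tag} (h : Match σ τ) (h' : Match ρ τ.dual) :
    Match σ ρ := by
  cases h <;> simp only [Msg.dual] at * <;> cases h'
  · exact .star
  · exact .tag ..
  · next h1 _ h2 => exact .chan _ _ (Correct.sub_right h1 h2)

/-- The hole of a buffer is ready to input what a correctly composed process outputs. -/
theorem SType.Correct.out_hole {S S' T U V : SType Tag} {B : Buffer Tag Name} {Γ n} {σ}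
    (hST : Correct S T) (hS : Trans S (.out σ) S') (hB : BTy D C B Γ U T n) (hV : Sub V U) :
    ∃ τ V' U' T', Match σ τ ∧ Trans V (.inp τ) V' ∧ SType.Sub V' U' ∧ BTy D C B Γ U' T' n ∧
      Correct S' T' := by
  obtain ⟨τ, T', hm, hT, hc⟩ := hST.out hS
  obtain ⟨ρ, U', hm', hU, hB'⟩ := hB.inp hT
  obtain ⟨ρ', V', hm'', hV, hs⟩ := SType.Sub.inp hV hU
  exact ⟨ρ', V', U', T', (hm.sub_right hm').sub_right hm'', hV, hs, hB', hc⟩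

/-- Linearity keeps `y` out of `P`, so identifying the bound channel with `y` is injective on free
channels. Correct composition makes `T` a subtype of the dual of `S`, which the link makes a subtype
of the type of `y`. The measure of the link is released. -/
theorem ty_r_link {y : ℕ} {P : Proc Tag Name} {Γ n} (h : Ty D C (.cut (.link 0 (y + 1)) P) Γ n) :
    ∃ n' < n, Ty D C (P.rename (inst y)) Γ n' ∧
      (P.rename (inst y)).fn = (Proc.cut (.link 0 (y + 1)) P).fn := by
  obtain ⟨-, h0, hd, S, T, n₁, n₂, hST, ⟨-, h1, h2⟩, h3, hn⟩ := h
  have hy : y + 1 ∉ P.fn := hd y (by simp)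
  refine ⟨n₂, by omega, ?_, ?_⟩
  · rw [ty_rename (Γ' := fun x => Γ (inst y x)) _ fun _ _ => rfl]
    · refine h3.mono ?_ le_rfl
      rintro (_ | z) hz
      · refine SType.Sub.trans (T := S.dual) ?_ h1
        unfold SType.Sub; rw [SType.dual_dual]; exact hST.symm
      · exact SType.Sub.refl _
    · rintro (_ | a) ha (_ | b) hb e <;> simp_all
  · ext z; simp; grind

theorem ty_r_close {P : Proc Tag Name} {Γ n}
    (h : Ty D C (.cut (.close 0) (.wait 0 (P.rename Nat.succ))) Γ n) :
    ∃ n' < n, Ty D C P Γ n' ∧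
      P.fn = (Proc.cut (.close 0) (.wait 0 (P.rename Nat.succ)) : Proc Tag Name).fn := by
  obtain ⟨-, h0, hd, S, T, n₁, n₂, hST, ⟨-, h1⟩, ⟨-, -, h2⟩, hn⟩ := h
  exact ⟨n₂, by omega, ty_rename_succ.1 h2, by ext z; simp⟩

theorem ty_r_select {B : Buffer Tag Name} {I : Finset Tag} {F : {a // a ∈ I} → Proc Tag Name}
    {k : {a // a ∈ I}} {P : Proc Tag Name} {Γ n}
    (h : Ty D C (.cut (.select 0 k.1 P) (B.fill 0 (.offer 0 I F))) Γ n) :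
    ∃ n' < n, Ty D C (.cut P (B.fill 0 (F k))) Γ n' ∧
      (Proc.cut P (B.fill 0 (F k))).fn =
        (Proc.cut (.select 0 k.1 P) (B.fill 0 (.offer 0 I F))).fn := by
  obtain ⟨-, -, hd, S, T, n₁, n₂, hST, ⟨h0, I', hI', m, K, k', n', hk, h1, h2, h3⟩, h4, hn⟩ := h
  obtain ⟨h5, h6, U, m₁, m₂, h7, ⟨J, hJ, m', K', hJI, h8, h9⟩, h10⟩ := (ty_fill (by simp)).1 h4
  simp only [scons_zero, update_self] at h1 h7 h8
  rw [update_scons_zero] at h2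
  obtain ⟨τ, V', U', T', hm, hV, hs, hB, hc⟩ := (hST.sub_left h1).out_hole (trans_plus k') h7 h8
  obtain ⟨j, rfl, rfl⟩ := amp_inp hV
  generalize hmk : m k' = mk at *
  generalize hmj : m' j = mj at *
  have hjk : j.1 = k.1 := by
    generalize hj : j.1 = a at hm
    rw [hk] at hm
    cases hm; exact rfl
  -- Annotations agree on both sides, so what the sender paid for the tag is exactly what the branch
  -- needs; the net loss is the 1 of the output.
  have hmm : mj = mk := by
    generalize j.1 = a at hm
    cases hm; rfl
  obtain ⟨h11, h12, h13⟩ := h9 j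
  have hkj : (⟨j.1, hJI j.2⟩ : {a // a ∈ I}) = k := Subtype.ext hjk
  rw [hkj] at h11 h12 h13
  have hfn : ∀ z, (z = 0 ∨ ∃ i, z ∈ (F i).fn) ↔ z ∈ (F k).fn := by
    refine fun z => ⟨?_, fun h => .inr ⟨_, h⟩⟩
    rintro (rfl | ⟨i, hi⟩)
    exacts [h11, h12 i hi]
  refine ⟨n' + n₂ + mk, by omega, ⟨h0, by simp [Buffer.mem_fn_fill, h11], ?_, K k', T', n',
    n₂ + mk, hc, h2, (ty_fill h11).2 ⟨h5, ?_, U', m₁, m₂ + mk, ?_, ?_, by omega⟩, by omega⟩, ?_⟩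
  · intro z hz hz'
    refine hd z (by simp [hz]) ?_
    simp only [Buffer.mem_fn_fill, Proc.mem_fn_offer, hfn] at hz' ⊢
    exact hz'
  · intro z hz hz'
    exact h6 z hz (Proc.mem_fn_offer.2 (.inr ⟨_, hz'⟩))
  · refine hB.congr ?_
    rintro (_ | z) hz
    exacts [(h5 hz).elim, rfl]
  · rw [update_scons_zero] at h13 ⊢
    rw [update_scons_zero] at h13
    refine h13.mono ?_ (by omega)
    rintro (_ | z) hz
    exacts [hs, SType.Sub.refl _]
  · ext z
    simp only [Proc.mem_fn_cut, Buffer.mem_fn_fill, Proc.mem_fn_offer, hfn, Proc.mem_fn_select]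
    simp

/-- The transition matching the output provides two correct compositions, one for the payload and
one for the continuation, and these type the two nested cuts. The 1 paid for the output is released;
the rest is disjointness of free channels. -/
theorem ty_r_fork {B : Buffer Tag Name} {P Q R : Proc Tag Name} {Γ n}
    (h : Ty D C (.cut (.fork 0 (P.rename (lift Nat.succ)) Q) (B.fill 0 (.join 0 R))) Γ n) :
    ∃ n' < n, Ty D C (.cut P (.cut (Q.rename (lift Nat.succ))
      ((B.rename (lift Nat.succ)).fill 0 (R.rename swap)))) Γ n' ∧
      (Proc.cut P (.cut (Q.rename (lift Nat.succ))
        ((B.rename (lift Nat.succ)).fill 0 (R.rename swap)))).fn =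
        (Proc.cut (.fork 0 (P.rename (lift Nat.succ)) Q) (B.fill 0 (.join 0 R))).fn := by
  obtain ⟨-, -, hd, S, T, n₁, n₂, hST, ⟨h0, h0', hPQ, S₁, T₁, k₁, k₂, h1, h1', h2, h3⟩,
    h4, hn⟩ := h
  obtain ⟨h5, h6, U, m₁, m₂, h7, ⟨h8, h9, A, V, h10, h11⟩, h12⟩ := (ty_fill (by simp)).1 h4
  simp only [scons_zero, update_self] at h1 h7 h10
  simp only [update_scons_zero] at h2 h11
  rw [ty_rename_lift_succ] at h1'
  obtain ⟨τ, V', U', T', hm, hV, hs, hB, hc⟩ := (hST.sub_left h1).out_hole trans_tensor h7 h10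
  obtain ⟨rfl, rfl⟩ := par_inp hV
  cases hm with | chan _ _ hSA =>
  have h0 : 0 ∈ P.fn := by simpa using h0
  have hBR : ∀ z, z + 1 ∈ B.fn → z + 1 + 1 ∉ R.fn := fun z hz hz' => h6 _ hz (by simp [hz'])
  have hPQ' : ∀ z, z + 1 ∈ P.fn → z + 1 ∉ Q.fn := fun z hz => hPQ (z + 1) (by simpa using hz)
  have hPB : ∀ z, z + 1 ∈ P.fn → z + 1 ∉ B.fn := fun z hz hz' =>
    hd z (by simp [hz]) (by simp [Buffer.mem_fn_fill, hz'])
  have hPR : ∀ z, z + 1 ∈ P.fn → z + 1 + 1 ∉ R.fn := fun z hz hz' =>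
    hd z (by simp [hz]) (by simp [Buffer.mem_fn_fill, hz'])
  have hQB : ∀ z, z + 1 ∈ Q.fn → z + 1 ∉ B.fn := fun z hz hz' =>
    hd z (by simp [hz]) (by simp [Buffer.mem_fn_fill, hz'])
  have hQR : ∀ z, z + 1 ∈ Q.fn → z + 1 + 1 ∉ R.fn := fun z hz hz' =>
    hd z (by simp [hz]) (by simp [Buffer.mem_fn_fill, hz'])
  have h9 : 1 ∈ R.fn := h9
  refine ⟨k₁ + (k₂ + n₂), by omega, ⟨h0, by simp [Buffer.mem_fn_fill, h8], ?_, S₁, A, k₁, k₂ + n₂,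
    hSA, h1', ⟨by simpa using h0', by simp [Buffer.mem_fn_fill, h9], ?_, T₁, T', k₂, n₂, hc,
      ty_rename_lift_succ.2 h2, ?_, le_rfl⟩, le_rfl⟩, ?_⟩
  · intro z hz hz'
    simp [Buffer.mem_fn_fill] at hz'
    grind
  · rintro (_ | z) hz hz'
    · simp at hz
    · simp [Buffer.mem_fn_fill] at hz hz'
      grind
  · refine (ty_fill (by simpa using h9)).2 ⟨by simpa using h5, ?_, U', m₁, m₂,
      bty_rename_lift_succ.2 (hB.congr ?_), ?_, h12⟩
    · rintro (_ | _ | z) hz hz'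
      · simp at hz; exact h5 hz
      · simp at hz
      · simp at hz hz'
        exact hBR _ hz hz'
    · rintro (_ | z) hz
      exacts [(h5 hz).elim, rfl]
    · rw [update_scons_zero, ty_rename_swap]
      refine h11.mono ?_ le_rfl
      rintro (_ | _ | z) hz
      exacts [SType.Sub.refl _, hs, SType.Sub.refl _]
  · ext z
    simp [Buffer.mem_fn_fill]
    grind

theorem ty_fill_congr {B : Buffer Tag Name} {x : ℕ} {P Q : Proc Tag Name}
    (hPQ : ∀ Γ n, Ty D C P Γ n → ∃ n', Ty D C Q Γ n' ∧ Q.fn = P.fn) {Γ n}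
    (h : Ty D C (B.fill x P) Γ n) : ∃ n', Ty D C (B.fill x Q) Γ n' ∧
      (B.fill x Q).fn = (B.fill x P).fn := by
  induction B generalizing Γ n with
  | hole => exact hPQ _ _ h
  | select a B ih =>
    obtain ⟨h0, I, hI, m, K, k, n', rfl, h1, h2, h3⟩ := h
    obtain ⟨n'', h4, h5⟩ := ih h2
    exact ⟨_, ⟨h5 ▸ h0, I, hI, m, K, k, n'', rfl, h1, h4, le_rfl⟩, by ext; simp [Buffer.fill, h5]⟩
  | fork R B ih =>
    obtain ⟨h0, h0', hd, S, T, n₁, n₂, h1, h2, h3, h4⟩ := h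
    obtain ⟨n', h5, h6⟩ := ih h3
    exact ⟨_, ⟨h0, h6 ▸ h0', h6 ▸ hd, S, T, n₁, n', h1, h2, h5, le_rfl⟩,
      by ext; simp [Buffer.fill, h6]⟩

/-- Reduction preserves typing, possibly with another measure, and free channels. -/
theorem Red.ty (hC : C.Sound D) {P Q : Proc Tag Name} (h : Red D P Q) {Γ n}
    (hP : Ty D C P Γ n) : ∃ n', Ty D C Q Γ n' ∧ Q.fn = P.fn := by
  induction h generalizing Γ n with
  -- The typing rule bounds the measure of one alternative only, so the measure may grow here.
  | r_choice_left P Q =>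
    obtain ⟨h, n₁, n₂, h1, h2, -⟩ := hP
    exact ⟨n₁, h1, by ext; simp [h]⟩
  | r_choice_right P Q =>
    obtain ⟨h, n₁, n₂, h1, h2, -⟩ := hP
    exact ⟨n₂, h2, by ext; simp [h]⟩
  | r_link y P => exact let ⟨n', _, h⟩ := ty_r_link hP; ⟨n', h⟩
  | r_close P => exact let ⟨n', _, h⟩ := ty_r_close hP; ⟨n', h⟩
  | r_select B I F k P => exact let ⟨n', _, h⟩ := ty_r_select hP; ⟨n', h⟩
  | r_fork B P Q R => exact let ⟨n', _, h⟩ := ty_r_fork hP; ⟨n', h⟩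
  | r_cut P Q R h ih =>
    obtain ⟨h0, h0', hd, S, T, n₁, n₂, hST, h1, h2, hn⟩ := hP
    obtain ⟨n', h3, h4⟩ := ih h1
    exact ⟨_, ⟨h4 ▸ h0, h0', h4 ▸ hd, S, T, n', n₂, hST, h3, h2, le_rfl⟩, by ext; simp [h4]⟩
  | r_buffer B x P Q h ih => exact ty_fill_congr (fun _ _ => ih) hP
  | r_str P R Q h h' ih =>
    obtain ⟨h1, h2⟩ := h.ty hC hP
    obtain ⟨n', h3, h4⟩ := ih h1
    exact ⟨n', h3, h4.trans h2⟩

end CaP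

namespace CaP

open Function SType

variable {Tag Name : Type} {D : Program Tag Name} {C : Oracle Tag Name}

/-! ### Progress -/

/-- The process reduces to a typed process with a smaller measure. -/
def Progress (D : Program Tag Name) (C : Oracle Tag Name) (P : Proc Tag Name)
    (Γ : ℕ → SType Tag) (n : ℕ) : Prop :=
  ∃ n' < n, ∃ Q, Red D P Q ∧ Ty D C Q Γ n' ∧ Q.fn = P.fn

/-- Threads are the processes other than invocations, choices and cuts. -/
def Proc.Thread : Proc Tag Name → Prop
  | call _ _ => False
  | choice _ _ => False
  | cut _ _ => False
  | _ => True

/-- The process makes progress or exposes a thread. -/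
def Outcome (D : Program Tag Name) (C : Oracle Tag Name) (P : Proc Tag Name)
    (Γ : ℕ → SType Tag) (n : ℕ) : Prop :=
  Progress D C P Γ n ∨ ∃ Q, PCong D P Q ∧ Q.Thread

/-- The process outputs a message on `x`. -/
def Proc.IsOut (x : ℕ) : Proc Tag Name → Prop
  | select y _ _ => y = x
  | fork y _ _ => y = x
  | _ => False

/-- The process waits for a message from `x`. -/
def Proc.IsIn (x : ℕ) : Proc Tag Name → Prop
  | wait y _ => y = x
  | offer y _ _ => y = x
  | join y _ => y = x
  | _ => False

theorem Outcome.thread {P : Proc Tag Name} {Γ n} (h : P.Thread) : Outcome D C P Γ n :=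
  .inr ⟨P, .refl P, h⟩

theorem Progress.of_pcong (hC : C.Sound D) {P P' : Proc Tag Name} {Γ n} (h : PCong D P P')
    (hP : Ty D C P Γ n) (hP' : Progress D C P' Γ n) : Progress D C P Γ n := by
  obtain ⟨n', hn, Q, h1, h2, h3⟩ := hP'
  exact ⟨n', hn, Q, .r_str _ _ _ h h1, h2, h3.trans (h.ty hC hP).2⟩

theorem Outcome.of_pcong (hC : C.Sound D) {P P' : Proc Tag Name} {Γ n} (h : PCong D P P')
    (hP : Ty D C P Γ n) (hP' : Ty D C P' Γ n → Outcome D C P' Γ n) : Outcome D C P Γ n := by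
  obtain h1 | ⟨Q, h1, h2⟩ := hP' (h.ty hC hP).1
  · exact .inl (h1.of_pcong hC h hP)
  · exact .inr ⟨Q, .trans _ _ _ h h1, h2⟩

theorem PCong.fill {B : Buffer Tag Name} {x : ℕ} {P Q : Proc Tag Name} (h : PCong D P Q) :
    PCong D (B.fill x P) (B.fill x Q) := by
  induction B with
  | hole => exact h
  | select a B ih => exact .c_select _ _ _ _ ih
  | fork R B ih => exact .c_fork _ _ _ _ _ (.refl _) ih

/-- A prefix on another channel can be pulled out of a buffer and a cut. -/
theorem exists_pcong_pull {B : Buffer Tag Name} {y : ℕ} {P Q : Proc Tag Name} {Γ n}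
    (h : Ty D C (.cut (B.fill 0 P) Q) Γ n) (hP : P.IsIn (y + 1) ∨ P.IsOut (y + 1)) :
    ∃ R, PCong D (.cut (B.fill 0 P) Q) R ∧ R.Thread := by
  obtain ⟨h0, -, -, -, -, -, S, S', T, n₁, n₂, n₃, -, -, hty, -, -⟩ := ty_cut_fill h
  cases P with
  | wait x P => obtain rfl : x = y + 1 := by simpa [Proc.IsIn, Proc.IsOut] using hP
                exact ⟨_, .s_wait B y P Q, trivial⟩
  | offer x I F => obtain rfl : x = y + 1 := by simpa [Proc.IsIn, Proc.IsOut] using hP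
                   exact ⟨_, .s_case B y I F Q, trivial⟩
  | join x P => obtain rfl : x = y + 1 := by simpa [Proc.IsIn, Proc.IsOut] using hP
                exact ⟨_, .s_join B y P Q, trivial⟩
  | select x a P =>
    obtain rfl : x = y + 1 := by simpa [Proc.IsIn, Proc.IsOut] using hP
    exact ⟨_, .trans _ _ _ (.c_cut _ _ _ _ (.s_pull_4 B (.select a .hole) 0 (y + 1) P
      (Nat.succ_ne_zero _).symm (by simpa using h0)) (.refl Q))
      (.s_pull_2 (.select a .hole) y (B.fill 0 P) Q), trivial⟩
  | fork x P P' =>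
    obtain rfl : x = y + 1 := by simpa [Proc.IsIn, Proc.IsOut] using hP
    obtain ⟨-, -, hd, -⟩ := hty
    -- Buffer and cut follow the cut channel: into the payload if it is used there, otherwise into
    -- the continuation.
    by_cases h1 : 1 ∈ P.fn
    · obtain ⟨P', rfl⟩ := Proc.exists_rename_succ (hd 0 h1)
      exact ⟨_, .trans _ _ _ (.c_cut _ _ _ _ (.s_pull_3 B 0 (y + 1) P (P'.rename Nat.succ)
        (Nat.succ_ne_zero _).symm h1) (.refl Q))
        (.s_pull_1 y _ P' Q (by simp [Buffer.mem_fn_fill, h1])), trivial⟩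
    · obtain ⟨P, rfl⟩ := Proc.exists_rename_lift_succ h1
      exact ⟨_, .trans _ _ _ (.c_cut _ _ _ _ (.s_pull_4 B (.fork (P.rename (lift Nat.succ)) .hole)
        0 (y + 1) P' (Nat.succ_ne_zero _).symm (by simpa [h1] using h0)) (.refl Q))
        (.s_pull_2 (.fork P .hole) y (B.fill 0 P') Q), trivial⟩
  | _ => simp [Proc.IsIn, Proc.IsOut] at hP

/-- Isolates the first message as a buffer. Pulled out along a link it is still an output prefix, so
it exposes a thread. -/
theorem Proc.IsOut.eq_fill {x : ℕ} {P : Proc Tag Name} (h : P.IsOut x) :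
    ∃ (B : Buffer Tag Name) (P' : Proc Tag Name), P = B.fill x P' ∧
      ∀ (ρ : ℕ → ℕ) (y : ℕ) (Q : Proc Tag Name), ((B.rename ρ).fill y Q).Thread := by
  cases P with
  | select y a P => cases h; exact ⟨.select a .hole, P, rfl, fun _ _ _ => trivial⟩
  | fork y P Q => cases h; exact ⟨.fork P .hole, Q, rfl, fun _ _ _ => trivial⟩
  | _ => exact h.elim

theorem SType.Match.tag_eq {m m' : ℕ} {a a' : Tag} (h : Match (.tag m a) (.tag m' a')) :
    a = a' := by
  cases h; rfl

/-- An output composed with a buffer whose hole is filled with a thread that is not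
an output on the same channel. -/
theorem outcome_cut_fill (hC : C.Sound D) {B : Buffer Tag Name} {P Q : Proc Tag Name} {Γ n}
    (h : Ty D C (.cut P (B.fill 0 Q)) Γ n) (hP : P.IsOut 0) (hQ : Q.Thread) (hQ' : ¬ Q.IsOut 0) :
    Outcome D C (.cut P (B.fill 0 Q)) Γ n := by
  have hcomm := (PCong.s_comm P (B.fill 0 Q) : PCong D _ _)
  have hpull : ∀ y, Q.IsIn (y + 1) ∨ Q.IsOut (y + 1) → Outcome D C (.cut P (B.fill 0 Q)) Γ n :=
    fun y hy => .of_pcong hC hcomm h fun h => .inr (exists_pcong_pull h hy)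
  have hlink : ∀ y, PCong D Q (.link 0 (y + 1)) → Outcome D C (.cut P (B.fill 0 Q)) Γ n := by
    intro y hy
    obtain ⟨B', P', rfl, hB⟩ := hP.eq_fill
    exact .inr ⟨_, .trans _ _ _ (.c_cut _ _ _ _ (.refl _) hy.fill) (.s_pull_0 B' B y P'),
      hB _ _ _⟩
  -- Collects what the input cases need: the transition for the message of `P`, the typing of the
  -- buffer and its hole, and that a forked payload does not use the session, as the reduction rule
  -- requires.
  have hin : ∃ σ S S' U T V n₁ n₂, Correct S T ∧ Trans S (.out σ) S' ∧
      ((∃ m a P', σ = .tag m a ∧ P = .select 0 a P') ∨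
        ∃ A P₁ P₂, σ = .chan A ∧ P = .fork 0 P₁ P₂ ∧ 1 ∉ P₁.fn) ∧
      BTy D C B V U T n₁ ∧ Ty D C Q (scons U Γ) n₂ := by
    obtain ⟨-, -, -, -, -, -, T, U, S, n₁, n₂, n₃, hST, h1, h2, h3, -⟩ :=
      ty_cut_fill (hcomm.ty hC h).1
    cases P with
    | select x a P =>
      cases hP
      obtain ⟨-, I, hI, m, K, k, n', rfl, h4, -⟩ := h3
      exact ⟨_, _, _, U, T, _, n₁, n₂, hST.symm.sub_left h4, trans_plus k,
        .inl ⟨_, _, P, rfl, rfl⟩, h1, h2⟩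
    | fork x P P' =>
      cases hP
      obtain ⟨-, h5, h6, S₁, T₁, k₁, k₂, h4, -⟩ := h3
      exact ⟨_, _, _, U, T, _, n₁, n₂, hST.symm.sub_left h4, trans_tensor,
        .inr ⟨_, P, P', rfl, rfl, fun h => h6 0 h h5⟩, h1, h2⟩
    | _ => exact hP.elim
  obtain ⟨σ, S, S', U, T, V, n₁, n₂, hST, hS, hσ, hB, hty⟩ := hin
  obtain ⟨h0, -⟩ := ty_cut_fill (hcomm.ty hC h).1
  cases Q with
  | done => exact h0.elim
  | call A xs => exact hQ.elim
  | choice Q Q' => exact hQ.elim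
  | cut Q Q' => exact hQ.elim
  | link x y =>
    rcases x with _ | x
    · rcases y with _ | y
      · exact (hty.1 rfl).elim
      · exact hlink y (.refl _)
    · obtain rfl : y = 0 := by simpa [eq_comm] using h0
      exact hlink x (.s_link _ _)
  | close x =>
    obtain rfl : x = 0 := by simpa [eq_comm] using h0
    -- The hole must be able to receive the message of `P`, and `𝟏` has no input.
    obtain ⟨_, _, _, _, -, hV, -⟩ := hST.out_hole hS hB hty.1
    exact (not_one_inp hV).elim
  | wait x Q =>
    rcases x with _ | x
    · obtain ⟨_, _, _, _, hm, hV, -⟩ := hST.out_hole hS hB hty.2.1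
      obtain ⟨rfl, -⟩ := bot_inp hV
      obtain ⟨_, _, _, rfl, -⟩ | ⟨_, _, _, rfl, -⟩ := hσ <;> cases hm
    · exact hpull x (.inl rfl)
  | offer x I F =>
    rcases x with _ | x
    · obtain ⟨J, hJ, m, K, hJI, h1, h2⟩ := hty
      obtain ⟨_, _, _, _, hm, hV, -⟩ := hST.out_hole hS hB h1
      obtain ⟨k, rfl, -⟩ := amp_inp hV
      obtain ⟨_, _, P', rfl, rfl⟩ | ⟨_, P₁, P₂, rfl, rfl, -⟩ := hσ
      · obtain rfl := hm.tag_eq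
        obtain ⟨n', hn, h3, h4⟩ := ty_r_select (k := ⟨k.1, hJI k.2⟩) h
        exact .inl ⟨n', hn, _, .r_select B I F ⟨k.1, hJI k.2⟩ P', h3, h4⟩
      · cases hm
    · exact hpull x (.inl rfl)
  | join x Q =>
    rcases x with _ | x
    · obtain ⟨-, -, A, A', h1, -⟩ := hty
      obtain ⟨_, _, _, _, hm, hV, -⟩ := hST.out_hole hS hB h1
      obtain ⟨rfl, -⟩ := par_inp hV
      obtain ⟨_, _, P', rfl, rfl⟩ | ⟨_, P₁, P₂, rfl, rfl, h1⟩ := hσ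
      · cases hm
      · obtain ⟨P₁, rfl⟩ := Proc.exists_rename_lift_succ h1
        obtain ⟨n', hn, h3, h4⟩ := ty_r_fork h
        exact .inl ⟨n', hn, _, .r_fork B P₁ P₂ Q, h3, h4⟩
    · exact hpull x (.inl rfl)
  | select x a Q =>
    rcases x with _ | x
    · exact (hQ' rfl).elim
    · exact hpull x (.inr rfl)
  | fork x Q Q' =>
    rcases x with _ | x
    · exact (hQ' rfl).elim
    · exact hpull x (.inr rfl)

/-- A thread makes progress, or is pre-congruent to a buffer filled with a thread that is not an
output on the same channel. -/
theorem progress_or_exists_fill (hC : C.Sound D) {n : ℕ}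
    (IH : ∀ n' < n, ∀ P Γ, Ty D C P Γ n' → Outcome D C P Γ n') {x : ℕ} {P : Proc Tag Name} {Γ}
    (h : Ty D C P Γ n) (hP : P.Thread) : Progress D C P Γ n ∨
      ∃ (B : Buffer Tag Name) (Q : Proc Tag Name), PCong D P (B.fill x Q) ∧ Q.Thread ∧
        ¬ Q.IsOut x := by
  induction n using Nat.strong_induction_on generalizing P Γ with
  | _ n ih =>
    by_cases hx : P.IsOut x
    · cases P with
      | select y a P =>
        cases hx
        obtain ⟨h0, I, hI, m, K, k, n', rfl, h1, h2, h3⟩ := h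
        -- The continuation of an output has smaller measure, so even if it is not a thread it makes
        -- progress or exposes one; for the same reason the collected buffer is finite.
        obtain hp | ⟨Q, hPQ, hQ⟩ := IH n' (by omega) _ _ h2
        · obtain ⟨n'', hn, Q, h4, h5, h6⟩ := hp
          exact .inl ⟨1 + m k + n'', by omega, .select x k Q, .r_buffer (.select k.1 .hole) x _ _ h4,
            ⟨h6 ▸ h0, I, hI, m, K, k, n'', rfl, h1, h5, le_rfl⟩, by ext; simp [h6]⟩
        · obtain ⟨n'', hn, R, h4, h5, h6⟩ | ⟨B, R, h4, h5, h6⟩ :=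
            ih n' (by omega) (fun m hm => IH m (by omega)) (hPQ.ty hC h2).1 hQ
          · exact .inl ⟨1 + m k + n'', by omega, .select x k R,
              .r_buffer (.select k.1 .hole) x _ _ (.r_str _ _ _ hPQ h4),
              ⟨h6 ▸ (hPQ.ty hC h2).2 ▸ h0, I, hI, m, K, k, n'', rfl, h1, h5, le_rfl⟩,
              by ext; simp [h6, (hPQ.ty hC h2).2]⟩
          · exact .inr ⟨.select k.1 B, R, .c_select _ _ _ _ (.trans _ _ _ hPQ h4), h5, h6⟩
      | fork y P' P =>
        cases hx
        obtain ⟨h0, h0', hd, S, T, n₁, n₂, h1, h1', h2, h3⟩ := h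
        obtain hp | ⟨Q, hPQ, hQ⟩ := IH n₂ (by omega) _ _ h2
        · obtain ⟨n'', hn, Q, h4, h5, h6⟩ := hp
          exact .inl ⟨1 + n₁ + n'', by omega, .fork x P' Q, .r_buffer (.fork P' .hole) x _ _ h4,
            ⟨h0, h6 ▸ h0', h6 ▸ hd, S, T, n₁, n'', h1, h1', h5, le_rfl⟩, by ext; simp [h6]⟩
        · have e := (hPQ.ty hC h2).2
          obtain ⟨n'', hn, R, h4, h5, h6⟩ | ⟨B, R, h4, h5, h6⟩ :=
            ih n₂ (by omega) (fun m hm => IH m (by omega)) (hPQ.ty hC h2).1 hQ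
          · exact .inl ⟨1 + n₁ + n'', by omega, .fork x P' R,
              .r_buffer (.fork P' .hole) x _ _ (.r_str _ _ _ hPQ h4),
              ⟨h0, h6 ▸ e ▸ h0', h6 ▸ e ▸ hd, S, T, n₁, n'', h1, h1', h5, le_rfl⟩,
              by ext; simp [h6, e]⟩
          · exact .inr ⟨.fork P' B, R, .c_fork _ _ _ _ _ (.refl _) (.trans _ _ _ hPQ h4), h5, h6⟩
      | _ => exact hx.elim
    · exact .inr ⟨.hole, P, .refl _, hP, hx⟩

theorem Progress.cut_left {P Q : Proc Tag Name} {S T : SType Tag} {Γ n₁ n₂ n}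
    (h0 : 0 ∈ P.fn) (h0' : 0 ∈ Q.fn) (hd : ∀ z, z + 1 ∈ P.fn → z + 1 ∉ Q.fn) (hST : Correct S T)
    (hP : Progress D C P (scons S Γ) n₁) (hQ : Ty D C Q (scons T Γ) n₂) (hn : n₁ + n₂ ≤ n) :
    Progress D C (.cut P Q) Γ n := by
  obtain ⟨n', h1, R, h2, h3, h4⟩ := hP
  exact ⟨n' + n₂, by omega, .cut R Q, .r_cut _ _ _ h2,
    ⟨h4 ▸ h0, h0', h4 ▸ hd, S, T, n', n₂, hST, h3, hQ, le_rfl⟩, by ext; simp [h4]⟩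

/-- Both sides may be sending at once. The pending outputs of `Q` on the cut channel are gathered in
a buffer, and the first action behind it decides. -/
theorem outcome_cut_of_isOut (hC : C.Sound D) {n : ℕ}
    (IH : ∀ n' < n, ∀ P Γ, Ty D C P Γ n' → Outcome D C P Γ n') {P Q : Proc Tag Name} {Γ}
    (h : Ty D C (.cut P Q) Γ n) (hP : P.IsOut 0) (hQ : Q.Thread) :
    Outcome D C (.cut P Q) Γ n := by
  obtain ⟨h0, h0', hd, S, T, n₁, n₂, hST, h1, h2, hn⟩ := id h
  obtain hp | ⟨B, R, hQR, hR, hR'⟩ := progress_or_exists_fill hC (x := 0)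
    (fun m hm => IH m (by omega)) h2 hQ
  · exact .inl (.of_pcong hC (.s_comm P Q) h
      (.cut_left h0' h0 (fun z hz hz' => hd z hz' hz) hST.symm hp h1 (by omega)))
  · exact .of_pcong hC (.c_cut _ _ _ _ (.refl P) hQR) h
      fun h => outcome_cut_fill hC h hP hR hR'

/-- A cut whose left component is a thread makes progress or exposes a thread, unless that
component acts on the bound channel. -/
theorem outcome_cut_or_acts (hC : C.Sound D) {P Q : Proc Tag Name} {Γ n}
    (h : Ty D C (.cut P Q) Γ n) (hP : P.Thread) :
    Outcome D C (.cut P Q) Γ n ∨ P = .close 0 ∨ P.IsIn 0 ∨ P.IsOut 0 := by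
  have hpull : ∀ y, P.IsIn (y + 1) ∨ P.IsOut (y + 1) → Outcome D C (.cut P Q) Γ n :=
    fun y hy => .inr (exists_pcong_pull (B := .hole) h hy)
  have hlink : ∀ y, PCong D P (.link 0 (y + 1)) → Outcome D C (.cut P Q) Γ n := by
    intro y hy
    refine .of_pcong hC (.c_cut _ _ _ _ hy (.refl Q)) h fun h => ?_
    obtain ⟨n', h1, h2, h3⟩ := ty_r_link h
    exact .inl ⟨n', h1, _, .r_link y Q, h2, h3⟩
  obtain ⟨h0, -, -, S, -, n₁, -, -, hty, -⟩ := h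
  cases P with
  | done => exact h0.elim
  | call A xs => exact hP.elim
  | choice Q Q' => exact hP.elim
  | cut Q Q' => exact hP.elim
  | link x y =>
    left
    rcases x with _ | x
    · rcases y with _ | y
      · exact (hty.1 rfl).elim
      · exact hlink y (.refl _)
    · obtain rfl : y = 0 := by simpa [eq_comm] using h0
      exact hlink x (.s_link _ _)
  | close x =>
    obtain rfl : x = 0 := by simpa [eq_comm] using h0
    exact .inr (.inl rfl)
  | wait x P => rcases x with _ | x; exacts [.inr (.inr (.inl rfl)), .inl (hpull x (.inl rfl))]
  | offer x I F => rcases x with _ | x; exacts [.inr (.inr (.inl rfl)), .inl (hpull x (.inl rfl))]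
  | join x P => rcases x with _ | x; exacts [.inr (.inr (.inl rfl)), .inl (hpull x (.inl rfl))]
  | select x a P => rcases x with _ | x; exacts [.inr (.inr (.inr rfl)), .inl (hpull x (.inr rfl))]
  | fork x P P' => rcases x with _ | x; exacts [.inr (.inr (.inr rfl)), .inl (hpull x (.inr rfl))]

theorem Ty.not_pos_of_isIn {P : Proc Tag Name} {Γ n x} (h : Ty D C P Γ n) (hP : P.IsIn x) :
    ∃ U, SType.Sub U (Γ x) ∧ ¬ Pos U := by
  cases P with
  | wait y P => cases hP; exact ⟨_, h.2.1, by simp [Pos]⟩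
  | offer y I F => cases hP; obtain ⟨J, hJ, m, K, -, h, -⟩ := h; exact ⟨_, h, by simp [Pos]⟩
  | join y P => cases hP; obtain ⟨-, -, S, T, h, -⟩ := h; exact ⟨_, h, by simp [Pos]⟩
  | _ => exact hP.elim

/-- The partner's type has to input the termination signal; among the remaining candidates only
`wait` has a type that does. -/
theorem progress_cut_close {P : Proc Tag Name} {Γ n}
    (h : Ty D C (.cut (.close 0) P) Γ n) (hP : P = .close 0 ∨ P.IsIn 0) :
    Progress D C (.cut (.close 0) P) Γ n := by
  obtain ⟨-, -, hd, S, T, n₁, n₂, hST, ⟨h1, -⟩, h2, -⟩ := id h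
  have hin : ∀ U, SType.Sub U T → ∃ U', Trans U (.inp .star) U' := by
    intro U hU
    -- The empty buffer reduces the general statement to plain subtyping; its measure is immaterial.
    obtain ⟨τ, V, _, _, hm, hV, -⟩ := (hST.sub_left h1).out_hole (D := D) (C := C) (B := .hole)
      (Γ := Γ) (n := 0) trans_one (SType.Sub.refl T) hU
    cases hm
    exact ⟨_, hV⟩
  cases P with
  | close x =>
    obtain rfl : x = 0 := by simpa [Proc.IsIn] using hP
    obtain ⟨_, hV⟩ := hin _ h2.1
    exact (not_one_inp hV).elim
  | wait x P =>
    obtain rfl : x = 0 := by simpa [Proc.IsIn] using hP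
    obtain ⟨P, rfl⟩ := Proc.exists_rename_succ h2.1
    obtain ⟨n', h3, h4, h5⟩ := ty_r_close h
    exact ⟨n', h3, _, .r_close P, h4, h5⟩
  | offer x I F =>
    obtain rfl : x = 0 := by simpa [Proc.IsIn] using hP
    obtain ⟨J, hJ, m, K, -, h3, -⟩ := h2
    obtain ⟨_, hV⟩ := hin _ h3
    obtain ⟨_, h, -⟩ := amp_inp hV
    cases h
  | join x P =>
    obtain rfl : x = 0 := by simpa [Proc.IsIn] using hP
    obtain ⟨-, -, A, V, h3, -⟩ := h2
    obtain ⟨_, hV⟩ := hin _ h3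
    obtain ⟨h, -⟩ := par_inp hV
    cases h
  | _ => simp [Proc.IsIn] at hP

/-- Once links and prefixes on other channels are dealt with, both threads act on the cut channel.
An output meets its buffered partner, a `close` meets its `wait`, and two inputs would have two
non-positive types, against the polarity clause. -/
theorem outcome_cut_threads (hC : C.Sound D) {n : ℕ}
    (IH : ∀ n' < n, ∀ P Γ, Ty D C P Γ n' → Outcome D C P Γ n') {P Q : Proc Tag Name} {Γ}
    (h : Ty D C (.cut P Q) Γ n) (hP : P.Thread) (hQ : Q.Thread) :
    Outcome D C (.cut P Q) Γ n := by
  have hcomm := (PCong.s_comm P Q : PCong D _ _)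
  have h' := (hcomm.ty hC h).1
  obtain h1 | h1 := outcome_cut_or_acts hC h hP
  · exact h1
  obtain h2 | h2 := outcome_cut_or_acts hC h' hQ
  · exact .of_pcong hC hcomm h fun _ => h2
  by_cases hP' : P.IsOut 0
  · exact outcome_cut_of_isOut hC IH h hP' hQ
  by_cases hQ' : Q.IsOut 0
  · exact .of_pcong hC hcomm h fun h => outcome_cut_of_isOut hC IH h hQ' hP
  simp only [hP', hQ', or_false] at h1 h2
  rcases h1 with rfl | h1
  · exact .inl (progress_cut_close h h2)
  rcases h2 with rfl | h2
  · exact .inl (.of_pcong hC hcomm h (progress_cut_close h' (.inr h1)))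
  obtain ⟨-, -, -, S, T, n₁, n₂, hST, h3, h4, -⟩ := h
  obtain ⟨U, hU, hU'⟩ := h3.not_pos_of_isIn h1
  obtain ⟨V, hV, hV'⟩ := h4.not_pos_of_isIn h2
  exact ((isCorrectComposition_correct.pol _ _
    ((hST.sub_left hU).sub_right hV)).elim hU' hV').elim

/-- Structural induction through choices and cuts. Unfolding an invocation does not lower the
measure, so invocations are left to a handler available under `G`; without it the process must be
guarded. `Ty.outcome` applies this twice, and the inner use, on the body of a definition, needs no
handler. -/
theorem outcome_of_call (hC : C.Sound D) {n : ℕ}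
    (IH : ∀ n' < n, ∀ P Γ, Ty D C P Γ n' → Outcome D C P Γ n') (G : Prop)
    (hG : G → ∀ A xs Γ m, m ≤ n → Ty D C (.call A xs) Γ m → Outcome D C (.call A xs) Γ m)
    {P : Proc Tag Name} {Γ m} (hm : m ≤ n) (h : Ty D C P Γ m) (hP : P.Guarded ∨ G) :
    Outcome D C P Γ m := by
  induction P generalizing Γ m with
  | call A xs => exact hG (hP.resolve_left id) A xs Γ m hm h
  | choice P Q =>
    obtain ⟨h0, n₁, n₂, h1, h2, h3⟩ := h
    rcases h3 with h3 | h3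
    · exact .inl ⟨n₁, by omega, P, .r_choice_left P Q, h1, by ext; simp [h0]⟩
    · exact .inl ⟨n₂, by omega, Q, .r_choice_right P Q, h2, by ext; simp [h0]⟩
  | cut P Q ihP ihQ =>
    obtain ⟨h0, h0', hd, S, T, n₁, n₂, hST, h1, h2, hn⟩ := id h
    obtain hp | ⟨P', hPP', hP'⟩ := ihP (by omega) h1 (hP.imp_left And.left)
    · exact .inl (hp.cut_left h0 h0' hd hST h2 hn)
    obtain hq | ⟨Q', hQQ', hQ'⟩ := ihQ (by omega) h2 (hP.imp_left And.right)
    · exact .inl (.of_pcong hC (.s_comm P Q) h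
        (hq.cut_left h0' h0 (fun z hz hz' => hd z hz' hz) hST.symm h1 (by omega)))
    exact .of_pcong hC (.c_cut _ _ _ _ hPP' hQQ') h
      fun h => outcome_cut_threads hC (fun n' hn' => IH n' (by omega)) h hP' hQ'
  | _ => exact .thread trivial

theorem Proc.guarded_rename {P : Proc Tag Name} {ρ : ℕ → ℕ} (h : P.Guarded) :
    (P.rename ρ).Guarded := by
  induction P generalizing ρ with
  | call A xs => exact h
  | cut P Q ihP ihQ => exact ⟨ihP h.1, ihQ h.2⟩
  | _ => trivial

/-- Every typed process makes progress or exposes a thread. -/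
theorem Ty.outcome (hC : C.Sound D) {P : Proc Tag Name} {Γ n} (h : Ty D C P Γ n) :
    Outcome D C P Γ n := by
  induction n using Nat.strong_induction_on generalizing P Γ with
  | _ n ih =>
    have IH : ∀ n' < n, ∀ P Γ, Ty D C P Γ n' → Outcome D C P Γ n' := fun n' hn P Γ => ih n' hn
    refine outcome_of_call hC IH True (fun _ A xs Γ m hm h => ?_) le_rfl h (.inr trivial)
    refine .of_pcong hC (.s_call A xs h.2.1) h fun h => ?_
    exact outcome_of_call hC IH False False.elim hm h (.inl (Proc.guarded_rename (D.guarded A)))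

/-- A closed typed process makes progress or is pre-congruent to the terminated process. -/
theorem Ty.progress_or_done (hC : C.Sound D) {P : Proc Tag Name} {Γ n} (h : Ty D C P Γ n)
    (hP : P.fn = ∅) : Progress D C P Γ n ∨ PCong D P .done := by
  refine (h.outcome hC).imp_right fun ⟨Q, hPQ, hQ⟩ => ?_
  have hfn : ∀ x, x ∉ Q.fn := fun x hx => by
    have := hPQ.fn_subset hx
    rw [hP] at this; exact this
  -- `done` is the only thread without free channels.
  cases Q with
  | done => exact hPQ
  | call A xs => exact hQ.elim
  | choice Q Q' => exact hQ.elim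
  | cut Q Q' => exact hQ.elim
  | link x y => exact (hfn x (by simp)).elim
  | close x => exact (hfn x (by simp)).elim
  | wait x P => exact (hfn x (by simp)).elim
  | offer x I F => exact (hfn x (by simp)).elim
  | join x P => exact (hfn x (by simp)).elim
  | select x a P => exact (hfn x (by simp)).elim
  | fork x P P' => exact (hfn x (by simp)).elim

/-! ### Terminated processes -/

/-- The process is terminated, up to the unfolding of an invocation. -/
def Dead (D : Program Tag Name) : Proc Tag Name → Prop
  | .done => True
  | .call A _ => D.body A = .done
  | _ => False

theorem dead_fill {B : Buffer Tag Name} {x : ℕ} {P : Proc Tag Name} :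
    Dead D (B.fill x P) ↔ B = .hole ∧ Dead D P := by
  cases B <;> simp [Buffer.fill, Dead]

/-- Guardedness prevents a body from being itself an invocation, so `Dead` never has to look through
more than one unfolding. -/
theorem dead_rename_of_guarded {P : Proc Tag Name} {ρ : ℕ → ℕ} (h : P.Guarded) :
    Dead D (P.rename ρ) ↔ P = .done := by
  cases P <;> simp_all [Proc.rename, Dead, Proc.Guarded]

/-- Reduction may rearrange a process first, so irreducibility has to be read off an invariant of
pre-congruence: whatever is pre-congruent to `done` is `Dead`, and `Dead` processes do not reduce.
-/
theorem PCong.dead_iff {P Q : Proc Tag Name} (h : PCong D P Q) : Dead D P ↔ Dead D Q := by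
  induction h with
  | s_call A xs h => exact (dead_rename_of_guarded (D.guarded A)).symm
  | s_pull_0 B B' y P => rw [dead_fill]; simp [Dead]
  | s_pull_2 B y P Q => rw [dead_fill]; simp [Dead]
  | s_pull_3 B x y P Q hxy h => rw [dead_fill]; simp [Dead]
  | s_pull_4 B B' x y P hxy h => simp [dead_fill]; tauto
  | trans P Q R h h' ih ih' => exact ih.trans ih'
  | _ => simp [Dead]

theorem Red.not_dead {P Q : Proc Tag Name} (h : Red D P Q) : ¬ Dead D P := by
  induction h with
  | r_buffer B x P Q h ih => rw [dead_fill]; exact fun h => ih h.2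
  | r_str P R Q h h' ih => rwa [h.dead_iff]
  | _ => simp [Dead]

/-! ### Fair termination -/

theorem Ty.weaklyTerminating (hC : C.Sound D) {P : Proc Tag Name} {Γ n} (h : Ty D C P Γ n)
    (hP : P.fn = ∅) : WeaklyTerminating D P := by
  induction n using Nat.strong_induction_on generalizing P with
  | _ n ih =>
    obtain ⟨n', hn, Q, hPQ, hQ, hfn⟩ | hd := h.progress_or_done hC hP
    · obtain ⟨N, f, hf, hN⟩ := ih n' hn hQ (hfn.trans hP)
      -- A finite run of the reduct, shifted by one and preceded by `P`.
      refine ⟨N + 1, fun i => Nat.casesOn i P f, ⟨rfl, fun i hi => ?_, fun k hk => ?_⟩, by simpa⟩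
      · rcases i with _ | i
        · simpa [hf.start] using hPQ
        · exact hf.step i (by push_cast at hi; exact lt_of_add_lt_add_right hi)
      · lift N to ℕ using hN
        obtain rfl : k = N + 1 := by exact_mod_cast hk.symm
        exact hf.maximal N rfl
    · refine ⟨(0 : ℕ), fun _ => P, ⟨rfl, fun i hi => by simp at hi, fun k _ => ?_⟩, by simp⟩
      rintro ⟨Q, hQ⟩
      exact hQ.not_dead ((PCong.dead_iff hd).2 trivial)

theorem Ty.run (hC : C.Sound D) {P : Proc Tag Name} {Γ n} (h : Ty D C P Γ n) {N : ℕ∞}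
    {f : ℕ → Proc Tag Name} (hf : IsRun D P N f) (i : ℕ) (hi : (i : ℕ∞) ≤ N) :
    ∃ n', Ty D C (f i) Γ n' ∧ (f i).fn = P.fn := by
  induction i with
  | zero => exact ⟨n, hf.start.symm ▸ h, by rw [hf.start]⟩
  | succ i ih =>
    have hi' : (i : ℕ∞) < N := lt_of_lt_of_le (by exact_mod_cast i.lt_succ_self) hi
    obtain ⟨n', h1, h2⟩ := ih hi'.le
    obtain ⟨n'', h3, h4⟩ := (hf.step i hi').ty hC h1
    exact ⟨n'', h3, h4.trans h2⟩

theorem Ty.fairlyTerminating (hC : C.Sound D) {P : Proc Tag Name} {Γ n} (h : Ty D C P Γ n)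
    (hP : P.fn = ∅) : FairlyTerminating D P := by
  rintro N f hf hfair rfl
  -- Every index of an infinite run is a weakly terminating process, against fairness.
  refine Set.infinite_univ (α := ℕ) (hfair.subset fun i _ => ?_)
  obtain ⟨n', h1, h2⟩ := h.run hC hf i le_top
  exact ⟨le_top, h1.weaklyTerminating hC (h2.trans hP)⟩

theorem Ty.last_run (hC : C.Sound D) {P : Proc Tag Name} {Γ n} (h : Ty D C P Γ n)
    (hP : P.fn = ∅) {k : ℕ} {f : ℕ → Proc Tag Name} (hf : IsRun D P k f) :
    PCong D (f k) .done := by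
  obtain ⟨n', h1, h2⟩ := h.run hC hf k le_rfl
  obtain ⟨_, _, Q, hQ, _⟩ | hd := h1.progress_or_done hC (h2.trans hP)
  · exact (hf.maximal k rfl ⟨Q, hQ⟩).elim
  · exact hd

end CaP

theorem mainTheorem2 {Tag Name : Type} (D : CaP.Program Tag Name)
    (P : CaP.Proc Tag Name) (n : ℕ) (hP : CaP.Typed D P CaP.Ctx.empty n) :
    CaP.FairlyTerminating D P ∧
      ∀ (N : ℕ∞) (f : ℕ → CaP.Proc Tag Name), CaP.IsRun D P N f → CaP.Fair D N f →
        ∃ k : ℕ, N = k ∧ CaP.PCong D (f k) CaP.Proc.done := by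
  have hC := CaP.bodyOracle_sound (D := D)
  -- The process is closed, so the values of the total environment are arbitrary.
  have hty : CaP.Ty D (CaP.bodyOracle D) P (fun _ => CaP.SType.one) n :=
    hP.ty fun x T h => by simp [CaP.Ctx.empty] at h
  have hfn : P.fn = ∅ := by
    ext x
    simp [← hP.dom x, CaP.Ctx.empty]
  have hft := hty.fairlyTerminating hC hfn
  refine ⟨hft, fun N f hf hfair => ?_⟩
  lift N to ℕ using hft N f hf hfair
  exact ⟨N, rfl, hty.last_run hC hfn hf⟩
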